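/- Let $X$ be a two-dimensional regular integral scheme of finite type over $\mathbb{Z}$ and let $\mathcal{A}$ be an Azumaya algebra of degree $d$ on $X$, i.e. a quasi-coherent sheaf of $\mathcal{O}_X$-algebras which over every affine open $U$ is an Azumaya $\mathcal{O}_X(U)$-algebra of constant rank $d^2$. Call a sheaf of left ideals $\mathcal{I}\le\mathcal{A}$ cofinite if $\mathcal{A}/\mathcal{I}$ is a coherent $\mathcal{O}_X$-module supported at finitely many closed points with finite residue field; then $|\mathcal{A}/\mathcal{I}|$ denotes the cardinality of its module of global sections. Consider the formal Dirichlet series $$\zeta_{\mathcal{A}}(s)=\sum_{\mathcal{I}\le\mathcal{A}\ \text{cofinite}}|\mathcal{A}/\mathcal{I}|^{-s},\qquad \zeta_X^{\mathrm{Serre}}(s)=\prod_{x\in X\ \text{closed}}\bigl(1-|\kappa(x)|^{-s}\bigr)^{-1}.$$ Both are well defined: for each $n$ there are only finitely many cofinite $\mathcal{I}$ with $|\mathcal{A}/\mathcal{I}|=n$, and the Euler product converges formally (each coefficient of the finite partial products is eventually constant). Moreover, as an identity of formal Dirichlet series, with a formally convergent product over $n$, $$\zeta_{\mathcal{A}}(s)=\prod_{n=1}^{\infty}\prod_{j=1}^{d}\zeta_X^{\mathrm{Serre}}\bigl(nd(s-1)+j\bigr).$$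 If in addition $X$ is a scheme over a finite field $\mathbb{F}_q$ (so that $X$ is a smooth surface over $\mathbb{F}_q$), consider the formal power series $$Z_{\mathcal{A}}(t)=\sum_{\mathcal{I}\le\mathcal{A}\ \text{cofinite}}t^{\dim_{\mathbb{F}_q}\mathcal{A}/\mathcal{I}},\qquad Z_X^{\mathrm{Serre}}(t)=\prod_{x\in X\ \text{closed}}\bigl(1-t^{[\kappa(x):\mathbb{F}_q]}\bigr)^{-1}.$$ They are well defined in the same sense, and, as an identity of formal power series with a formally convergent product over $n$, $$Z_{\mathcal{A}}(t)=\prod_{n=1}^{\infty}\prod_{j=1}^{d}Z_X^{\mathrm{Serre}}\bigl(q^{-j}(qt)^{dn}\bigr).$$ -/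

import Mathlib

open CategoryTheory AlgebraicGeometry TopologicalSpace Opposite

universe u

noncomputable section

namespace OrderZeta

/-! ### Sheaves of algebras on a scheme -/

/-- The homomorphism `k → 𝒪_X(X)` given by a morphism `X ⟶ Spec k`. -/
def baseHom {X : Scheme.{u}} {k : Type u} [Field k]
    (f : X ⟶ Spec (CommRingCat.of k)) : k →+* Γ(X, ⊤) :=
  ((Scheme.ΓSpecIso (CommRingCat.of k)).inv ≫ f.appTop).hom

/-- A sheaf of (not necessarily commutative) `𝒪_X`-algebras: a sheaf of rings `𝒜` with a
homomorphism `𝒪_X → 𝒜` of sheaves of rings whose image is central. -/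
structure AlgebraSheaf (X : Scheme.{u}) where
  /-- the underlying sheaf of rings -/
  sheaf : TopCat.Sheaf RingCat.{u} X
  /-- the structure homomorphism on sections -/
  unit : ∀ U : X.Opens, Γ(X, U) →+* sheaf.presheaf.obj (op U)
  unit_res : ∀ (U V : X.Opens) (h : V ≤ U) (a : Γ(X, U)),
    (sheaf.presheaf.map (homOfLE h).op).hom (unit U a)
      = unit V ((X.presheaf.map (homOfLE h).op).hom a)
  unit_central : ∀ (U : X.Opens) (a : Γ(X, U)) (b : sheaf.presheaf.obj (op U)),
    unit U a * b = b * unit U a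

namespace AlgebraSheaf

variable {X : Scheme.{u}} (𝒜 : AlgebraSheaf X)

/-- The ring of sections `𝒜(U)`. -/
abbrev sections (U : X.Opens) : Type u := 𝒜.sheaf.presheaf.obj (op U)

/-- The restriction homomorphism `𝒜(U) → 𝒜(V)`. -/
def res {U V : X.Opens} (h : V ≤ U) : 𝒜.sections U →+* 𝒜.sections V :=
  (𝒜.sheaf.presheaf.map (homOfLE h).op).hom

/-- The stalk `𝒜_x`. -/
abbrev stalk (x : X) : Type u := (TopCat.Presheaf.stalk 𝒜.sheaf.presheaf x : RingCat.{u})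

/-- The germ homomorphism `𝒜(U) → 𝒜_x` for `x ∈ U`. -/
def germ (U : X.Opens) (x : X) (hx : x ∈ U) : 𝒜.sections U →+* 𝒜.stalk x :=
  (TopCat.Presheaf.germ 𝒜.sheaf.presheaf U x hx).hom

instance algebraSections (U : X.Opens) : Algebra Γ(X, U) (𝒜.sections U) :=
  (𝒜.unit U).toAlgebra' (𝒜.unit_central U)

/-- `𝒜` is quasi-coherent as an `𝒪_X`-module: for every affine open `U` and `f ∈ 𝒪_X(U)`, the
restriction `𝒜(U) → 𝒜(D(f))` is a localization at the powers of `f`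
(`f` is already invertible on `D(f)`). -/
structure IsQuasicoherent : Prop where
  exists_smul_eq_zero : ∀ (U : X.Opens), IsAffineOpen U → ∀ (f : Γ(X, U)) (s : 𝒜.sections U),
    𝒜.res (X.basicOpen_le f) s = 0 → ∃ n : ℕ, f ^ n • s = 0
  exists_res_eq : ∀ (U : X.Opens), IsAffineOpen U → ∀ (f : Γ(X, U))
    (t : 𝒜.sections (X.basicOpen f)),
    ∃ (n : ℕ) (s : 𝒜.sections U),
      𝒜.res (X.basicOpen_le f) s = 𝒜.res (X.basicOpen_le f) (𝒜.unit U f) ^ n * t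

/-- `𝒜` is an Azumaya algebra of degree `d` on `X`: it is quasi-coherent, and over every affine
open `U` the `𝒪_X(U)`-algebra `𝒜(U)` is Azumaya (in particular finitely generated projective),
of constant rank `d ^ 2`. -/
structure IsAzumayaOfDegree (d : ℕ) : Prop where
  quasicoherent : 𝒜.IsQuasicoherent
  azumaya : ∀ U : X.Opens, IsAffineOpen U → IsAzumaya Γ(X, U) (𝒜.sections U)
  rank : ∀ U : X.Opens, IsAffineOpen U → ∀ p : PrimeSpectrum Γ(X, U),
    Module.rankAtStalk (R := Γ(X, U)) (𝒜.sections U) p = d ^ 2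

/-! ### Sheaves of left ideals -/

/-- A sheaf of left ideals of `𝒜`: a subsheaf `𝓘 ≤ 𝒜` such that `𝓘(U)` is a left ideal of `𝒜(U)`
for every open `U`. (In Mathlib, an `Ideal` of a noncommutative ring is a left ideal.) -/
@[ext]
structure LeftIdeal where
  /-- the sections of the ideal -/
  ideal : ∀ U : X.Opens, Ideal (𝒜.sections U)
  res_mem : ∀ (U V : X.Opens) (h : V ≤ U) (s : 𝒜.sections U), s ∈ ideal U → 𝒜.res h s ∈ ideal V
  mem_of_locally : ∀ (U : X.Opens) (s : 𝒜.sections U),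
    (∀ x ∈ U, ∃ (V : X.Opens) (h : V ≤ U), x ∈ V ∧ 𝒜.res h s ∈ ideal V) → s ∈ ideal U

namespace LeftIdeal

variable {𝒜} (I : 𝒜.LeftIdeal)

/-- The stalk `𝓘_x`, a left ideal of `𝒜_x`. -/
def stalk (x : X) : Ideal (𝒜.stalk x) :=
  Ideal.span {a | ∃ (U : X.Opens) (hx : x ∈ U) (s : 𝒜.sections U),
    s ∈ I.ideal U ∧ 𝒜.germ U x hx s = a}

/-- The support of the quotient `𝒜/𝓘`, whose stalk at `x` is `𝒜_x/𝓘_x`. -/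
def support : Set X := {x | I.stalk x ≠ ⊤}

/-- For a coherent `𝒜` on a locally noetherian scheme: `𝒜/𝓘` is a coherent `𝒪_X`-module supported
at a finite number of closed points with finite residue field.

The first field says that `𝒜/𝓘` (equivalently `𝓘`) is quasi-coherent: on an affine open `U`, the
kernel of `𝒜(U)/𝓘(U) → 𝒜(D(f))/𝓘(D(f))` consists of the elements killed by a power of `f`. The
other half of the localization property (every element of the target becomes, after multiplication
by a power of `f`, an element of the image) and finite generation pass from `𝒜` to `𝒜/𝓘`. -/
structure IsCofinite : Prop where
  quasicoherent : ∀ (U : X.Opens), IsAffineOpen U → ∀ (f : Γ(X, U)) (s : 𝒜.sections U),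
    𝒜.res (X.basicOpen_le f) s ∈ I.ideal (X.basicOpen f) → ∃ n : ℕ, f ^ n • s ∈ I.ideal U
  finite_support : I.support.Finite
  isClosed : ∀ x ∈ I.support, IsClosed ({x} : Set X)
  finite_residueField : ∀ x ∈ I.support, Finite (X.residueField x)

/-- The product of all stalks `𝒜_x/𝓘_x` of the quotient. If the quotient is supported
at finitely many closed points, all but finitely many factors are zero and this is the module of
global sections of `𝒜/𝓘`. -/
abbrev Quot : Type u := ∀ x : X, 𝒜.stalk x ⧸ I.stalk x

/-- The cardinality `|𝒜/𝓘|`. -/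
def card : ℕ := Nat.card I.Quot

end LeftIdeal

/-- The homomorphism `k → 𝒪_X(X) → 𝒜(X) → ∏ x, 𝒜_x`, for a scheme over `k`. -/
def baseToStalks {k : Type u} [Field k] (f : X ⟶ Spec (CommRingCat.of k)) :
    k →+* ∀ x : X, 𝒜.stalk x :=
  (RingHom.pi fun x => 𝒜.germ ⊤ x trivial).comp ((𝒜.unit ⊤).comp (baseHom f))

/-- The dimension `dim_k 𝒜/𝓘`, for a scheme over `k`. -/
def LeftIdeal.dim {𝒜 : AlgebraSheaf X} (I : 𝒜.LeftIdeal) {k : Type u} [Field k]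
    (f : X ⟶ Spec (CommRingCat.of k)) : ℕ :=
  letI : Module k I.Quot := Module.compHom I.Quot (𝒜.baseToStalks f)
  Module.finrank k I.Quot

end AlgebraSheaf

/-! ### Formal Dirichlet series, formal power series and their infinite products -/

/-- The formal Dirichlet series `F` is the (unconditional) infinite product of the `f i`: every
coefficient of the finite partial products is eventually equal to that of `F`. -/
def HasDirichletProd {ι : Type*} (f : ι → ArithmeticFunction ℚ) (F : ArithmeticFunction ℚ) : Prop :=
  ∀ n : ℕ, ∀ᶠ S : Finset ι in Filter.atTop, (∏ i ∈ S, f i) n = F n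

open Classical in
/-- The infinite product of formal Dirichlet series (`0` if it does not exist). -/
def dirichletProd {ι : Type*} (f : ι → ArithmeticFunction ℚ) : ArithmeticFunction ℚ :=
  if h : ∃ F, HasDirichletProd f F then h.choose else 0

/-- The formal power series `F` is the (unconditional) infinite product of the `f i`: every
coefficient of the finite partial products is eventually equal to that of `F`. -/
def HasPowerProd {ι : Type*} (f : ι → PowerSeries ℚ) (F : PowerSeries ℚ) : Prop :=
  ∀ n : ℕ, ∀ᶠ S : Finset ι in Filter.atTop,
    PowerSeries.coeff n (∏ i ∈ S, f i) = PowerSeries.coeff n F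

open Classical in
/-- The infinite product of formal power series (`0` if it does not exist). -/
def powerProd {ι : Type*} (f : ι → PowerSeries ℚ) : PowerSeries ℚ :=
  if h : ∃ F, HasPowerProd f F then h.choose else 0

/-- The formal Dirichlet series `N ^ (-s)`, for `N ≥ 1`. -/
def dirichletMonomial (N : ℕ) : ArithmeticFunction ℚ :=
  ⟨fun m => if m = N ∧ m ≠ 0 then 1 else 0, by simp⟩

/-- The formal Dirichlet series `D(a s + b)`, for `a ≥ 1`: if `D(s) = ∑ c_m m ^ (-s)`, then
`D(a s + b) = ∑ c_m m ^ (-b) (m ^ a) ^ (-s)`. -/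
def dirichletSubst (D : ArithmeticFunction ℚ) (a : ℕ) (b : ℤ) : ArithmeticFunction ℚ :=
  ⟨fun n => ∑ m ∈ n.divisors, if m ^ a = n then D m * (m : ℚ) ^ (-b) else 0, by simp⟩

/-! ### The zeta functions -/

/-- The closed points of `X`. -/
abbrev ClosedPt (X : Scheme.{u}) : Type u := {x : X // IsClosed ({x} : Set X)}

/-- The Euler factor `(1 - |κ(x)| ^ (-s))⁻¹` of the Serre zeta function. -/
def serreFactor (X : Scheme.{u}) (x : ClosedPt X) : ArithmeticFunction ℚ :=
  Ring.inverse (1 - dirichletMonomial (Nat.card (X.residueField x.1)))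

/-- The Serre zeta function `∏_x (1 - |κ(x)| ^ (-s))⁻¹`, as a formal Dirichlet series. -/
def serreZeta (X : Scheme.{u}) : ArithmeticFunction ℚ := dirichletProd (serreFactor X)

/-- The degree `[κ(x) : k]` of a point on a scheme over `k`. -/
def pointDegree {X : Scheme.{u}} {k : Type u} [Field k] (f : X ⟶ Spec (CommRingCat.of k)) (x : X) :
    ℕ :=
  letI : Algebra k (X.residueField x) := ((X.Γevaluation x).hom.comp (baseHom f)).toAlgebra
  Module.finrank k (X.residueField x)

/-- The Euler factor `(1 - t ^ deg x)⁻¹`. -/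
def serreZFactor {X : Scheme.{u}} {k : Type u} [Field k] (f : X ⟶ Spec (CommRingCat.of k))
    (x : ClosedPt X) : PowerSeries ℚ :=
  (1 - PowerSeries.X ^ pointDegree f x.1)⁻¹

/-- The Serre zeta function `∏_x (1 - t ^ deg x)⁻¹` of a scheme over `k`, as a formal power
series in `t`. -/
def serreZ {X : Scheme.{u}} {k : Type u} [Field k] (f : X ⟶ Spec (CommRingCat.of k)) :
    PowerSeries ℚ :=
  powerProd (serreZFactor f)

namespace AlgebraSheaf

variable {X : Scheme.{u}} (𝒜 : AlgebraSheaf X)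

/-- The cofinite sheaves of left ideals with `|𝒜/𝓘| = n`. -/
def idealsOfCard (n : ℕ) : Set 𝒜.LeftIdeal := {I | I.IsCofinite ∧ I.card = n}

/-- The zeta function `∑_𝓘 |𝒜/𝓘| ^ (-s)` over the cofinite sheaves of left ideals, as a formal
Dirichlet series. -/
def zeta : ArithmeticFunction ℚ :=
  ⟨fun n => if n = 0 then 0 else ((𝒜.idealsOfCard n).ncard : ℚ), by simp⟩

/-- The cofinite sheaves of left ideals with `dim_k 𝒜/𝓘 = n`. -/
def idealsOfDim {k : Type u} [Field k] (f : X ⟶ Spec (CommRingCat.of k)) (n : ℕ) :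
    Set 𝒜.LeftIdeal := {I | I.IsCofinite ∧ I.dim f = n}

/-- The zeta function `∑_𝓘 t ^ (dim_k 𝒜/𝓘)` over the cofinite sheaves of left ideals, as a formal
power series in `t`. -/
def zetaZ {k : Type u} [Field k] (f : X ⟶ Spec (CommRingCat.of k)) : PowerSeries ℚ :=
  PowerSeries.mk fun n => ((𝒜.idealsOfDim f n).ncard : ℚ)

end AlgebraSheaf

end OrderZeta

end

/-!
The zeta function of an Azumaya algebra `𝒜` of degree `d` on a two-dimensional regular scheme `X`
of finite type over `ℤ` is a product of local factors at the closed points, and each local factor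
depends only on `d` and on the order `q` of the residue field.

*Localization.* A cofinite sheaf of left ideals is determined by its stalks, which are left ideals
of finite index, equal to the whole stalk outside a finite set of closed points; conversely all such
families occur (`AlgebraSheaf.card_idealsOfCard`). Only the finitely many closed points with residue
field of at most `n` elements matter for index `n`.

*Removing the algebra.* A left ideal of index `N` of the stalk `𝒜_x` contains `𝔪 ^ N 𝒜_x`, so that
left ideals can be counted in the reduction of `𝒜` modulo `𝔪 ^ N`. This is an Azumaya algebra over a
finite local ring, whose fibre over the finite residue field is a matrix algebra by the theorems of
Wedderburn. Matrix units lift (`IsLocalRing.nonempty_ringEquiv_matrix`), so the reduction is itself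
a matrix algebra, and by Morita equivalence its left ideals of index `N` correspond to submodules of
a free module of rank `d`, of index `N'` with `N' ^ d = N`
(`IsAzumaya.card_ideal_natCard_quotient_eq`).

*The local count.* It remains to count submodules `N` of finite index in `M = O ^ d`, for a regular
local ring `O` of dimension two. Choose `y ∈ 𝔪 ∖ 𝔪²`, so that `V = O / y` is a discrete valuation
ring. Sorting the submodules `N` by `N' = (N : y)` and by the image `L` of `N` in `V ^ d`, which is
contained in the image `L'` of `N'`, gives `|M / N| = |M / N'| |V ^ d / L|`, and there are
`|V ^ d / L'| ^ d` submodules for each such pair, because `L` is free and the lifts of a basis form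
a torsor. As `L'` is again free of rank `d`, the sum over `L` splits off as the generating series of
the submodules of `V ^ d`, which is a product of `d` geometric series. Iterating this
(`surfaceSeries_succ`) gives
`∏ (1 - q ^ (d i + j) q ^ (-d (i + 1) s))⁻¹` over `i ≥ 0` and `0 ≤ j < d`
(`IsRegularLocalRing.submoduleSeries_apply`). The sums are formed with coefficients in `ℝ≥0∞`, where
they always make sense; finiteness is read off from the result.

*Dimension.* That the local rings at all closed points have dimension two follows from the
presentation of an affine open as a quotient of a polynomial ring over `ℤ`, all of whose maximal
ideals have the same height: for regular local rings, dimension and codimension add up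
(`IsRegularLocalRing.le_height_ker`).

*Assembly.* The factor at `x` with indices `i`, `j` is the Euler factor of the Serre zeta function
at `n d (s - 1) + (d - j)`, with `n = i + 1`, and both sides of the product formula are compared up
to any given order, where all products are finite. Over a finite field with `q` elements, power
series in `t` embed into Dirichlet series by `t = q ^ (-s)`, which turns the second product formula
into the first.
-/

universe v

/-! ### Regular local rings and the dimension of their regular quotients -/

section RegularLocalRing

open IsLocalRing

/-- Killing an element of `𝔪 ∖ 𝔪²` makes the minimal number of generators of `𝔪` drop. -/
theorem IsLocalRing.spanFinrank_maximalIdeal_quotient_succ_le {S : Type*} [CommRing S]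
    [IsLocalRing S] [IsNoetherianRing S] {x : S} (hx : x ∈ maximalIdeal S)
    (hx2 : x ∉ maximalIdeal S ^ 2) [IsLocalRing (S ⧸ Ideal.span {x})] :
    (maximalIdeal (S ⧸ Ideal.span {x})).spanFinrank + 1 ≤ (maximalIdeal S).spanFinrank := by
  classical
  set m := maximalIdeal S
  let x' : m := ⟨x, hx⟩
  have hne : m.toCotangent x' ≠ 0 := by
    rw [Ne, Ideal.toCotangent_eq_zero]; exact hx2
  have hli : LinearIndepOn (ResidueField S) id ({m.toCotangent x'} : Set (CotangentSpace S)) :=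
    LinearIndepOn.singleton hne
  let b := Module.Basis.extend hli
  have hb := b.span_eq
  rw [Module.Basis.range_extend hli] at hb
  have hsub := hli.subset_extend (Set.subset_univ _)
  set E := hli.extend (Set.subset_univ _)
  have hE : E.Finite := b.finite_index_of_rank_lt_aleph0 (Module.rank_lt_aleph0 _ _)
  have hcard : Module.finrank (ResidueField S) (CotangentSpace S) = hE.toFinset.card := by
    rw [Module.finrank_eq_nat_card_basis b, Nat.card_coe_set_eq, Set.ncard_eq_toFinset_card E hE]
  -- a lift of the basis containing `x` itself
  let g : CotangentSpace S → m := fun v => if v = m.toCotangent x' then x' else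
    (m.toCotangent_surjective v).choose
  have hg : ∀ v, m.toCotangent (g v) = v := by
    intro v
    by_cases h : v = m.toCotangent x'
    · simp only [g, h, if_true]
    · simp only [g, h, if_false]; exact (m.toCotangent_surjective v).choose_spec
  have hspan : Submodule.span S (g '' E) = ⊤ := by
    rw [← CotangentSpace.span_image_eq_top_iff, Set.image_image]
    simp only [m] at hg
    simp only [m, hg, Set.image_id']
    exact hb
  have hspan' : Ideal.span ((fun v => (g v : S)) '' E) = m := by
    have := congrArg (Submodule.map m.subtype) hspan
    rw [Submodule.map_span, Submodule.map_top, Submodule.range_subtype, Set.image_image] at this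
    exact this
  have hmax := map_maximalIdeal_of_surjective (Ideal.Quotient.mk (Ideal.span {x}))
    Ideal.Quotient.mk_surjective
  let s : Finset (S ⧸ Ideal.span {x}) :=
    (hE.toFinset.erase (m.toCotangent x')).image fun v => Ideal.Quotient.mk _ (g v : S)
  have hs : Ideal.span (s : Set (S ⧸ Ideal.span {x})) = maximalIdeal _ := by
    apply le_antisymm
    · rw [Ideal.span_le, ← hmax]
      intro y hy
      simp only [s, Finset.coe_image, Set.mem_image] at hy
      obtain ⟨v, -, rfl⟩ := hy
      exact Ideal.mem_map_of_mem _ (g v).2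
    · rw [← hmax]
      change m.map _ ≤ _
      rw [← hspan', Ideal.map_span, Ideal.span_le]
      rintro _ ⟨_, ⟨v, hv, rfl⟩, rfl⟩
      by_cases h : v = m.toCotangent x'
      · have : Ideal.Quotient.mk (Ideal.span {x}) (g v : S) = 0 := by
          simp only [g, h, if_true, x']
          exact Ideal.Quotient.eq_zero_iff_mem.2 (Ideal.mem_span_singleton_self x)
        simp only [this]
        exact Submodule.zero_mem _
      · apply Ideal.subset_span
        simp only [s, Finset.coe_image, Set.mem_image]
        exact ⟨v, by simp [h, hv], rfl⟩
  rw [IsLocalRing.spanFinrank_maximalIdeal_eq_finrank_cotangentSpace (R := S), hcard, ← hs]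
  have h1 : m.toCotangent x' ∈ hE.toFinset := by simpa using hsub rfl
  have h2 := Submodule.spanFinrank_span_le_ncard_of_finite (R := S ⧸ Ideal.span {x})
    s.finite_toSet
  rw [Set.ncard_coe_finset] at h2
  have h3 : s.card ≤ (hE.toFinset.erase (m.toCotangent x')).card := Finset.card_image_le
  rw [Finset.card_erase_of_mem h1] at h3
  have h4 : 0 < hE.toFinset.card := Finset.card_pos.2 ⟨_, h1⟩
  have h5 : (Ideal.span (s : Set (S ⧸ Ideal.span {x}))).spanFinrank ≤ s.card := h2
  omega

theorem IsLocalRing.isLocalRing_quotient_span_singleton {S : Type*} [CommRing S]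
    [IsLocalRing S] {x : S} (hx : x ∈ maximalIdeal S) : IsLocalRing (S ⧸ Ideal.span {x}) := by
  have : Nontrivial (S ⧸ Ideal.span {x}) := by
    rw [Ideal.Quotient.nontrivial_iff, Ne, Ideal.span_singleton_eq_top]
    exact (mem_maximalIdeal x).1 hx
  exact .of_surjective' _ Ideal.Quotient.mk_surjective

/-- A quotient of a regular local ring by an element of `𝔪 ∖ 𝔪²` is regular, of dimension one
less. -/
theorem IsRegularLocalRing.quotient_span_singleton {S : Type*} [CommRing S]
    [IsRegularLocalRing S] {x : S} (hx : x ∈ maximalIdeal S) (hx2 : x ∉ maximalIdeal S ^ 2) :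
    IsRegularLocalRing (S ⧸ Ideal.span {x}) ∧
      ringKrullDim (S ⧸ Ideal.span {x}) + 1 = ringKrullDim S := by
  have := isLocalRing_quotient_span_singleton hx
  have h1 := spanFinrank_maximalIdeal_quotient_succ_le hx hx2
  have h2 : ringKrullDim S ≤ ringKrullDim (S ⧸ Ideal.span {x}) + 1 := by
    simpa using ringKrullDim_le_ringKrullDim_quotient_add_encard ({x} : Set S) (by
      rw [ringJacobson_eq_maximalIdeal]; simpa using hx)
  have h3 := ringKrullDim_le_spanFinrank_maximalIdeal (S ⧸ Ideal.span {x})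
  have h4 := (isRegularLocalRing_iff S).1 inferInstance
  have h5 : ((maximalIdeal S).spanFinrank : WithBot ℕ∞) ≤
      (maximalIdeal (S ⧸ Ideal.span {x})).spanFinrank + 1 := by
    rw [h4]; exact h2.trans (add_le_add_left h3 1)
  have h6 : (maximalIdeal S).spanFinrank = (maximalIdeal (S ⧸ Ideal.span {x})).spanFinrank + 1 := by
    apply le_antisymm _ h1
    exact_mod_cast h5
  have h7 : ((maximalIdeal (S ⧸ Ideal.span {x})).spanFinrank : WithBot ℕ∞) ≤
      ringKrullDim (S ⧸ Ideal.span {x}) := by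
    rw [← h4, h6, Nat.cast_succ] at h2
    revert h2
    cases ringKrullDim (S ⧸ Ideal.span {x}) with
    | bot => intro h; simp at h
    | coe a =>
      intro h
      norm_cast at h ⊢
      exact (ENat.add_le_add_iff_right (by simp)).1 h
  have hreg := IsRegularLocalRing.of_spanFinrank_maximalIdeal_le _ h7
  refine ⟨hreg, ?_⟩
  rw [← h4, h6, ← (isRegularLocalRing_iff _).1 hreg]
  norm_cast

/-- A regular local ring is a domain, by induction on the dimension: for some `x ∈ 𝔪 ∖ 𝔪²` outside
all minimal primes, `(x)` is prime by induction, and a minimal prime `q ≤ (x)` satisfies `q = x q`,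
so that it vanishes. -/
theorem IsRegularLocalRing.isDomain_of_ringKrullDim_eq (n : ℕ) (S : Type u) [CommRing S]
    [IsRegularLocalRing S] (hn : ringKrullDim S = n) : IsDomain S := by
  induction n generalizing S with
  | zero =>
    have h4 := (isRegularLocalRing_iff S).1 inferInstance
    rw [hn] at h4
    have h5 : (maximalIdeal S).spanFinrank = 0 := by exact_mod_cast h4
    rw [Submodule.spanFinrank_eq_zero_iff_eq_bot (maximalIdeal S).fg_of_isNoetherianRing] at h5
    exact (isField_iff_maximalIdeal_eq.2 h5).isDomain
  | succ n ih =>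
    have hfin : (minimalPrimes S).Finite := minimalPrimes.finite_of_isNoetherianRing S
    -- prime avoidance: some `x ∈ 𝔪 ∖ 𝔪²` lies in no minimal prime
    obtain ⟨x, hx, hx2, hxp⟩ : ∃ x ∈ maximalIdeal S, x ∉ maximalIdeal S ^ 2 ∧
        ∀ p ∈ minimalPrimes S, x ∉ p := by
      by_contra! hcon
      have hsub : (maximalIdeal S : Set S) ⊆ ⋃ i ∈ (↑(insert (maximalIdeal S ^ 2) hfin.toFinset) :
          Set (Ideal S)), (id i : Ideal S) := by
        intro x hx
        by_cases h : x ∈ maximalIdeal S ^ 2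
        · exact Set.mem_biUnion (x := maximalIdeal S ^ 2) (by simp) h
        · obtain ⟨p, hp, hxp⟩ := hcon x hx h
          exact Set.mem_biUnion (x := p) (by simp [hp]) hxp
      rw [Ideal.subset_union_prime (maximalIdeal S ^ 2) (maximalIdeal S ^ 2)] at hsub
      · obtain ⟨i, hi, hle⟩ := hsub
        have hht := maximalIdeal_height_eq_ringKrullDim (R := S)
        simp only [Finset.mem_insert, Set.Finite.mem_toFinset] at hi
        rcases hi with rfl | hi
        · have : maximalIdeal S = ⊥ := by
            apply Submodule.eq_bot_of_le_smul_of_le_jacobson_bot (maximalIdeal S) _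
              (maximalIdeal S).fg_of_isNoetherianRing
            · rw [smul_eq_mul, ← pow_two]; exact hle
            · exact (jacobson_eq_maximalIdeal _ bot_ne_top).ge
          have h4 := (isRegularLocalRing_iff S).1 inferInstance
          rw [this, Submodule.spanFinrank_bot, hn] at h4
          norm_cast at h4
        · have hip : i.IsPrime := hi.1.1
          have : i = maximalIdeal S := le_antisymm (le_maximalIdeal hip.ne_top) hle
          rw [this] at hi
          rw [Ideal.height_eq_zero_iff.2 hi, hn] at hht
          norm_cast at hht
      · intro i hi h1 _
        simp only [Finset.mem_insert, h1, Set.Finite.mem_toFinset, false_or] at hi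
        exact hi.1.1
    obtain ⟨hreg, hdim⟩ := IsRegularLocalRing.quotient_span_singleton hx hx2
    have hd : ringKrullDim (S ⧸ Ideal.span {x}) = n := by
      rw [hn] at hdim
      revert hdim
      cases ringKrullDim (S ⧸ Ideal.span {x}) with
      | bot => intro h; simp at h; norm_cast at h
      | coe a =>
        intro h
        push_cast at h
        norm_cast at h ⊢
        exact ENat.add_left_injective_of_ne_top (by simp) h
    have hdom := ih _ hd
    have hprime : (Ideal.span {x}).IsPrime := (Ideal.Quotient.isDomain_iff_prime _).1 hdom
    obtain ⟨q, hq, hqx⟩ := Ideal.exists_minimalPrimes_le (J := Ideal.span {x}) (bot_le (a := _))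
    have hqp : q.IsPrime := hq.1.1
    have hqb : q = ⊥ := by
      apply Submodule.eq_bot_of_le_smul_of_le_jacobson_bot (maximalIdeal S) _
        q.fg_of_isNoetherianRing
      · intro a ha
        obtain ⟨b, rfl⟩ := Ideal.mem_span_singleton'.1 (hqx ha)
        have hb : b ∈ q := (hqp.mem_or_mem ha).resolve_right (hxp q hq)
        rw [mul_comm]
        exact Submodule.smul_mem_smul hx hb
      · exact (jacobson_eq_maximalIdeal _ bot_ne_top).ge
    rw [hqb] at hqp
    exact IsDomain.of_bot_isPrime S

theorem IsRegularLocalRing.isDomain (S : Type u) [CommRing S] [IsRegularLocalRing S] :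
    IsDomain S :=
  isDomain_of_ringKrullDim_eq _ S ((isRegularLocalRing_iff S).1 inferInstance).symm

/-- In a domain, pulling back a prime along a quotient map with nonzero kernel raises its height. -/
theorem Ideal.height_add_one_le_height_comap {S R : Type*} [CommRing S] [IsDomain S]
    [CommRing R] [IsNoetherianRing R] (f : S →+* R) (hf : Function.Surjective f)
    (hker : RingHom.ker f ≠ ⊥) (Q : Ideal R) [Q.IsPrime] :
    Q.height + 1 ≤ (Q.comap f).height := by
  obtain ⟨l, hl, hlen⟩ := Ideal.exists_ltSeries_length_eq_height Q
  let φ : PrimeSpectrum R → PrimeSpectrum S := PrimeSpectrum.comap f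
  have hφ : StrictMono φ := by
    intro p q hpq
    refine lt_of_le_of_ne (Ideal.comap_mono hpq.le) fun h => hpq.ne ?_
    exact PrimeSpectrum.comap_injective_of_surjective f hf h
  let l' := l.map φ hφ
  have hbot : (⟨⊥, Ideal.isPrime_bot⟩ : PrimeSpectrum S) < l'.head := by
    rw [← PrimeSpectrum.asIdeal_lt_asIdeal]
    refine lt_of_lt_of_le (bot_lt_iff_ne_bot.2 hker) ?_
    exact Ideal.ker_le_comap (K := (l.head).asIdeal) f
  let l'' := l'.cons _ hbot
  have hlast : l''.last = ⟨Q.comap f, inferInstance⟩ := by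
    simp only [l'', RelSeries.last_cons]
    change φ l.last = _
    rw [hl]; rfl
  have := Order.length_le_height (p := l'') (x := ⟨Q.comap f, inferInstance⟩) hlast.le
  rw [← PrimeSpectrum.height_eq_orderHeight] at this
  refine le_trans ?_ this
  rw [← hlen]
  simp [l'', l', RelSeries.cons, RelSeries.append]

/-- A regular quotient of a regular local ring is cut out by part of a regular system of
parameters, so that dimension and codimension add up. -/
theorem IsRegularLocalRing.le_height_ker (n : ℕ) (S : Type u) [CommRing S] [IsRegularLocalRing S]
    (hn : ringKrullDim S = n) {R : Type v} [CommRing R] [IsRegularLocalRing R] (f : S →+* R)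
    (hf : Function.Surjective f) : ringKrullDim S ≤ (RingHom.ker f).height + ringKrullDim R := by
  induction n using Nat.strong_induction_on generalizing S with
  | _ n ih =>
  have := IsRegularLocalRing.isDomain S
  have := IsRegularLocalRing.isDomain R
  have hmap := map_maximalIdeal_of_surjective f hf
  by_cases hker : RingHom.ker f = ⊥
  · have e : S ≃+* R := RingEquiv.ofBijective f ⟨(RingHom.injective_iff_ker_eq_bot f).2 hker, hf⟩
    rw [hker, ringKrullDim_eq_of_ringEquiv e]
    simp
  have hle0 : (0 : WithBot ℕ∞) ≤ (RingHom.ker f).height := WithBot.coe_le_coe.2 bot_le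
  have hkm : RingHom.ker f ≤ maximalIdeal S := le_maximalIdeal (RingHom.ker_ne_top f)
  by_cases hx : ∃ x ∈ RingHom.ker f, x ∉ maximalIdeal S ^ 2
  · obtain ⟨x, hxk, hx2⟩ := hx
    obtain ⟨hreg, hdim⟩ := IsRegularLocalRing.quotient_span_singleton (hkm hxk) hx2
    cases n with
    | zero =>
      have h1 := ringKrullDim_nonneg_of_nontrivial (R := S ⧸ Ideal.span {x})
      rw [hn] at hdim
      revert h1 hdim
      cases ringKrullDim (S ⧸ Ideal.span {x}) with
      | bot => simp
      | coe a => intro h2 h1; norm_cast at h2; simp at h2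
    | succ n =>
      have hd : ringKrullDim (S ⧸ Ideal.span {x}) = n := by
        rw [hn] at hdim
        revert hdim
        cases ringKrullDim (S ⧸ Ideal.span {x}) with
        | bot => intro h; simp at h; norm_cast at h
        | coe a =>
          intro h
          push_cast at h
          norm_cast at h ⊢
          exact ENat.add_left_injective_of_ne_top (by simp) h
      have hdom := IsRegularLocalRing.isDomain (S ⧸ Ideal.span {x})
      let g : S ⧸ Ideal.span {x} →+* R := Ideal.Quotient.lift (Ideal.span {x}) f (by
        intro a ha
        obtain ⟨b, rfl⟩ := Ideal.mem_span_singleton'.1 ha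
        rw [map_mul, (RingHom.mem_ker).1 hxk, mul_zero])
      have hg : Function.Surjective g := Ideal.Quotient.lift_surjective_of_surjective _ _ hf
      have h1 := ih n (Nat.lt_succ_self n) _ hd g hg
      have hcomap : (RingHom.ker g).comap (Ideal.Quotient.mk (Ideal.span {x})) = RingHom.ker f := by
        ext a
        simp [g, RingHom.mem_ker]
      have hkp : (RingHom.ker g).IsPrime := RingHom.ker_isPrime g
      have h2 := Ideal.height_add_one_le_height_comap (Ideal.Quotient.mk (Ideal.span {x}))
        Ideal.Quotient.mk_surjective (by
          rw [Ideal.mk_ker, Ne, Ideal.span_singleton_eq_bot]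
          rintro rfl; exact hx2 (zero_mem _)) (RingHom.ker g)
      rw [hcomap] at h2
      have h3 : ((RingHom.ker g).height : WithBot ℕ∞) + 1 ≤ (RingHom.ker f).height := by
        exact_mod_cast h2
      calc ringKrullDim S = ringKrullDim (S ⧸ Ideal.span {x}) + 1 := hdim.symm
        _ ≤ (RingHom.ker g).height + ringKrullDim R + 1 := add_le_add_left h1 1
        _ = ((RingHom.ker g).height + 1) + ringKrullDim R := by rw [add_right_comm]
        _ ≤ _ := add_le_add_left h3 _
  · -- a quotient by an ideal inside `𝔪²` has the same embedding dimension
    push Not at hx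
    obtain ⟨s, hs⟩ : ∃ s : Finset R, Ideal.span (s : Set R) = maximalIdeal R ∧
        s.card = (maximalIdeal R).spanFinrank := by
      have hfg := (maximalIdeal R).fg_of_isNoetherianRing
      refine ⟨(Submodule.FG.finite_generators hfg).toFinset, ?_, ?_⟩
      · simpa using (maximalIdeal R).span_generators
      · rw [← Set.ncard_eq_toFinset_card _ (Submodule.FG.finite_generators hfg)]
        exact Submodule.FG.generators_ncard hfg
    classical
    let t : Finset S := s.image (Function.surjInv hf)
    have hspan : Ideal.span (t : Set S) = maximalIdeal S := by
      have htm : Ideal.span (t : Set S) ≤ maximalIdeal S := by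
        rw [Ideal.span_le]
        intro a ha
        obtain ⟨b, hb, rfl⟩ := Finset.mem_image.1 (Finset.mem_coe.1 ha)
        by_contra hu
        rw [SetLike.mem_coe, mem_maximalIdeal, mem_nonunits_iff, not_not] at hu
        have h1 := hu.map f
        rw [Function.surjInv_eq hf] at h1
        have h2 : b ∈ maximalIdeal R := hs.1 ▸ Ideal.subset_span hb
        exact h2 h1
      refine le_antisymm htm ?_
      apply Submodule.le_of_le_smul_of_le_jacobson_bot (maximalIdeal S).fg_of_isNoetherianRing
        (jacobson_eq_maximalIdeal _ bot_ne_top).ge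
      intro a ha
      have h1 : f a ∈ Ideal.map f (Ideal.span (t : Set S)) := by
        rw [Ideal.map_span]
        have : f '' (t : Set S) = s := by
          simp only [t, Finset.coe_image, Set.image_image, Function.surjInv_eq hf, Set.image_id']
        rw [this, hs.1, ← hmap]
        exact Ideal.mem_map_of_mem _ ha
      obtain ⟨b, hb, hba⟩ := (Ideal.mem_map_iff_of_surjective f hf).1 h1
      rw [← sub_add_cancel a b, add_comm]
      refine Submodule.add_mem_sup hb ?_
      rw [smul_eq_mul, ← pow_two]
      exact hx _ (by rw [RingHom.mem_ker, map_sub, hba, sub_self])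
    have h1 : (maximalIdeal S).spanFinrank ≤ (maximalIdeal R).spanFinrank := by
      rw [← hspan, ← hs.2]
      refine (Submodule.spanFinrank_span_le_ncard_of_finite t.finite_toSet).trans ?_
      rw [Set.ncard_coe_finset]
      exact Finset.card_image_le
    calc ringKrullDim S = (maximalIdeal S).spanFinrank := ((isRegularLocalRing_iff S).1 ‹_›).symm
      _ ≤ (maximalIdeal R).spanFinrank := by exact_mod_cast h1
      _ = ringKrullDim R := (isRegularLocalRing_iff R).1 ‹_›
      _ ≤ _ := le_add_of_nonneg_left hle0

/-- The general half of the equality of dimension and codimension: chains of primes below and above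
the kernel can be concatenated. -/
theorem RingHom.height_ker_add_ringKrullDim_le {S R : Type*} [CommRing S] [CommRing R] [IsDomain R]
    (f : S →+* R) (hf : Function.Surjective f) :
    ((RingHom.ker f).height : WithBot ℕ∞) + ringKrullDim R ≤ ringKrullDim S := by
  have hP : (RingHom.ker f).IsPrime := RingHom.ker_isPrime f
  have := f.domain_nontrivial
  let φ : PrimeSpectrum R → PrimeSpectrum S := PrimeSpectrum.comap f
  have hφ : StrictMono φ := by
    intro p q hpq
    refine lt_of_le_of_ne (Ideal.comap_mono hpq.le) fun h => hpq.ne ?_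
    exact PrimeSpectrum.comap_injective_of_surjective f hf h
  have h0 : φ ⊥ = ⟨RingHom.ker f, hP⟩ := rfl
  have h1 := Order.coheight_le_coheight_apply_of_strictMono φ hφ ⊥
  have h2 : ringKrullDim R = Order.coheight (⊥ : PrimeSpectrum R) :=
    Order.coheight_bot_eq_krullDim.symm
  have h3 : ringKrullDim S = _ := Order.krullDim_eq_iSup_height_add_coheight_of_nonempty
  have h4 := PrimeSpectrum.height_eq_orderHeight ⟨RingHom.ker f, hP⟩
  rw [h0] at h1
  rw [h2, h3, h4, ← WithBot.coe_add]
  refine WithBot.coe_le_coe.2 ((add_le_add_right h1 _).trans ?_)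
  exact le_iSup (fun a : PrimeSpectrum S => Order.height a + Order.coheight a) ⟨RingHom.ker f, hP⟩

instance Int.isJacobsonRing : IsJacobsonRing ℤ := by
  rw [isJacobsonRing_iff_prime_eq]
  intro P hP
  by_cases h : P = ⊥
  · rw [h, eq_bot_iff]
    intro x hx
    have h1 := Ideal.mem_jacobson_bot.1 hx x
    rw [Int.isUnit_iff] at h1
    rw [Ideal.mem_bot]
    nlinarith [mul_self_nonneg x, h1.resolve_right (by nlinarith [mul_self_nonneg x])]
  · have := hP.isMaximal h
    exact Ideal.jacobson_eq_self_of_isMaximal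

theorem MvPolynomial.height_eq_of_isMaximal (n : ℕ) (M : Ideal (MvPolynomial (Fin n) ℤ))
    [hM : M.IsMaximal] : M.height = n + 1 := by
  induction n with
  | zero =>
    let e := isEmptyRingEquiv ℤ (Fin 0)
    rw [← e.height_map]
    have : (M.map e).IsMaximal := Ideal.map_isMaximal_of_equiv e
    rw [IsPrincipalIdealRing.height_eq_one_of_isMaximal _ Int.not_isField]
    simp
  | succ n ih =>
    let e := (finSuccEquiv ℤ n).toRingEquiv
    rw [← e.height_map]
    have : (M.map e).IsMaximal := Ideal.map_isMaximal_of_equiv e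
    have hj : IsJacobsonRing (MvPolynomial (Fin n) ℤ) := isJacobsonRing_of_finiteType (A := ℤ)
    have h2 : ((M.map e).comap Polynomial.C).IsMaximal :=
      Polynomial.isMaximal_comap_C_of_isJacobsonRing _
    have h3 : (M.map e).LiesOver ((M.map e).comap Polynomial.C) := ⟨rfl⟩
    rw [Polynomial.height_eq_height_add_one ((M.map e).comap Polynomial.C), ih]
    simp

/-- The local rings of a regular domain of finite type over `ℤ` at the maximal ideals all have the
same dimension, which is computed from the height of the ideal of relations. -/
theorem ringKrullDim_add_height_ker_eq {n : ℕ} {R : Type u} [CommRing R] [IsDomain R]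
    (φ : MvPolynomial (Fin n) ℤ →+* R) (hφ : Function.Surjective φ) (m : Ideal R) [m.IsMaximal]
    (Rm : Type v) [CommRing Rm] [Algebra R Rm] [IsLocalization.AtPrime Rm m]
    [IsRegularLocalRing Rm] :
    ((RingHom.ker φ).height : WithBot ℕ∞) + ringKrullDim Rm = n + 1 := by
  let M := m.comap φ
  have hM : M.IsMaximal := Ideal.comap_isMaximal_of_surjective φ hφ
  let S := Localization.AtPrime M
  have := IsRegularLocalRing.isDomain Rm
  let f : S →+* Rm := IsLocalization.lift (M := M.primeCompl) (g := (algebraMap R Rm).comp φ)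
    (fun y => IsLocalization.map_units (M := m.primeCompl) Rm ⟨φ y, y.2⟩)
  have hfa : ∀ x, f (algebraMap _ S x) = algebraMap R Rm (φ x) := fun x => by simp [f]
  have hf : Function.Surjective f := by
    intro z
    obtain ⟨⟨a, s⟩, h⟩ := IsLocalization.surj (M := m.primeCompl) z
    obtain ⟨a', rfl⟩ := hφ a
    obtain ⟨s', hs'⟩ := hφ s
    have hs'' : s' ∈ M.primeCompl := by
      change φ s' ∉ m
      rw [hs']; exact s.2
    refine ⟨IsLocalization.mk' S a' ⟨s', hs''⟩, ?_⟩
    apply (IsLocalization.map_units (M := m.primeCompl) Rm s).mul_right_cancel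
    have h1 : algebraMap R Rm s = f (algebraMap _ S s') := by rw [hfa, hs']
    have h2 : algebraMap R Rm (φ a') = f (algebraMap _ S a') := by rw [hfa]
    simp only at h
    rw [h, h1, h2, ← map_mul]
    congr 1
    exact IsLocalization.mk'_spec S a' ⟨s', hs''⟩
  have hdim : ringKrullDim S = ((n + 1 : ℕ) : WithBot ℕ∞) := by
    rw [IsLocalization.AtPrime.ringKrullDim_eq_height M, MvPolynomial.height_eq_of_isMaximal]
    rfl
  have hinj : Function.Injective (algebraMap R Rm) :=
    IsLocalization.injective Rm (Ideal.primeCompl_le_nonZeroDivisors m)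
  have hker : (RingHom.ker f).under (MvPolynomial (Fin n) ℤ) = RingHom.ker φ := by
    ext x
    simp only [Ideal.under_def, Ideal.mem_comap, RingHom.mem_ker, hfa]
    exact map_eq_zero_iff _ hinj
  have hreg : IsRegularLocalRing S := inferInstance
  have h1 := IsRegularLocalRing.le_height_ker _ S hdim f hf
  have h2 := f.height_ker_add_ringKrullDim_le hf
  rw [← IsLocalization.height_under M.primeCompl, hker] at h1 h2
  rw [le_antisymm h2 h1, hdim]
  rfl

/-- A regular local ring of dimension one is a discrete valuation ring. -/
theorem IsRegularLocalRing.isDiscreteValuationRing {V : Type u} [CommRing V] [IsRegularLocalRing V]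
    (h : ringKrullDim V = 1) : ∃ _ : IsDomain V, IsDiscreteValuationRing V := by
  have := IsRegularLocalRing.isDomain V
  have h4 := (isRegularLocalRing_iff V).1 inferInstance
  have hn : ¬ IsField V := fun hf => by
    rw [ringKrullDim_eq_zero_of_isField hf] at h; norm_num at h
  have h5 : (maximalIdeal V).spanFinrank = 1 := by rw [h] at h4; exact_mod_cast h4
  refine ⟨this, ((IsDiscreteValuationRing.TFAE V hn).out 0 5).2 ?_⟩
  rw [← spanFinrank_maximalIdeal_eq_finrank_cotangentSpace, h5]

/-- In a two-dimensional regular local ring there is an `x` such that `S / x` is a discrete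
valuation ring. -/
theorem IsRegularLocalRing.exists_isDiscreteValuationRing_quotient {S : Type u} [CommRing S]
    [IsRegularLocalRing S] (h : ringKrullDim S = 2) :
    ∃ x ∈ maximalIdeal S, x ≠ 0 ∧ ∃ _ : IsDomain (S ⧸ Ideal.span {x}),
      IsDiscreteValuationRing (S ⧸ Ideal.span {x}) := by
  obtain ⟨x, hx, hx2⟩ : ∃ x ∈ maximalIdeal S, x ∉ maximalIdeal S ^ 2 := by
    by_contra! hcon
    have : maximalIdeal S = ⊥ := by
      apply Submodule.eq_bot_of_le_smul_of_le_jacobson_bot (maximalIdeal S) _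
        (maximalIdeal S).fg_of_isNoetherianRing
      · rw [smul_eq_mul, ← pow_two]; exact hcon
      · exact (jacobson_eq_maximalIdeal _ bot_ne_top).ge
    rw [ringKrullDim_eq_zero_of_isField (isField_iff_maximalIdeal_eq.2 this)] at h
    norm_num at h
  obtain ⟨hreg, hdim⟩ := IsRegularLocalRing.quotient_span_singleton hx hx2
  refine ⟨x, hx, fun h0 => hx2 (h0 ▸ zero_mem _), IsRegularLocalRing.isDiscreteValuationRing ?_⟩
  rw [h] at hdim
  revert hdim
  cases ringKrullDim (S ⧸ Ideal.span {x}) with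
  | bot => intro h; simp at h
  | coe a =>
    intro h
    have h' : a + 1 = 1 + 1 := by
      exact WithBot.coe_eq_coe.1 (h.trans (by norm_num))
    exact_mod_cast ENat.add_left_injective_of_ne_top (by simp) h'

end RegularLocalRing

/-! ### Submodules of an extension -/

section Extension

variable {O V K M W : Type*} [CommRing O] [CommRing V] {σ : O →+* V}
  [AddCommGroup K] [Module O K] [AddCommGroup M] [Module O M] [AddCommGroup W] [Module V W]

theorem Submodule.map_sup_span_of_lift [RingHomSurjective σ] {ι : K →ₗ[O] M} {π : M →ₛₗ[σ] W}
    (hex : ∀ x, π x = 0 ↔ x ∈ LinearMap.range ι) (N₀ : Submodule O K) (L : Submodule V W) {n : ℕ}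
    (e : Module.Basis (Fin n) V L) (f : Fin n → M) (hf : ∀ i, π (f i) = e i) :
    (N₀.map ι ⊔ span O (Set.range f)).map π = L := by
  have hι : ∀ x, π (ι x) = 0 := fun x => (hex _).2 ⟨x, rfl⟩
  rw [Submodule.map_sup]
  have h1 : (N₀.map ι).map π = ⊥ := by
    rw [eq_bot_iff]
    rintro _ ⟨_, ⟨x, -, rfl⟩, rfl⟩
    exact (Submodule.mem_bot V).2 (hι x)
  rw [h1, bot_sup_eq, Submodule.map_span, ← Set.range_comp]
  have h2 : π ∘ f = L.subtype ∘ e := funext hf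
  rw [h2, Set.range_comp, ← Submodule.map_span, e.span_eq, Submodule.map_top,
    Submodule.range_subtype]

/-- Adjoining lifts of a basis of `L` does not enlarge the trace on `K`: a combination of the lifts
which lies in `K` has coefficients in `ker σ`. -/
theorem Submodule.comap_sup_span_of_lift {ι : K →ₗ[O] M} {π : M →ₛₗ[σ] W}
    (hinj : Function.Injective ι) (hex : ∀ x, π x = 0 ↔ x ∈ LinearMap.range ι)
    (N₀ : Submodule O K) (L : Submodule V W) {n : ℕ}
    (e : Module.Basis (Fin n) V L) (f : Fin n → M) (hf : ∀ i, π (f i) = e i)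
    (hfU : ∀ i, ∀ c ∈ RingHom.ker σ, c • f i ∈ N₀.map ι) :
    (N₀.map ι ⊔ span O (Set.range f)).comap ι = N₀ := by
  have hι : ∀ x, π (ι x) = 0 := fun x => (hex _).2 ⟨x, rfl⟩
  apply le_antisymm
  · intro z hz
    obtain ⟨_, ⟨x, hx, rfl⟩, w, hw, hzw⟩ := Submodule.mem_sup.1 (Submodule.mem_comap.1 hz)
    obtain ⟨c, rfl⟩ := (Submodule.mem_span_range_iff_exists_fun O).1 hw
    have h1 : ∑ i, σ (c i) • e i = 0 := by
      apply Subtype.ext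
      have := congrArg π hzw
      simp only [map_add, hι, zero_add, map_sum, LinearMap.map_smulₛₗ, hf] at this
      simpa using this
    have h2 := Fintype.linearIndependent_iff.1 e.linearIndependent _ h1
    have h3 : ∑ i, c i • f i ∈ N₀.map ι :=
      Submodule.sum_mem _ fun i _ => hfU i _ (RingHom.mem_ker.2 (h2 i))
    obtain ⟨x', hx', h4⟩ := h3
    have : z = x + x' := hinj (by rw [map_add, h4, hzw])
    rw [this]
    exact N₀.add_mem hx hx'
  · intro z hz
    exact Submodule.mem_sup_left (Submodule.mem_map_of_mem hz)

/-- The submodules `N` of an extension `M` of `W` by `K` with given intersection `N₀` with `K` and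
given image `L` in `W`, for `L` free over `V`: if the basis of `L` has lifts `f` to elements
of `M / N₀` killed by `ker σ`, then the choices of such lifts form a torsor under `(K' / N₀) ^ n`,
where `K' / N₀` consists of the elements of `K / N₀` killed by `ker σ`. -/
theorem Submodule.exists_bijective_lifts [RingHomSurjective σ] {ι : K →ₗ[O] M} {π : M →ₛₗ[σ] W}
    (hinj : Function.Injective ι) (hex : ∀ x, π x = 0 ↔ x ∈ LinearMap.range ι)
    (N₀ : Submodule O K) (L : Submodule V W) {n : ℕ}
    (e : Module.Basis (Fin n) V L) (f : Fin n → M) (hf : ∀ i, π (f i) = e i)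
    (hfU : ∀ i, ∀ c ∈ RingHom.ker σ, c • f i ∈ N₀.map ι) (K' : Submodule O K)
    (hK' : ∀ x, x ∈ K' ↔ ∀ c ∈ RingHom.ker σ, c • x ∈ N₀) :
    ∃ Ψ : (Fin n → K' ⧸ N₀.submoduleOf K') →
      {N : Submodule O M // N.comap ι = N₀ ∧ N.map π = L}, Function.Bijective Ψ := by
  classical
  have hι : ∀ x, π (ι x) = 0 := fun x => (hex _).2 ⟨x, rfl⟩
  let g : (Fin n → K') → Fin n → M := fun t i => f i + ι (t i)
  have hg : ∀ t i, π (g t i) = e i := fun t i => by simp only [g, map_add, hι, hf, add_zero]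
  have hgU : ∀ t i, ∀ c ∈ RingHom.ker σ, c • g t i ∈ N₀.map ι := fun t i c hc => by
    simp only [g, smul_add]
    refine Submodule.add_mem _ (hfU i c hc) ?_
    rw [← map_smul]
    exact Submodule.mem_map_of_mem ((hK' _).1 (t i).2 c hc)
  let Φ : (Fin n → K') → Submodule O M := fun t => N₀.map ι ⊔ span O (Set.range (g t))
  have hΦ1 : ∀ t, (Φ t).comap ι = N₀ := fun t =>
    Submodule.comap_sup_span_of_lift hinj hex N₀ L e (g t) (hg t) (hgU t)
  have hΦ2 : ∀ t, (Φ t).map π = L := fun t =>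
    Submodule.map_sup_span_of_lift hex N₀ L e (g t) (hg t)
  have hmem : ∀ t i, g t i ∈ Φ t := fun t i =>
    Submodule.mem_sup_right (Submodule.subset_span ⟨i, rfl⟩)
  have hle : ∀ t s, (∀ i, ((t i : K) - s i) ∈ N₀) → Φ t ≤ Φ s := by
    intro t s h
    refine sup_le le_sup_left (Submodule.span_le.2 ?_)
    rintro _ ⟨i, rfl⟩
    have : g t i = ι ((t i : K) - s i) + g s i := by simp only [g, map_sub]; abel
    rw [this]
    exact Submodule.add_mem _ (Submodule.mem_sup_left (Submodule.mem_map_of_mem (h i)))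
      (hmem s i)
  have hΦ : ∀ t s, Φ t = Φ s ↔ ∀ i, ((t i : K) - s i) ∈ N₀ := by
    intro t s
    constructor
    · intro h i
      rw [← hΦ1 s, Submodule.mem_comap]
      have : ι ((t i : K) - s i) = g t i - g s i := by simp only [g, map_sub]; abel
      rw [this]
      exact Submodule.sub_mem _ (h ▸ hmem t i) (hmem s i)
    · intro h
      refine le_antisymm (hle t s h) (hle s t fun i => ?_)
      rw [← neg_sub]
      exact N₀.neg_mem (h i)
  have hsurj : ∀ N : Submodule O M, N.comap ι = N₀ → N.map π = L → ∃ t, Φ t = N := by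
    intro N h1 h2
    have h3 : ∀ i, ∃ x ∈ N, π x = e i := fun i => by
      have : ((e i : L) : W) ∈ N.map π := by rw [h2]; exact (e i).2
      exact this
    choose x hxN hx using h3
    have h4 : ∀ i, ∃ y, ι y = x i - f i := fun i => by
      have : π (x i - f i) = 0 := by rw [map_sub, hx, hf, sub_self]
      exact (hex _).1 this
    choose y hy using h4
    have h5 : ∀ i, y i ∈ K' := by
      intro i
      rw [hK']
      intro c hc
      obtain ⟨a, ha, hac⟩ := hfU i c hc
      have h6 : c • x i ∈ N₀.map ι := by
        have h7 : π (c • x i) = 0 := by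
          rw [LinearMap.map_smulₛₗ, RingHom.mem_ker.1 hc, zero_smul]
        obtain ⟨b, hb⟩ := (hex _).1 h7
        refine ⟨b, ?_, hb⟩
        rw [← h1]
        change ι b ∈ N
        rw [hb]
        exact N.smul_mem _ (hxN i)
      obtain ⟨b, hb, hbc⟩ := h6
      have : c • y i = b - a := hinj (by rw [map_smul, hy, map_sub, hbc, hac, smul_sub])
      rw [this]
      exact N₀.sub_mem hb ha
    refine ⟨fun i => ⟨y i, h5 i⟩, ?_⟩
    have hgx : g (fun i => ⟨y i, h5 i⟩) = x := by
      funext i; simp only [g, hy]; abel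
    have hΦN : Φ (fun i => ⟨y i, h5 i⟩) ≤ N := by
      refine sup_le ?_ (Submodule.span_le.2 ?_)
      · rw [← h1]; exact Submodule.map_comap_le _ _
      · rw [hgx]; rintro _ ⟨i, rfl⟩; exact hxN i
    refine le_antisymm hΦN fun z hz => ?_
    -- both submodules have the same image in `W` and the same trace on `K`
    have hz2 : π z ∈ (Φ (fun i => ⟨y i, h5 i⟩)).map π := by
      rw [hΦ2, ← h2]; exact Submodule.mem_map_of_mem hz
    obtain ⟨z', hz', hzz'⟩ := hz2
    obtain ⟨a, ha⟩ := (hex (z - z')).1 (by rw [map_sub, hzz', sub_self])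
    have ha0 : a ∈ N₀ := by
      rw [← h1, Submodule.mem_comap, ha]
      exact N.sub_mem hz (hΦN hz')
    rw [← sub_add_cancel z z', ← ha]
    exact Submodule.add_mem _ (Submodule.mem_sup_left (Submodule.mem_map_of_mem ha0)) hz'
  refine ⟨fun t => ⟨Φ fun i => (t i).out, hΦ1 _, hΦ2 _⟩, ?_, ?_⟩
  · intro t s h
    funext i
    have h1 := (hΦ _ _).1 (Subtype.ext_iff.1 h) i
    rw [← Quotient.out_eq (t i), ← Quotient.out_eq (s i)]
    exact (Submodule.Quotient.eq _).2 h1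
  · rintro ⟨N, h1, h2⟩
    obtain ⟨s, hs⟩ := hsurj N h1 h2
    refine ⟨fun i => Submodule.Quotient.mk (s i), Subtype.ext (Eq.trans ?_ hs)⟩
    refine (hΦ _ _).2 ?_
    intro i
    have := Submodule.Quotient.mk_out (p := N₀.submoduleOf K') (Submodule.Quotient.mk (s i))
    exact (Submodule.Quotient.eq (N₀.submoduleOf K')).1 this

theorem Submodule.card_fiber_eq [RingHomSurjective σ] {ι : K →ₗ[O] M} {π : M →ₛₗ[σ] W}
    (hinj : Function.Injective ι) (hex : ∀ x, π x = 0 ↔ x ∈ LinearMap.range ι)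
    (N₀ : Submodule O K) (L : Submodule V W) {n : ℕ}
    (e : Module.Basis (Fin n) V L) (f : Fin n → M) (hf : ∀ i, π (f i) = e i)
    (hfU : ∀ i, ∀ c ∈ RingHom.ker σ, c • f i ∈ N₀.map ι) (K' : Submodule O K)
    (hK' : ∀ x, x ∈ K' ↔ ∀ c ∈ RingHom.ker σ, c • x ∈ N₀) [Finite (K' ⧸ N₀.submoduleOf K')] :
    ENat.card {N : Submodule O M // N.comap ι = N₀ ∧ N.map π = L} =
      (Nat.card (K' ⧸ N₀.submoduleOf K') ^ n : ℕ) := by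
  obtain ⟨Ψ, hΨ⟩ := Submodule.exists_bijective_lifts hinj hex N₀ L e f hf hfU K' hK'
  rw [← ENat.card_congr (Equiv.ofBijective Ψ hΨ), ENat.card_eq_coe_natCard, Nat.card_fun,
    Nat.card_fin]

/-- The index of `N` in an extension is the product of the indices of its trace and its image. -/
theorem Submodule.card_quotient_eq_mul [RingHomSurjective σ] {ι : K →ₗ[O] M} {π : M →ₛₗ[σ] W}
    (hπ : Function.Surjective π)
    (hex : ∀ x, π x = 0 ↔ x ∈ LinearMap.range ι) (N : Submodule O M) :
    Nat.card (M ⧸ N) = Nat.card (K ⧸ N.comap ι) * Nat.card (W ⧸ N.map π) := by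
  let φ : K →ₗ[O] M ⧸ N := N.mkQ ∘ₗ ι
  have hker : LinearMap.ker φ = N.comap ι := by
    rw [LinearMap.ker_comp, Submodule.ker_mkQ]
  have h1 := Submodule.card_eq_card_quotient_mul_card (LinearMap.range φ)
  have h2 : Nat.card (LinearMap.range φ) = Nat.card (K ⧸ N.comap ι) := by
    rw [← hker]; exact (Nat.card_congr φ.quotKerEquivRange.toEquiv).symm
  have h3 : Nat.card ((M ⧸ N) ⧸ LinearMap.range φ) = Nat.card (W ⧸ N.map π) := by
    let ψ : M →+ W ⧸ N.map π := (N.map π).mkQ.toAddMonoidHom.comp π.toAddMonoidHom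
    let χ : M →+ (M ⧸ N) ⧸ LinearMap.range φ :=
      (LinearMap.range φ).mkQ.toAddMonoidHom.comp N.mkQ.toAddMonoidHom
    have hψ : Function.Surjective ψ := (Submodule.mkQ_surjective _).comp hπ
    have hχ : Function.Surjective χ :=
      (Submodule.mkQ_surjective _).comp (Submodule.mkQ_surjective _)
    have hkψ : ∀ x, ψ x = 0 ↔ π x ∈ N.map π := fun x => Submodule.Quotient.mk_eq_zero _
    have hkχ : ∀ x, χ x = 0 ↔ N.mkQ x ∈ LinearMap.range φ := fun x =>
      Submodule.Quotient.mk_eq_zero _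
    have hkk : ψ.ker = χ.ker := by
      ext x
      rw [AddMonoidHom.mem_ker, AddMonoidHom.mem_ker, hkψ, hkχ]
      constructor
      · rintro ⟨z, hz, hzx⟩
        obtain ⟨a, ha⟩ := (hex (x - z)).1 (by rw [map_sub, hzx, sub_self])
        refine ⟨a, ?_⟩
        change N.mkQ (ι a) = N.mkQ x
        rw [ha]
        exact (Submodule.Quotient.eq _).2 (by simpa using hz)
      · rintro ⟨a, ha⟩
        have h : x - ι a ∈ N := (Submodule.Quotient.eq _).1 ha.symm
        refine ⟨x - ι a, h, ?_⟩
        rw [map_sub, (hex (ι a)).2 ⟨a, rfl⟩, sub_zero]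
    have e1 := QuotientAddGroup.quotientKerEquivOfSurjective ψ hψ
    have e2 := QuotientAddGroup.quotientKerEquivOfSurjective χ hχ
    rw [← Nat.card_congr e1.toEquiv, ← Nat.card_congr e2.toEquiv, hkk]
  rw [h1, h2, h3, mul_comm]

end Extension

/-! ### Dirichlet series with coefficients in `ℝ≥0∞` -/

section DirichletENNReal

open scoped ENNReal

/-- The Dirichlet series `c * m ^ (-s)`, which is zero for `m = 0`. -/
noncomputable def dirichletMono (m : ℕ) (c : ℝ≥0∞) : ArithmeticFunction ℝ≥0∞ :=
  ⟨fun n => if n = m ∧ n ≠ 0 then c else 0, by simp⟩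

theorem dirichletMono_apply (m : ℕ) (c : ℝ≥0∞) (n : ℕ) :
    dirichletMono m c n = if n = m ∧ n ≠ 0 then c else 0 := rfl

theorem dirichletMono_zero (c : ℝ≥0∞) : dirichletMono 0 c = 0 := by
  ext n
  simp only [dirichletMono_apply, ArithmeticFunction.zero_apply]
  exact if_neg fun h => h.2 h.1

theorem dirichletMono_zero_right (m : ℕ) : dirichletMono m 0 = 0 := by
  ext n; simp [dirichletMono_apply]

theorem dirichletMono_one_one : dirichletMono 1 1 = 1 := by
  ext n
  simp only [dirichletMono_apply, ArithmeticFunction.one_apply]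
  by_cases h : n = 1 <;> simp [h]

theorem dirichletMono_mul (m n : ℕ) (a b : ℝ≥0∞) :
    dirichletMono m a * dirichletMono n b = dirichletMono (m * n) (a * b) := by
  rcases Nat.eq_zero_or_pos m with rfl | hm
  · simp [dirichletMono_zero]
  rcases Nat.eq_zero_or_pos n with rfl | hn
  · simp [dirichletMono_zero]
  ext k
  rw [ArithmeticFunction.mul_apply, dirichletMono_apply]
  split_ifs with h
  · obtain ⟨rfl, h0⟩ := h
    rw [Finset.sum_eq_single (m, n)]
    · simp [dirichletMono_apply, hm.ne', hn.ne']
    · rintro ⟨i, j⟩ _ hne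
      simp only [dirichletMono_apply]
      by_cases h1 : i = m
      · have h2 : j ≠ n := fun h2 => hne (by rw [h1, h2])
        simp [h2]
      · simp [h1]
    · intro h; exact (h (by simp [hm.ne', hn.ne'])).elim
  · apply Finset.sum_eq_zero
    rintro ⟨i, j⟩ hij
    rw [Nat.mem_divisorsAntidiagonal] at hij
    simp only [dirichletMono_apply]
    by_cases h1 : i = m
    · by_cases h2 : j = n
      · subst h1 h2; exact (h ⟨hij.1.symm, hij.2⟩).elim
      · simp [h2]
    · simp [h1]

/-- The sum of an arbitrary family of Dirichlet series with coefficients in `ℝ≥0∞`. -/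
noncomputable def dirichletSum {T : Type*} (F : T → ArithmeticFunction ℝ≥0∞) :
    ArithmeticFunction ℝ≥0∞ :=
  ⟨fun n => ∑' t, F t n, by simp⟩

theorem dirichletSum_apply {T : Type*} (F : T → ArithmeticFunction ℝ≥0∞) (n : ℕ) :
    dirichletSum F n = ∑' t, F t n := rfl

theorem dirichletSum_mul_left {T : Type*} (G : ArithmeticFunction ℝ≥0∞)
    (F : T → ArithmeticFunction ℝ≥0∞) :
    dirichletSum (fun t => G * F t) = G * dirichletSum F := by
  ext n
  simp only [dirichletSum_apply, ArithmeticFunction.mul_apply]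
  rw [Summable.tsum_finsetSum fun _ _ => ENNReal.summable]
  simp only [ENNReal.tsum_mul_left]

theorem dirichletSum_prod {A B : Type*} (F : A × B → ArithmeticFunction ℝ≥0∞) :
    dirichletSum F = dirichletSum fun a => dirichletSum fun b => F (a, b) := by
  ext n
  simp only [dirichletSum_apply]
  rw [ENNReal.tsum_prod']

theorem dirichletSum_mul_dirichletSum {A B : Type*} (F : A → ArithmeticFunction ℝ≥0∞)
    (G : B → ArithmeticFunction ℝ≥0∞) :
    dirichletSum (fun x : A × B => F x.1 * G x.2) = dirichletSum F * dirichletSum G := by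
  rw [dirichletSum_prod]
  simp only [dirichletSum_mul_left]
  rw [mul_comm, ← dirichletSum_mul_left]
  congr 1; funext a; rw [mul_comm]

theorem dirichletSum_equiv {A B : Type*} (e : A ≃ B) (F : B → ArithmeticFunction ℝ≥0∞) :
    dirichletSum (fun a => F (e a)) = dirichletSum F := by
  ext n
  exact e.tsum_eq fun b => F b n

theorem dirichletSum_subtype {A : Type*} (p : A → Prop) (F : A → ArithmeticFunction ℝ≥0∞)
    (h : ∀ a, ¬ p a → F a = 0) : dirichletSum F = dirichletSum fun a : {a // p a} => F a := by
  ext n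
  simp only [dirichletSum_apply]
  refine (tsum_subtype_eq_of_support_subset (s := {a | p a}) ?_).symm
  intro a ha
  by_contra hp
  refine ha ?_
  change F a n = 0
  rw [h a hp]; rfl

/-- Collecting equal monomials: the sum over `T` of monomials depending only on `p t` is the sum
over the values `b` of `p`, each counted with the number of its preimages. -/
theorem dirichletSum_fiberwise {T B : Type*} (p : T → B) (m : B → ℕ) (c : B → ℝ≥0∞) (k : B → ℕ)
    (hk : ∀ b, m b ≠ 0 → ENat.card {t // p t = b} = k b) :
    dirichletSum (fun t => dirichletMono (m (p t)) (c (p t))) =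
      dirichletSum fun b => dirichletMono (m b) (k b * c b) := by
  ext n
  simp only [dirichletSum_apply]
  rw [← (Equiv.sigmaFiberEquiv p).tsum_eq, ENNReal.tsum_sigma']
  congr 1
  funext b
  have h1 : ∀ t : {t // p t = b}, dirichletMono (m (p ((Equiv.sigmaFiberEquiv p) ⟨b, t⟩)))
      (c (p ((Equiv.sigmaFiberEquiv p) ⟨b, t⟩))) n = dirichletMono (m b) (c b) n := by
    rintro ⟨t, rfl⟩; rfl
  simp only [h1]
  rw [ENNReal.tsum_const]
  by_cases hm : m b = 0
  · simp [hm, dirichletMono_zero]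
  · rw [hk b hm]
    simp only [dirichletMono_apply]
    split_ifs <;> simp

end DirichletENNReal

/-! ### Submodules of free modules over a discrete valuation ring -/

section DVR

open scoped ENNReal

/-- The Dirichlet series `∑ |W / L| ^ (c - b s)` over the submodules `L ≤ W` of finite index.
For `b ≠ 0`, those of infinite index contribute zero, as `Nat.card (W ⧸ L) = 0`. -/
noncomputable def latticeSeries (V W : Type*) [Ring V] [AddCommGroup W] [Module V W] (b c : ℕ) :
    ArithmeticFunction ℝ≥0∞ :=
  dirichletSum fun L : Submodule V W =>
    dirichletMono (Nat.card (W ⧸ L) ^ b) ((Nat.card (W ⧸ L) : ℝ≥0∞) ^ c)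

theorem latticeSeries_congr {V W W' : Type*} [Ring V] [AddCommGroup W] [Module V W]
    [AddCommGroup W'] [Module V W'] (e : W ≃ₗ[V] W') (b c : ℕ) :
    latticeSeries V W b c = latticeSeries V W' b c := by
  rw [latticeSeries, latticeSeries, ← dirichletSum_equiv (Submodule.orderIsoMapComap e).toEquiv]
  congr 1; funext L
  have : Nat.card (W' ⧸ L.map (e : W →ₗ[V] W')) = Nat.card (W ⧸ L) :=
    (Nat.card_congr (Submodule.Quotient.equiv L (L.map (e : W →ₗ[V] W')) e rfl).toEquiv).symm
  change _ = dirichletMono (Nat.card (W' ⧸ L.map (e : W →ₗ[V] W')) ^ b)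
    ((Nat.card (W' ⧸ L.map (e : W →ₗ[V] W')) : ℝ≥0∞) ^ c)
  rw [this]

variable {V : Type*} [CommRing V] [IsDomain V] [IsPrincipalIdealRing V] [Infinite V]

/-- A submodule of finite index in a free module of rank `n` over an infinite principal ideal
domain is free of rank `n`. -/
theorem Submodule.nonempty_basis_of_finite_quotient {W : Type*} [AddCommGroup W] [Module V W]
    {n : ℕ} (b : Module.Basis (Fin n) V W) (L : Submodule V W) [Finite (W ⧸ L)] :
    Nonempty (Module.Basis (Fin n) V L) := by
  have : Module.Free V W := .of_basis b
  have : Module.Finite V W := .of_basis b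
  obtain ⟨m, bL⟩ := Submodule.basisOfPid b L
  suffices h : m = n by subst h; exact ⟨bL⟩
  have hm : Module.finrank V L = m := by simpa using Module.finrank_eq_card_basis bL
  have hn : Module.finrank V W = n := by simpa using Module.finrank_eq_card_basis b
  have : Module.Free V L := .of_basis bL
  have : Module.Finite V L := .of_basis bL
  apply le_antisymm
  · rw [← hm, ← hn]; exact Submodule.finrank_le L
  · -- some nonzero scalar kills the finite module `W / L`
    obtain ⟨c, hc0, hc⟩ : ∃ c : V, c ≠ 0 ∧ ∀ w : W, c • w ∈ L := by
      have hninj : ¬ Function.Injective (fun (a : V) (x : W ⧸ L) => a • x) := fun h =>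
        not_finite_iff_infinite.2 ‹Infinite V› (Finite.of_injective _ h)
      rw [Function.not_injective_iff] at hninj
      obtain ⟨a, a', h, hne⟩ := hninj
      refine ⟨a - a', sub_ne_zero.2 hne, fun w => ?_⟩
      have := congrFun h (Submodule.Quotient.mk w)
      rw [sub_smul]
      exact (Submodule.Quotient.eq L).1 this
    rw [← hm, ← hn]
    refine LinearMap.finrank_le_finrank_of_injective
      (f := (LinearMap.lsmul V W c).codRestrict L hc) fun x y hxy => ?_
    have h1 : c • x = c • y := Subtype.ext_iff.1 hxy
    exact (smul_right_injective W hc0) h1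

theorem Submodule.card_fiber_fst {W : Type*} [AddCommGroup W] [Module V W]
    (L' : Submodule V W) (a : Submodule V V) [Finite (W ⧸ L')] [Finite (V ⧸ a)] :
    ENat.card {L : Submodule V (V × W) //
        L.comap (LinearMap.inr V V W) = L' ∧ L.map (LinearMap.fst V V W) = a} =
      (Nat.card (W ⧸ L') : ℕ) := by
  obtain ⟨e⟩ := Submodule.nonempty_basis_of_finite_quotient (Module.Basis.singleton (Fin 1) V) a
  have hker : ∀ c ∈ RingHom.ker (RingHom.id V), c = 0 := fun c hc => hc
  have eq : ((⊤ : Submodule V W) ⧸ L'.submoduleOf ⊤) ≃ (W ⧸ L') :=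
    (Submodule.Quotient.equiv _ _ Submodule.topEquiv (by
      ext x; simp [Submodule.submoduleOf])).toEquiv
  have : Finite ((⊤ : Submodule V W) ⧸ L'.submoduleOf ⊤) := Finite.of_equiv _ eq.symm
  rw [Submodule.card_fiber_eq (σ := RingHom.id V) (ι := LinearMap.inr V V W)
    (π := LinearMap.fst V V W) LinearMap.inr_injective (by simp [LinearMap.range_inr]) L' a e
    (fun i => ((e i : V), 0)) (fun i => rfl) (fun i c hc => by
      rw [hker c hc, zero_smul]; exact zero_mem _) ⊤ (fun x => by
      simp only [Submodule.mem_top, true_iff]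
      intro c hc; rw [hker c hc, zero_smul]; exact zero_mem _), pow_one, Nat.card_congr eq]

/-- A submodule of `V × W` of finite index is given by its trace on `W`, its image in `V`, and the
class modulo the former of a lift of a generator of the latter. -/
theorem latticeSeries_prod {W : Type*} [AddCommGroup W] [Module V W] {b : ℕ} (hb : b ≠ 0) (c : ℕ) :
    latticeSeries V (V × W) b c = latticeSeries V W b (c + 1) * latticeSeries V V b c := by
  have h1 : ∀ L : Submodule V (V × W), Nat.card ((V × W) ⧸ L) =
      Nat.card (W ⧸ L.comap (LinearMap.inr V V W)) * Nat.card (V ⧸ L.map (LinearMap.fst V V W)) :=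
    fun L => Submodule.card_quotient_eq_mul (σ := RingHom.id V) (ι := LinearMap.inr V V W)
      (π := LinearMap.fst V V W) LinearMap.fst_surjective (by simp [LinearMap.range_inr]) L
  rw [latticeSeries]
  simp only [h1]
  rw [dirichletSum_fiberwise (T := Submodule V (V × W))
    (p := fun L => (L.comap (LinearMap.inr V V W), L.map (LinearMap.fst V V W)))
    (m := fun x => (Nat.card (W ⧸ x.1) * Nat.card (V ⧸ x.2)) ^ b)
    (c := fun x => ((Nat.card (W ⧸ x.1) * Nat.card (V ⧸ x.2) : ℕ) : ℝ≥0∞) ^ c)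
    (k := fun x => Nat.card (W ⧸ x.1)), latticeSeries, latticeSeries,
    ← dirichletSum_mul_dirichletSum]
  · congr 1; funext x
    rw [dirichletMono_mul, mul_pow]
    congr 1
    push_cast
    ring
  · rintro ⟨L', a⟩ hx
    have h2 := pow_ne_zero_iff hb |>.1 hx
    have h3 := Nat.finite_of_card_ne_zero (left_ne_zero_of_mul h2)
    have h4 := Nat.finite_of_card_ne_zero (right_ne_zero_of_mul h2)
    rw [← Submodule.card_fiber_fst L' a]
    refine ENat.card_congr (Equiv.subtypeEquivRight fun L => ?_)
    simp only [Prod.mk.injEq]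

theorem latticeSeries_pi (d : ℕ) {b : ℕ} (hb : b ≠ 0) (c : ℕ) :
    latticeSeries V (Fin d → V) b c =
      ∏ j ∈ Finset.range d, latticeSeries V V b (c + j) := by
  induction d generalizing c with
  | zero =>
    rw [Finset.prod_range_zero, latticeSeries]
    have hsub : ∀ L : Submodule V (Fin 0 → V), Nat.card ((Fin 0 → V) ⧸ L) = 1 := fun L =>
      Nat.card_unique
    simp only [hsub, one_pow, Nat.cast_one, dirichletMono_one_one]
    ext n
    rw [dirichletSum_apply, tsum_eq_single ⊥ fun b hb => (hb (Subsingleton.elim _ _)).elim]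
  | succ d ih =>
    rw [latticeSeries_congr (Fin.consLinearEquiv V (fun _ => V)).symm, latticeSeries_prod hb, ih,
      Finset.prod_range_succ', add_zero]
    congr 1
    refine Finset.prod_congr rfl fun j _ => ?_
    rw [add_assoc, add_comm 1 j]

end DVR

/-! ### Submodules of free modules over a ring with a discrete valuation ring as divisor -/

section Surface

open scoped ENNReal

/-- The series `∑ l ^ (n i) * (|M / N| * l ^ i) ^ (-D s)`, with `l = |W / π N|`, over the
submodules `N ≤ M` containing `y ^ r M`. For `D ≠ 0`, submodules of infinite index contribute zero,
as their index is `Nat.card (M ⧸ N) = 0`. -/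
noncomputable def surfaceSeries {O V M W : Type*} [CommRing O] [CommRing V] {σ : O →+* V}
    [RingHomSurjective σ] [AddCommGroup M] [Module O M] [AddCommGroup W] [Module V W]
    (π : M →ₛₗ[σ] W) (y : O) (n D r i : ℕ) : ArithmeticFunction ℝ≥0∞ :=
  dirichletSum fun N : {N : Submodule O M // ∀ x, y ^ r • x ∈ N} =>
    dirichletMono ((Nat.card (M ⧸ N.1) * Nat.card (W ⧸ N.1.map π) ^ i) ^ D)
      ((Nat.card (W ⧸ N.1.map π) : ℝ≥0∞) ^ (n * i))

variable {O V M W : Type*} [CommRing O] [CommRing V] {σ : O →+* V} [RingHomSurjective σ]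
  [AddCommGroup M] [Module O M] [AddCommGroup W] [Module V W]
  {π : M →ₛₗ[σ] W} {y : O}

theorem surfaceSeries_zero (hπ : Function.Surjective π) (n D i : ℕ) :
    surfaceSeries π y n D 0 i = 1 := by
  have htop : ∀ N : {N : Submodule O M // ∀ x, y ^ 0 • x ∈ N}, N.1 = ⊤ := fun N => by
    rw [eq_top_iff]; intro x _; simpa using N.2 x
  have hmap : (⊤ : Submodule O M).map π = ⊤ := by
    rw [Submodule.map_top, LinearMap.range_eq_top.2 hπ]
  have h1 : Nat.card (M ⧸ (⊤ : Submodule O M)) = 1 := Nat.card_unique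
  have h2 : Nat.card (W ⧸ (⊤ : Submodule V W)) = 1 := Nat.card_unique
  rw [surfaceSeries]
  simp only [htop, hmap, h1, h2, one_pow, mul_one, Nat.cast_one, dirichletMono_one_one]
  ext m
  rw [dirichletSum_apply, tsum_eq_single ⟨⊤, fun _ => trivial⟩ fun N hN =>
    (hN (Subtype.ext (htop N))).elim]

section

variable [IsDomain V] [IsPrincipalIdealRing V] [Infinite V]

/-- The number of submodules `N` with `(N : y) = N'` and image `L` in `W = M / y M`. -/
theorem Submodule.card_fiber_colon (hσ : RingHom.ker σ = Ideal.span {y})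
    (hy : ∀ x : M, y • x = 0 → x = 0) (hex : ∀ x : M, π x = 0 ↔ ∃ z, y • z = x)
    (hπ : Function.Surjective π) {n : ℕ} (b : Module.Basis (Fin n) V W) (N' : Submodule O M)
    (hN' : Nat.card (M ⧸ N') ≠ 0) (L : Submodule V W) [Finite (W ⧸ L)] (hL : L ≤ N'.map π) :
    ENat.card {N : Submodule O M // N.comap (LinearMap.lsmul O M y) = N' ∧ N.map π = L} =
      (Nat.card (W ⧸ N'.map π) ^ n : ℕ) := by
  obtain ⟨e⟩ := Submodule.nonempty_basis_of_finite_quotient b L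
  have hlift : ∀ i, ∃ x ∈ N', π x = e i := fun i => hL (e i).2
  choose f hfN hf using hlift
  have hinj : Function.Injective (LinearMap.lsmul O M y) := by
    rw [injective_iff_map_eq_zero]; exact hy
  have hex' : ∀ x, π x = 0 ↔ x ∈ LinearMap.range (LinearMap.lsmul O M y) := hex
  have hcN : ∀ x ∈ N', ∀ c ∈ RingHom.ker σ, c • x ∈ N'.map (LinearMap.lsmul O M y) := by
    intro x hx c hc
    rw [hσ] at hc
    obtain ⟨a, rfl⟩ := Ideal.mem_span_singleton.1 hc
    exact ⟨a • x, N'.smul_mem _ hx, by rw [LinearMap.lsmul_apply, mul_smul]⟩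
  set K' := N'.comap (LinearMap.lsmul O M y)
  have hK' : ∀ x, x ∈ K' ↔ ∀ c ∈ RingHom.ker σ, c • x ∈ N' := by
    intro x
    rw [hσ]
    constructor
    · intro hx c hc
      obtain ⟨a, rfl⟩ := Ideal.mem_span_singleton.1 hc
      rw [mul_comm, mul_smul]
      exact N'.smul_mem _ hx
    · intro h; exact h y (Ideal.mem_span_singleton_self y)
  have hle : N' ≤ K' := fun x hx => N'.smul_mem y hx
  have h1 := Submodule.card_quotient_eq_mul hπ hex' N'
  have h2 := Submodule.card_quotient_eq_mul (σ := RingHom.id O) (ι := K'.subtype) (π := K'.mkQ)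
    K'.mkQ_surjective (by simp) N'
  have h3 : N'.map K'.mkQ = ⊥ := by
    rw [eq_bot_iff]
    rintro _ ⟨x, hx, rfl⟩
    exact (Submodule.mem_bot _).2 ((Submodule.Quotient.mk_eq_zero _).2 (hle hx))
  rw [h3, Nat.card_congr (Submodule.quotEquivOfEqBot _ rfl).toEquiv, mul_comm] at h2
  have hK0 : Nat.card (M ⧸ K') ≠ 0 := by
    intro h; rw [h2, h, zero_mul] at hN'; exact hN' rfl
  have h4 : Nat.card (K' ⧸ N'.submoduleOf K') = Nat.card (W ⧸ N'.map π) :=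
    mul_left_cancel₀ hK0 (h2.symm.trans h1)
  have : Finite (K' ⧸ N'.submoduleOf K') := Nat.finite_of_card_ne_zero (by
    rw [h4]; intro h; rw [h1, h, mul_zero] at hN'; exact hN' rfl)
  rw [Submodule.card_fiber_eq hinj hex' N' L e f hf (fun i => hcN _ (hfN i)) K' hK', h4]

/-- The recursion behind the product formula. The submodules `N` are sorted by `N' = (N : y)` and by
their image `L` in `W`, which is contained in the image `L'` of `N'`. The index of `N` is `|M / N'|
|W / L|`, there are `|W / L'| ^ n` submodules for each pair, and the sum over `L` is the lattice
series of `L' ≃ W`. -/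
theorem surfaceSeries_succ (hσ : RingHom.ker σ = Ideal.span {y})
    (hy : ∀ x : M, y • x = 0 → x = 0) (hex : ∀ x : M, π x = 0 ↔ ∃ z, y • z = x)
    (hπ : Function.Surjective π) {n : ℕ} (b : Module.Basis (Fin n) V W) {D : ℕ} (hD : D ≠ 0)
    (r i : ℕ) :
    surfaceSeries π y n D (r + 1) i =
      latticeSeries V W (D * (i + 1)) (n * i) * surfaceSeries π y n D r (i + 1) := by
  classical
  have hex' : ∀ x, π x = 0 ↔ x ∈ LinearMap.range (LinearMap.lsmul O M y) := hex
  have h1 := fun N : Submodule O M => Submodule.card_quotient_eq_mul hπ hex' N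
  let p : {N : Submodule O M // ∀ x, y ^ (r + 1) • x ∈ N} →
      {N : Submodule O M // ∀ x, y ^ r • x ∈ N} × Submodule V W := fun N =>
    (⟨N.1.comap (LinearMap.lsmul O M y), fun x => by
      rw [Submodule.mem_comap, LinearMap.lsmul_apply, ← mul_smul, ← pow_succ']
      exact N.2 x⟩, N.1.map π)
  -- sort by `N'` and `L`, where only the pairs with `L ≤ π N'` have a nonempty fibre
  have hleft : surfaceSeries π y n D (r + 1) i = dirichletSum fun N' : {N : Submodule O M //
      ∀ x, y ^ r • x ∈ N} => dirichletSum fun L : Submodule V W => dirichletMono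
        ((Nat.card (M ⧸ N'.1) * Nat.card (W ⧸ L) * Nat.card (W ⧸ L) ^ i) ^ D)
        (((if L ≤ N'.1.map π then Nat.card (W ⧸ N'.1.map π) ^ n else 0 : ℕ) : ℝ≥0∞) *
          (Nat.card (W ⧸ L) : ℝ≥0∞) ^ (n * i)) := by
    rw [surfaceSeries]
    have h2 : ∀ N : {N : Submodule O M // ∀ x, y ^ (r + 1) • x ∈ N},
        Nat.card (M ⧸ N.1) = Nat.card (M ⧸ (p N).1.1) * Nat.card (W ⧸ (p N).2) := fun N => h1 N.1
    have h3 : ∀ N : {N : Submodule O M // ∀ x, y ^ (r + 1) • x ∈ N},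
        dirichletMono ((Nat.card (M ⧸ N.1) * Nat.card (W ⧸ N.1.map π) ^ i) ^ D)
          ((Nat.card (W ⧸ N.1.map π) : ℝ≥0∞) ^ (n * i)) =
        dirichletMono ((Nat.card (M ⧸ (p N).1.1) * Nat.card (W ⧸ (p N).2) *
          Nat.card (W ⧸ (p N).2) ^ i) ^ D) ((Nat.card (W ⧸ (p N).2) : ℝ≥0∞) ^ (n * i)) :=
      fun N => by rw [h2]
    rw [funext h3, dirichletSum_fiberwise (p := p)
      (m := fun x => (Nat.card (M ⧸ x.1.1) * Nat.card (W ⧸ x.2) * Nat.card (W ⧸ x.2) ^ i) ^ D)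
      (c := fun x => (Nat.card (W ⧸ x.2) : ℝ≥0∞) ^ (n * i))
      (k := fun x => if x.2 ≤ x.1.1.map π then Nat.card (W ⧸ x.1.1.map π) ^ n else 0),
      dirichletSum_prod]
    rintro ⟨⟨N', hN'⟩, L⟩ hne
    have h2 := (pow_ne_zero_iff hD).1 hne
    have h3 := left_ne_zero_of_mul h2
    have h4 := Nat.finite_of_card_ne_zero (right_ne_zero_of_mul h3)
    have hfib : ENat.card {N // p N = (⟨N', hN'⟩, L)} = ENat.card {N : Submodule O M //
        N.comap (LinearMap.lsmul O M y) = N' ∧ N.map π = L} := by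
      refine ENat.card_congr ⟨fun N => ⟨N.1.1, ?_, ?_⟩, fun N => ⟨⟨N.1, ?_⟩, ?_⟩, ?_, ?_⟩
      · exact congrArg (fun x => x.1.1) N.2
      · exact congrArg (fun x => x.2) N.2
      · intro x
        have : y ^ r • x ∈ N.1.comap (LinearMap.lsmul O M y) := by rw [N.2.1]; exact hN' x
        rw [Submodule.mem_comap, LinearMap.lsmul_apply, ← mul_smul, ← pow_succ'] at this
        exact this
      · exact Prod.ext (Subtype.ext N.2.1) N.2.2
      · intro N; rfl
      · intro N; rfl
    rw [hfib]
    split_ifs with hL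
    · exact Submodule.card_fiber_colon hσ hy hex hπ b N' (left_ne_zero_of_mul h3) L hL
    · rw [Nat.cast_zero, ENat.card_eq_zero_iff_empty, isEmpty_iff]
      rintro ⟨N, hN1, hN2⟩
      refine hL ?_
      simp only
      rw [← hN1, ← hN2]
      exact Submodule.map_mono fun x hx => N.smul_mem y hx
  rw [hleft, surfaceSeries, ← dirichletSum_mul_left]
  congr 1; funext N'
  -- for fixed `N'`, pass from submodules `L ≤ L₁` of `W` to submodules of the free module `L₁`
  set L₁ := N'.1.map π
  rw [dirichletSum_subtype (fun L => L ≤ L₁) _ fun L hL => by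
    rw [if_neg hL, Nat.cast_zero, zero_mul, dirichletMono_zero_right]]
  let E : Submodule V L₁ ≃ {L : Submodule V W // L ≤ L₁} := (Submodule.mapIic L₁).toEquiv
  rw [← dirichletSum_equiv E]
  have h5 : ∀ L : Submodule V L₁, Nat.card (W ⧸ L.map L₁.subtype) =
      Nat.card (W ⧸ L₁) * Nat.card (L₁ ⧸ L) := by
    intro L
    have h2 := Submodule.card_quotient_eq_mul (σ := RingHom.id V) (ι := L₁.subtype) (π := L₁.mkQ)
      L₁.mkQ_surjective (by simp) (L.map L₁.subtype)
    have h3 : (L.map L₁.subtype).map L₁.mkQ = ⊥ := by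
      rw [eq_bot_iff]
      rintro _ ⟨_, ⟨x, hx, rfl⟩, rfl⟩
      exact (Submodule.mem_bot _).2 ((Submodule.Quotient.mk_eq_zero _).2 x.2)
    rw [h3, Nat.card_congr (Submodule.quotEquivOfEqBot _ rfl).toEquiv, mul_comm,
      Submodule.comap_map_eq_of_injective L₁.injective_subtype] at h2
    exact h2
  have h6 : ∀ L : Submodule V L₁, dirichletMono
      ((Nat.card (M ⧸ N'.1) * Nat.card (W ⧸ L.map L₁.subtype) *
        Nat.card (W ⧸ L.map L₁.subtype) ^ i) ^ D)
      (((if L.map L₁.subtype ≤ L₁ then Nat.card (W ⧸ L₁) ^ n else 0 : ℕ) : ℝ≥0∞) *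
          (Nat.card (W ⧸ L.map L₁.subtype) : ℝ≥0∞) ^ (n * i)) =
      dirichletMono ((Nat.card (M ⧸ N'.1) * Nat.card (W ⧸ L₁) ^ (i + 1)) ^ D)
        ((Nat.card (W ⧸ L₁) : ℝ≥0∞) ^ (n * (i + 1))) *
      dirichletMono (Nat.card (L₁ ⧸ L) ^ (D * (i + 1)))
        ((Nat.card (L₁ ⧸ L) : ℝ≥0∞) ^ (n * i)) := by
    intro L
    rw [if_pos (Submodule.map_subtype_le _ _), h5, dirichletMono_mul]
    congr 1
    · rw [mul_comm D, pow_mul, ← mul_pow]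
      congr 1
      ring
    · push_cast
      ring
  refine Eq.trans (congrArg dirichletSum (funext h6)) ?_
  rw [dirichletSum_mul_left, mul_comm]
  by_cases hL₁ : Nat.card (W ⧸ L₁) = 0
  · rw [hL₁, zero_pow (Nat.succ_ne_zero i), mul_zero, zero_pow hD, dirichletMono_zero, mul_zero,
      mul_zero]
  · have := Nat.finite_of_card_ne_zero hL₁
    obtain ⟨e⟩ := Submodule.nonempty_basis_of_finite_quotient b L₁
    rw [latticeSeries_congr (b.equiv e (Equiv.refl _)), latticeSeries]

theorem surfaceSeries_eq_prod (hσ : RingHom.ker σ = Ideal.span {y})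
    (hy : ∀ x : M, y • x = 0 → x = 0) (hex : ∀ x : M, π x = 0 ↔ ∃ z, y • z = x)
    (hπ : Function.Surjective π) {n : ℕ} (b : Module.Basis (Fin n) V W) {D : ℕ} (hD : D ≠ 0)
    (r i : ℕ) :
    surfaceSeries π y n D r i = ∏ j ∈ Finset.range r, ∏ k ∈ Finset.range n,
      latticeSeries V V (D * (i + j + 1)) (n * (i + j) + k) := by
  induction r generalizing i with
  | zero => rw [surfaceSeries_zero hπ, Finset.prod_range_zero]
  | succ r ih =>
    rw [surfaceSeries_succ hσ hy hex hπ b hD, ih, Finset.prod_range_succ', mul_comm,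
      latticeSeries_congr b.equivFun, latticeSeries_pi n (mul_ne_zero hD (Nat.succ_ne_zero i))]
    congr 1
    refine Finset.prod_congr rfl fun j _ => ?_
    rw [add_assoc i 1 j, add_comm 1 j]

end

/-- An element of the maximal ideal acts nilpotently on every finite module. -/
theorem IsLocalRing.pow_card_smul_eq_zero {R M : Type*} [CommRing R] [IsLocalRing R]
    [AddCommGroup M] [Module R M] [Finite M] {y : R} (hy : y ∈ IsLocalRing.maximalIdeal R)
    {c : ℕ} (hc : Nat.card M ≤ c) (x : M) : y ^ c • x = 0 := by
  -- two of the elements `x, y x, …, y ^ c x` coincide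
  obtain ⟨a, b, hab, h⟩ : ∃ a b : Fin (c + 1), a < b ∧ y ^ (a : ℕ) • x = y ^ (b : ℕ) • x := by
    have : Fintype M := Fintype.ofFinite M
    obtain ⟨a, b, hne, h⟩ := Fintype.exists_ne_map_eq_of_card_lt
      (fun a : Fin (c + 1) => y ^ (a : ℕ) • x) (by
        rw [Fintype.card_fin, ← Nat.card_eq_fintype_card]; omega)
    rcases lt_or_gt_of_ne hne with h' | h'
    · exact ⟨a, b, h', h⟩
    · exact ⟨b, a, h', h.symm⟩
  have hab' : (a : ℕ) < b := hab
  have h1 : (1 - y ^ ((b : ℕ) - a)) • y ^ (a : ℕ) • x = 0 := by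
    rw [sub_smul, one_smul, ← mul_smul, ← pow_add, Nat.sub_add_cancel hab'.le, h, sub_self]
  have h2 : IsUnit (1 - y ^ ((b : ℕ) - a)) := by
    by_contra hu
    have h3 : y ^ ((b : ℕ) - a) ∈ IsLocalRing.maximalIdeal R :=
      Ideal.pow_mem_of_mem _ hy _ (Nat.sub_pos_of_lt hab')
    have h4 := Ideal.add_mem _ ((IsLocalRing.mem_maximalIdeal _).2 hu) h3
    rw [sub_add_cancel] at h4
    exact (Ideal.ne_top_iff_one _).1 (IsLocalRing.maximalIdeal.isMaximal R).ne_top h4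
  have h3 : y ^ (a : ℕ) • x = 0 := (h2.smul_eq_zero).1 h1
  have h4 : (a : ℕ) ≤ c := Nat.lt_succ_iff.1 a.2
  rw [← Nat.sub_add_cancel h4, pow_add, mul_smul, h3, smul_zero]

theorem Ideal.card_quotient_span_singleton_pow {V : Type*} [CommRing V] [IsDomain V]
    {ϖ : V} (hϖ : ϖ ≠ 0) (k : ℕ) :
    Nat.card (V ⧸ Ideal.span {ϖ ^ k}) = Nat.card (V ⧸ Ideal.span {ϖ}) ^ k := by
  induction k with
  | zero =>
    rw [pow_zero, pow_zero, Ideal.span_singleton_one]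
    exact Nat.card_unique
  | succ k ih =>
    have h1 := Submodule.card_quotient_eq_mul (σ := RingHom.id V) (ι := LinearMap.lsmul V V ϖ)
      (π := (Ideal.span {ϖ}).mkQ) (Submodule.mkQ_surjective _) (fun x => by
        rw [Submodule.mkQ_apply, Submodule.Quotient.mk_eq_zero, Ideal.mem_span_singleton]
        exact ⟨fun ⟨a, ha⟩ => ⟨a, ha.symm⟩, fun ⟨a, ha⟩ => ⟨a, ha.symm⟩⟩)
      (Ideal.span {ϖ ^ (k + 1)})
    have h2 : Submodule.comap (LinearMap.lsmul V V ϖ) (Ideal.span {ϖ ^ (k + 1)}) =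
        Ideal.span {ϖ ^ k} := by
      ext x
      rw [Submodule.mem_comap, Ideal.mem_span_singleton, Ideal.mem_span_singleton, pow_succ',
        LinearMap.lsmul_apply, smul_eq_mul]
      exact mul_dvd_mul_iff_left hϖ
    have h3 : Submodule.map (Ideal.span {ϖ}).mkQ (Ideal.span {ϖ ^ (k + 1)}) = ⊥ := by
      rw [eq_bot_iff]
      rintro _ ⟨x, hx, rfl⟩
      refine (Submodule.mem_bot _).2 ((Submodule.Quotient.mk_eq_zero _).2 ?_)
      have := Ideal.mem_span_singleton.1 hx
      exact Ideal.mem_span_singleton.2 ((dvd_pow_self ϖ (Nat.succ_ne_zero k)).trans this)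
    rw [h2, h3, ih, Nat.card_congr (Submodule.quotEquivOfEqBot _ rfl).toEquiv] at h1
    rw [h1, pow_succ]

/-- Over a discrete valuation ring with residue field of order `q`, the ideals of finite index are
one of each index `q ^ k`. -/
theorem latticeSeries_self {V : Type*} [CommRing V] [IsDomain V] [IsDiscreteValuationRing V]
    {q : ℕ} (hq : Nat.card (IsLocalRing.ResidueField V) = q) (hq1 : 1 < q) {b : ℕ} (hb : b ≠ 0)
    (c : ℕ) :
    latticeSeries V V b c =
      dirichletSum fun k : ℕ => dirichletMono (q ^ (k * b)) ((q : ℝ≥0∞) ^ (k * c)) := by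
  have hinf : Infinite V := by
    by_contra h
    rw [not_infinite_iff_finite] at h
    exact IsDiscreteValuationRing.not_isField V (Finite.isField_of_domain V)
  obtain ⟨ϖ, hϖ⟩ := IsDiscreteValuationRing.exists_irreducible V
  have hq' : Nat.card (V ⧸ Ideal.span {ϖ}) = q := by
    rw [← hϖ.maximalIdeal_eq]; exact hq
  have hcard := Ideal.card_quotient_span_singleton_pow hϖ.ne_zero
  rw [hq'] at hcard
  rw [latticeSeries, dirichletSum_subtype (fun L => L ≠ ⊥) _ fun L hL => by
    rw [not_not.1 hL]
    have : Nat.card (V ⧸ (⊥ : Submodule V V)) = 0 := by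
      rw [Nat.card_congr (Submodule.quotEquivOfEqBot _ rfl).toEquiv]
      exact Nat.card_eq_zero_of_infinite
    rw [this, zero_pow hb, dirichletMono_zero]]
  let E : ℕ → {L : Submodule V V // L ≠ ⊥} := fun k => ⟨Ideal.span {ϖ ^ k}, by
    rw [Ne, Ideal.span_singleton_eq_bot]; exact pow_ne_zero k hϖ.ne_zero⟩
  have hE : Function.Bijective E := by
    constructor
    · intro k l h
      have h1 : Ideal.span {ϖ ^ k} = Ideal.span {ϖ ^ l} := Subtype.ext_iff.1 h
      have h2 := hcard k
      rw [h1, hcard l] at h2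
      exact (Nat.pow_right_injective hq1 h2).symm
    · rintro ⟨L, hL⟩
      obtain ⟨k, hk⟩ := IsDiscreteValuationRing.ideal_eq_span_pow_irreducible hL hϖ
      exact ⟨k, Subtype.ext hk.symm⟩
  rw [← dirichletSum_equiv (Equiv.ofBijective E hE)]
  congr 1; funext k
  have : Nat.card (V ⧸ (E k).1) = q ^ k := hcard k
  rw [Equiv.ofBijective_apply, this, ← pow_mul]
  push_cast
  rw [← pow_mul]

/-- The number of submodules of finite index of `O ^ d`, for `O` a two-dimensional regular local
ring with residue field of order `q`: up to any given order, their generating series is a product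
of geometric series. -/
theorem IsRegularLocalRing.submoduleSeries_apply {O : Type u} [CommRing O] [IsRegularLocalRing O]
    (hO : ringKrullDim O = 2) {q : ℕ} (hq : Nat.card (IsLocalRing.ResidueField O) = q)
    (hq1 : 1 < q) (d : ℕ) {D : ℕ} (hD : D ≠ 0) {m r : ℕ} (hmr : m ≤ r) :
    dirichletSum (fun N : Submodule O (Fin d → O) =>
        dirichletMono (Nat.card ((Fin d → O) ⧸ N) ^ D) 1) m =
      (∏ i ∈ Finset.range r, ∏ j ∈ Finset.range d, dirichletSum fun k : ℕ =>
        dirichletMono (q ^ (k * (D * (i + 1)))) ((q : ℝ≥0∞) ^ (k * (d * i + j)))) m := by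
  obtain ⟨y, hym, hy0, hdom, hdvr⟩ :=
    IsRegularLocalRing.exists_isDiscreteValuationRing_quotient hO
  have := IsRegularLocalRing.isDomain O
  let σ := Ideal.Quotient.mk (Ideal.span {y})
  have hσs : Function.Surjective σ := Ideal.Quotient.mk_surjective
  have : RingHomSurjective σ := ⟨hσs⟩
  let V := O ⧸ Ideal.span {y}
  let π : (Fin d → O) →ₛₗ[σ] (Fin d → V) :=
    { toFun := fun v i => σ (v i)
      map_add' := fun v w => by funext i; exact map_add σ _ _
      map_smul' := fun a v => by funext i; exact map_mul σ _ _ }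
  have hqV : Nat.card (IsLocalRing.ResidueField V) = q := by
    rw [← hq]
    have hloc : IsLocalHom σ := IsLocalHom.of_surjective σ hσs
    exact (Nat.card_congr (Equiv.ofBijective (IsLocalRing.ResidueField.map σ)
      ⟨RingHom.injective _, fun z => by
        obtain ⟨z, rfl⟩ := IsLocalRing.residue_surjective z
        obtain ⟨z, rfl⟩ := hσs z
        exact ⟨IsLocalRing.residue O z, IsLocalRing.ResidueField.map_residue σ z⟩⟩)).symm
  have hinf : Infinite V := by
    by_contra h
    rw [not_infinite_iff_finite] at h
    exact IsDiscreteValuationRing.not_isField V (Finite.isField_of_domain V)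
  have hprod := surfaceSeries_eq_prod (π := π) (y := y) (Ideal.mk_ker) (fun x hx => by
      funext i
      exact (mul_eq_zero.1 (congrFun hx i)).resolve_left hy0) (fun x => by
      constructor
      · intro hx
        have : ∀ i, ∃ z, y * z = x i := fun i => by
          obtain ⟨z, hz⟩ := Ideal.mem_span_singleton.1
            (Ideal.Quotient.eq_zero_iff_mem.1 (congrFun hx i))
          exact ⟨z, hz.symm⟩
        choose z hz using this
        exact ⟨z, funext hz⟩
      · rintro ⟨z, rfl⟩
        funext i
        exact Ideal.Quotient.eq_zero_iff_mem.2 (Ideal.mem_span_singleton.2 ⟨z i, rfl⟩))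
    (fun w => ⟨fun i => (hσs (w i)).choose, funext fun i => (hσs (w i)).choose_spec⟩)
    (Pi.basisFun V (Fin d)) hD r 0
  have hgeo : ∀ i j, latticeSeries V V (D * (0 + i + 1)) (d * (0 + i) + j) =
      dirichletSum fun k : ℕ =>
        dirichletMono (q ^ (k * (D * (i + 1)))) ((q : ℝ≥0∞) ^ (k * (d * i + j))) := fun i j => by
    rw [latticeSeries_self hqV hq1 (mul_ne_zero hD (Nat.succ_ne_zero _)), zero_add]
  rw [← hprod.trans (Finset.prod_congr rfl fun i _ => Finset.prod_congr rfl fun j _ => hgeo i j),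
    surfaceSeries]
  simp only [pow_zero, mul_one, mul_zero, dirichletSum_apply]
  refine (tsum_subtype_eq_of_support_subset
    (s := {N : Submodule O (Fin d → O) | ∀ x, y ^ r • x ∈ N}) fun N hN x => ?_).symm
  -- a submodule whose index is at most `m` contains `y ^ m O ^ d`
  have h1 : Nat.card ((Fin d → O) ⧸ N) ^ D = m ∧ m ≠ 0 := by
    by_contra h
    exact hN (if_neg fun h' => h ⟨h'.1.symm, h'.2⟩)
  have h2 : Nat.card ((Fin d → O) ⧸ N) ≠ 0 := fun h => h1.2 (by rw [← h1.1, h, zero_pow hD])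
  have := Nat.finite_of_card_ne_zero h2
  have h3 := IsLocalRing.pow_card_smul_eq_zero hym
    (((Nat.le_self_pow hD _).trans h1.1.le).trans hmr) (Submodule.Quotient.mk (p := N) x)
  exact (Submodule.Quotient.mk_eq_zero N).1 h3

end Surface

/-! ### Azumaya algebras over finite fields and finite local rings -/

section Azumaya

open scoped TensorProduct

section Fibre

variable {R B : Type*} [CommRing R] [Ring B] [Algebra R B] [IsAzumaya R B]
  (κ : Type*) {S : Type*} [Field κ] [Algebra R κ] [Ring S] [Algebra κ S] [Algebra R S]
  [IsScalarTower R κ S]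

/-- Every linear endomorphism of a fibre of an Azumaya algebra is a sum of maps
`x ↦ a * (x * b)`. -/
theorem IsAzumaya.endomorphism_induction (π : B →ₐ[R] S) (hπ : Function.Surjective π)
    (P : (S →ₗ[κ] S) → Prop) (h0 : P 0) (hadd : ∀ f g, P f → P g → P (f + g))
    (hmul : ∀ a b, P ((LinearMap.mulLeft κ a).comp (LinearMap.mulRight κ b))) (φ : S →ₗ[κ] S) :
    P φ := by
  obtain ⟨ψ, hψ⟩ := Module.projective_lifting_property π.toLinearMap
    ((φ.restrictScalars R).comp π.toLinearMap) hπ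
  obtain ⟨t, rfl⟩ := (IsAzumaya.bij (R := R) (A := B)).2 ψ
  have h1 : ∀ x, φ (π x) = π (AlgHom.mulLeftRight R B t x) := fun x =>
    (LinearMap.congr_fun hψ x).symm
  have h2 : ∃ f : S →ₗ[κ] S, P f ∧ ∀ x, f (π x) = π (AlgHom.mulLeftRight R B t x) := by
    clear h1 hψ
    induction t using TensorProduct.induction_on with
    | zero => exact ⟨0, h0, fun x => by simp⟩
    | tmul a b =>
      exact ⟨_, hmul (π a) (π b.unop), fun x => by
        rw [AlgHom.mulLeftRight_apply, map_mul, map_mul, mul_assoc]; rfl⟩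
    | add s t hs ht =>
      obtain ⟨f, hf, hf'⟩ := hs
      obtain ⟨g, hg, hg'⟩ := ht
      exact ⟨f + g, hadd _ _ hf hg, fun x => by
        rw [map_add, LinearMap.add_apply, LinearMap.add_apply, map_add, hf', hg']⟩
  obtain ⟨f, hf, hf'⟩ := h2
  have : f = φ := by
    ext x
    obtain ⟨x, rfl⟩ := hπ x
    rw [hf', h1]
  exact this ▸ hf

include κ in
/-- Some endomorphism of the vector space `S` takes a given nonzero element of an ideal to `1`, and
the endomorphisms of `S` preserve ideals. -/
theorem IsAzumaya.isSimpleRing_fibre [Nontrivial S] (π : B →ₐ[R] S) (hπ : Function.Surjective π) :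
    IsSimpleRing S := by
  refine IsSimpleRing.of_eq_bot_or_eq_top fun I => ?_
  by_cases h : ∀ x ∈ I, x = 0
  · left
    rw [eq_bot_iff]
    intro x hx
    rw [h x hx]
    exact zero_mem _
  · right
    push Not at h
    obtain ⟨x, hx, hx0⟩ := h
    obtain ⟨f, hf⟩ : ∃ f : Module.Dual κ S, f x ≠ 0 := by
      by_contra! hcon
      exact hx0 ((Module.forall_dual_apply_eq_zero_iff κ x).1 hcon)
    let φ : S →ₗ[κ] S := (LinearMap.toSpanSingleton κ S 1).comp ((f x)⁻¹ • f)
    have h1 : φ x = 1 := by simp [φ, hf]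
    have h2 : φ x ∈ I := IsAzumaya.endomorphism_induction κ π hπ (fun φ => φ x ∈ I) (zero_mem _)
      (fun _ _ => add_mem) (fun a b => I.mul_mem_left _ _ (I.mul_mem_right _ _ hx)) φ
    rw [h1] at h2
    rw [eq_top_iff]
    intro y _
    simpa using I.mul_mem_left y 1 h2

/-- The endomorphisms of the vector space `S` commute with multiplication by a central element;
apply this to a projection onto the line spanned by `1`. -/
theorem IsAzumaya.isCentral_fibre [Nontrivial S] (π : B →ₐ[R] S) (hπ : Function.Surjective π) :
    Algebra.IsCentral κ S := by
  refine ⟨fun z hz => ?_⟩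
  rw [Subalgebra.mem_center_iff] at hz
  obtain ⟨f, hf⟩ : ∃ f : Module.Dual κ S, f 1 ≠ 0 := by
    by_contra! hcon
    exact one_ne_zero ((Module.forall_dual_apply_eq_zero_iff κ (1 : S)).1 hcon)
  let φ : S →ₗ[κ] S := (LinearMap.toSpanSingleton κ S 1).comp ((f 1)⁻¹ • f)
  have h1 : φ 1 = 1 := by simp [φ, hf]
  -- multiplication by the central element `z` commutes with `φ`
  have h2 : φ z = z * φ 1 := by
    have h3 : ∀ x, φ (z * x) = z * φ x := by
      refine IsAzumaya.endomorphism_induction κ π hπ (fun φ => ∀ x, φ (z * x) = z * φ x) ?_ ?_ ?_ φ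
      · simp
      · intro f g hf hg x
        simp only [LinearMap.add_apply, hf, hg, mul_add]
      · intro a b x
        simp only [LinearMap.comp_apply, LinearMap.mulLeft_apply, LinearMap.mulRight_apply]
        rw [mul_assoc z x b, ← mul_assoc a, hz a, mul_assoc]
    simpa using h3 1
  rw [h1, mul_one] at h2
  rw [Algebra.mem_bot, ← h2]
  exact ⟨(f 1)⁻¹ * f z, by simp [φ, Algebra.algebraMap_eq_smul_one]⟩

/-- A fibre of an Azumaya algebra over a finite field is a matrix algebra, by the theorems of
Wedderburn. -/
theorem IsAzumaya.nonempty_algEquiv_matrix [Finite κ] [Nontrivial S] (π : B →ₐ[R] S)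
    (hπ : Function.Surjective π) [Module.Finite κ S] {d : ℕ} (hd : Module.finrank κ S = d ^ 2) :
    Nonempty (S ≃ₐ[κ] Matrix (Fin d) (Fin d) κ) := by
  have := IsAzumaya.isSimpleRing_fibre κ π hπ
  have := IsAzumaya.isCentral_fibre κ π hπ
  have : IsArtinianRing S := IsArtinianRing.of_finite κ S
  obtain ⟨n, hn, D, _, _, _, ⟨e⟩⟩ := IsSimpleRing.exists_algEquiv_matrix_divisionRing_finite κ S
  have : Finite D := Module.finite_of_finite κ
  have hcomm : ∀ a b : D, a * b = b * a := fun a b => (littleWedderburn D).mul_comm a b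
  have hsurj : Function.Surjective (algebraMap κ D) := by
    intro z
    have hz : e.symm (Matrix.scalar (Fin n) z) ∈ Subalgebra.center κ S := by
      rw [Subalgebra.mem_center_iff]
      intro b
      apply e.injective
      rw [map_mul, map_mul, e.apply_symm_apply]
      ext i j
      simp [Matrix.scalar_apply, Matrix.diagonal_mul, Matrix.mul_diagonal, hcomm]
    obtain ⟨a, ha⟩ := Algebra.mem_bot.1 (Algebra.IsCentral.out hz)
    have h1 := congrArg e ha
    rw [AlgEquiv.commutes, e.apply_symm_apply] at h1
    have h2 := congrFun (congrFun h1 0) 0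
    refine ⟨a, ?_⟩
    simpa [Matrix.algebraMap_matrix_apply] using h2
  let eD : κ ≃ₐ[κ] D := AlgEquiv.ofBijective (Algebra.ofId κ D)
    ⟨(algebraMap κ D).injective, hsurj⟩
  let e' : S ≃ₐ[κ] Matrix (Fin n) (Fin n) κ := e.trans eD.symm.mapMatrix
  have h1 := e'.toLinearEquiv.finrank_eq
  rw [hd, Module.finrank_matrix, Module.finrank_self, Fintype.card_fin, mul_one, ← pow_two] at h1
  have h2 : d = n := Nat.pow_left_injective (n := 2) (by norm_num) h1
  subst h2
  exact ⟨e'⟩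

end Fibre

section Reduction

variable {R : Type*} [CommRing R] (B : Type*) [Ring B] [Algebra R B] (I : Ideal R)

theorem Ideal.surjective_includeRight_quotient :
    Function.Surjective (Algebra.TensorProduct.includeRight : B →ₐ[R] (R ⧸ I) ⊗[R] B) := by
  intro z
  obtain ⟨w, hw⟩ := Submodule.mkQ_surjective _ (TensorProduct.quotTensorEquivQuotSMul B I z)
  refine ⟨w, (TensorProduct.quotTensorEquivQuotSMul B I).injective ?_⟩
  rw [← hw]
  simp

theorem Ideal.includeRight_quotient_eq_zero_iff (b : B) :
    (Algebra.TensorProduct.includeRight : B →ₐ[R] (R ⧸ I) ⊗[R] B) b = 0 ↔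
      b ∈ I • (⊤ : Submodule R B) := by
  rw [← (TensorProduct.quotTensorEquivQuotSMul B I).map_eq_zero_iff]
  have := TensorProduct.quotTensorEquivQuotSMul_mk_tmul I (1 : R) b
  rw [one_smul, map_one] at this
  rw [Algebra.TensorProduct.includeRight_apply, this, Submodule.Quotient.mk_eq_zero]

end Reduction

end Azumaya

/-! ### Lifting matrix units over a finite local ring -/

section Lifting

variable {O A : Type*} [CommRing O] [Ring A] [Algebra O A]

theorem Submodule.mul_mem_mul_smul_top {I J : Ideal O} {x y : A}
    (hx : x ∈ I • (⊤ : Submodule O A)) (hy : y ∈ J • (⊤ : Submodule O A)) :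
    x * y ∈ (I * J) • (⊤ : Submodule O A) := by
  induction hx using Submodule.smul_induction_on' with
  | smul r hr a _ =>
    induction hy using Submodule.smul_induction_on' with
    | smul s hs b _ =>
      rw [smul_mul_smul_comm]
      exact Submodule.smul_mem_smul (Ideal.mul_mem_mul hr hs) trivial
    | add y _ z _ hy hz => rw [mul_add]; exact add_mem hy hz
  | add y _ z _ hy hz => rw [add_mul]; exact add_mem hy hz

theorem Submodule.pow_mem_pow_smul_top {I : Ideal O} {x : A}
    (hx : x ∈ I • (⊤ : Submodule O A)) (n : ℕ) : x ^ n ∈ I ^ n • (⊤ : Submodule O A) := by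
  induction n with
  | zero => simp
  | succ n ih => rw [pow_succ, pow_succ]; exact Submodule.mul_mem_mul_smul_top ih hx

variable [IsLocalRing O] [Finite O] {κ : Type*} [CommRing κ] {d : ℕ}

/-- The matrix algebra structure of a fibre lifts: if `A` is free of rank `d ^ 2` over a finite
local ring and `A` modulo the maximal ideal is `M_d(κ)`, then `A` is a matrix algebra. An idempotent
`e` lifting the matrix unit `E₁₁` is chosen; by Nakayama's lemma `A e` is free with a basis lifting
the first column, and `A` acts on it as the full endomorphism ring. -/
theorem IsLocalRing.nonempty_ringEquiv_matrix [Module.Finite O A] [Module.Free O A]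
    (hrank : Module.finrank O A = d ^ 2) (res : O →+* κ) (hres : Function.Surjective res)
    (hker : RingHom.ker res ≤ IsLocalRing.maximalIdeal O) (ρ : A →+* Matrix (Fin d) (Fin d) κ)
    (hρ : Function.Surjective ρ) (hρs : ∀ (c : O) (a : A), ρ (c • a) = res c • ρ a)
    (hρk : ∀ a, ρ a = 0 → a ∈ IsLocalRing.maximalIdeal O • (⊤ : Submodule O A)) (hd : 1 ≤ d) :
    Nonempty (A ≃+* Matrix (Fin d) (Fin d) O) := by
  classical
  have hA : Finite A := Module.finite_of_finite O
  have hjac : IsLocalRing.maximalIdeal O ≤ Ideal.jacobson ⊥ :=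
    (IsLocalRing.jacobson_eq_maximalIdeal ⊥ bot_ne_top).ge
  obtain ⟨N, hN⟩ : IsNilpotent (IsLocalRing.maximalIdeal O) := by
    rw [← IsLocalRing.jacobson_eq_maximalIdeal (⊥ : Ideal O) bot_ne_top]
    exact IsArtinianRing.isNilpotent_jacobson_bot
  let o : Fin d := ⟨0, hd⟩
  obtain ⟨e, he, hρe⟩ := exists_isIdempotentElem_eq_of_ker_isNilpotent ρ
    (fun x hx => ⟨N, by simpa [hN] using Submodule.pow_mem_pow_smul_top (hρk x hx) N⟩)
    (Matrix.single o o 1) (hρ _) (by simp [IsIdempotentElem])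
  choose w hw using fun i : Fin d => hρ (Matrix.single i o 1)
  choose u hu using fun ij : Fin d × Fin d => hρ (Matrix.single ij.1 ij.2 1)
  -- lifts of the matrix units, those of the first column lying in `A e`
  let c : Fin d × Fin d → A := fun ij => if ij.2 = o then w ij.1 * e else u ij
  have hc : ∀ ij, ρ (c ij) = Matrix.single ij.1 ij.2 1 := by
    rintro ⟨i, j⟩
    by_cases hj : j = o
    · subst hj
      simp [c, hw, hρe]
    · simp [c, hj, hu]
  have hspan : ⊤ ≤ Submodule.span O (Set.range c) := by
    refine Submodule.le_of_le_smul_of_le_jacobson_bot (IsNoetherian.noetherian _) hjac ?_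
    intro a _
    choose x hx using fun ij : Fin d × Fin d => hres (ρ a ij.1 ij.2)
    have h1 : ∑ ij, x ij • c ij ∈ Submodule.span O (Set.range c) :=
      Submodule.sum_mem _ fun ij _ => Submodule.smul_mem _ _ (Submodule.subset_span ⟨ij, rfl⟩)
    have h2 : ρ (a - ∑ ij, x ij • c ij) = 0 := by
      rw [map_sub, map_sum, sub_eq_zero]
      simp only [hρs, hc, hx]
      rw [Fintype.sum_prod_type]
      conv_lhs => rw [Matrix.matrix_eq_sum_single (ρ a)]
      simp [Matrix.smul_single]
    exact Submodule.mem_sup.2 ⟨_, h1, _, hρk _ h2, by abel⟩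
  -- a surjection between finite sets of the same cardinality is injective
  have hli : LinearIndependent O c := by
    rw [linearIndependent_iff_injective_fintypeLinearCombination]
    refine (Function.Surjective.bijective_of_nat_card_le ?_ ?_).1
    · rw [← LinearMap.range_eq_top, Fintype.range_linearCombination]
      exact top_le_iff.1 hspan
    · rw [Nat.card_congr (Module.finBasis O A).equivFun.toEquiv, hrank]
      simp only [Nat.card_fun, Nat.card_prod, Nat.card_fin, pow_two, le_refl]
  -- the left module `A e`
  let P : Submodule A A := Submodule.span A {e}
  have hP : ∀ y ∈ P, y * e = y := by
    intro y hy
    obtain ⟨a, rfl⟩ := Submodule.mem_span_singleton.1 hy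
    rw [smul_eq_mul, mul_assoc, he]
  have hcP : ∀ i, c (i, o) ∈ P := fun i => by
    simp only [c, if_true]
    exact Submodule.smul_mem _ _ (Submodule.mem_span_singleton_self e)
  let b : Fin d → P := fun i => ⟨c (i, o), hcP i⟩
  have hbli : LinearIndependent O b := by
    refine LinearIndependent.of_comp (P.subtype.restrictScalars O) ?_
    exact hli.comp (fun i => (i, o)) fun i j h => (Prod.ext_iff.1 h).1
  have hPm : ∀ y ∈ IsLocalRing.maximalIdeal O • (⊤ : Submodule O A), ∀ h : y * e ∈ P,
      (⟨y * e, h⟩ : P) ∈ IsLocalRing.maximalIdeal O • (⊤ : Submodule O P) := by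
    intro y hy
    induction hy using Submodule.smul_induction_on' with
    | smul r hr a _ =>
      intro h
      have h' : a * e ∈ P := Submodule.smul_mem _ _ (Submodule.mem_span_singleton_self e)
      have : (⟨r • a * e, h⟩ : P) = r • ⟨a * e, h'⟩ := Subtype.ext (smul_mul_assoc r a e)
      rw [this]
      exact Submodule.smul_mem_smul hr trivial
    | add y _ z _ hy hz =>
      intro h
      have h' : ∀ a : A, a * e ∈ P := fun a =>
        Submodule.smul_mem _ _ (Submodule.mem_span_singleton_self e)
      have : (⟨(y + z) * e, h⟩ : P) = ⟨y * e, h' y⟩ + ⟨z * e, h' z⟩ :=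
        Subtype.ext (add_mul y z e)
      rw [this]
      exact add_mem (hy _) (hz _)
  have hbspan : ⊤ ≤ Submodule.span O (Set.range b) := by
    refine Submodule.le_of_le_smul_of_le_jacobson_bot (IsNoetherian.noetherian _) hjac ?_
    rintro ⟨a, ha⟩ -
    choose x hx using fun i : Fin d => hres (ρ a i o)
    have h1 : ∑ i, x i • b i ∈ Submodule.span O (Set.range b) :=
      Submodule.sum_mem _ fun ij _ => Submodule.smul_mem _ _ (Submodule.subset_span ⟨ij, rfl⟩)
    have hco : ((∑ i, x i • b i : P) : A) = ∑ i, x i • c (i, o) := by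
      rw [AddSubmonoidClass.coe_finsetSum]; rfl
    have h2 : ρ (a - (∑ i, x i • b i : P)) = 0 := by
      rw [map_sub, hco, map_sum, sub_eq_zero]
      simp only [hρs, hc, hx]
      conv_lhs => rw [← hP a ha, map_mul, hρe]
      ext i j
      rw [Matrix.sum_apply]
      by_cases hj : j = o
      · subst hj
        simp [Matrix.single_apply]
      · simp [Ne.symm hj, Matrix.mul_apply]
    have h3 := hρk _ h2
    have h4 : (a - (∑ i, x i • b i : P)) * e = a - (∑ i, x i • b i : P) :=
      hP _ (sub_mem ha (Subtype.mem _))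
    refine Submodule.mem_sup.2
      ⟨_, h1, _, hPm _ h3 (by rw [h4]; exact sub_mem ha (Subtype.mem _)), ?_⟩
    exact Subtype.ext (by simp only [h4, Submodule.coe_add, add_sub_cancel])
  let bP : Module.Basis (Fin d) O P := Module.Basis.mk hbli hbspan
  -- the action of `A` on `A e`, which reduces to `ρ` and hence is surjective by Nakayama's lemma
  let Φ : A →+* Matrix (Fin d) (Fin d) O :=
    ((LinearMap.toMatrixAlgEquiv bP : _ →+* _)).comp (Algebra.lsmul O O P : A →ₐ[O] _).toRingHom
  have hΦs : ∀ (r : O) (a : A), Φ (r • a) = r • Φ a := fun r a => by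
    simp [Φ]
  have hΦ : ∀ a i j, res (Φ a i j) = ρ a i j := by
    intro a i j
    have h1 : a * c (j, o) = ∑ k, Φ a k j • c (k, o) := by
      have h2 := bP.sum_repr (a • b j)
      have h3 : ∀ k, bP.repr (a • b j) k = Φ a k j := fun k => by
        simp [Φ, LinearMap.toMatrixAlgEquiv_apply, bP]
      simp only [h3] at h2
      have h4 := congrArg (Subtype.val) h2
      rw [AddSubmonoidClass.coe_finsetSum] at h4
      simpa [bP, b] using h4.symm
    have h5 := congrFun (congrFun (congrArg ρ h1) i) o
    rw [map_mul, map_sum, Matrix.sum_apply] at h5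
    simpa [hρs, hc, Matrix.single_apply] using h5.symm
  let Φl : A →ₗ[O] Matrix (Fin d) (Fin d) O :=
    { toFun := Φ, map_add' := map_add Φ, map_smul' := hΦs }
  have hsurj : ⊤ ≤ LinearMap.range Φl := by
    refine Submodule.le_of_le_smul_of_le_jacobson_bot (IsNoetherian.noetherian _) hjac ?_
    intro M _
    obtain ⟨a, ha⟩ := hρ (M.map res)
    refine Submodule.mem_sup.2 ⟨Φl a, ⟨a, rfl⟩, M - Φ a, ?_, by simp [Φl]⟩
    rw [Matrix.matrix_eq_sum_single (M - Φ a)]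
    refine Submodule.sum_mem _ fun i _ => Submodule.sum_mem _ fun j _ => ?_
    have h1 : (M - Φ a) i j ∈ IsLocalRing.maximalIdeal O := by
      apply hker
      rw [RingHom.mem_ker, Matrix.sub_apply, map_sub, hΦ, ha, Matrix.map_apply, sub_self]
    have h2 := Submodule.smul_mem_smul (N := (⊤ : Submodule O (Matrix (Fin d) (Fin d) O))) h1
      (show Matrix.single i j (1 : O) ∈ _ from trivial)
    simpa [Matrix.smul_single] using h2
  have hs : Function.Surjective Φ := fun M => hsurj (x := M) trivial
  refine ⟨RingEquiv.ofBijective Φ (hs.bijective_of_nat_card_le ?_)⟩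
  rw [Nat.card_congr (Module.finBasis O A).equivFun.toEquiv, hrank]
  have h1 : Nat.card (Matrix (Fin d) (Fin d) O) = Nat.card (Fin d → Fin d → O) := rfl
  rw [h1]
  simp only [Nat.card_fun, Nat.card_fin, ← pow_mul, pow_two, le_refl]

end Lifting

/-! ### Submodules of given finite index -/

section FiniteIndex

theorem Submodule.natCard_quotient_eq {S M W : Type*} [Ring S] [AddCommGroup M] [Module S M]
    [AddCommGroup W] (p : Submodule S M) (f : M →+ W) (hf : Function.Surjective f)
    (h : ∀ x, f x = 0 ↔ x ∈ p) : Nat.card (M ⧸ p) = Nat.card W := by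
  have hp : p.toAddSubgroup = f.ker := AddSubgroup.ext fun x => (h x).symm
  have h1 : Nat.card (M ⧸ f.ker) = Nat.card W :=
    Nat.card_congr (QuotientAddGroup.quotientKerEquivOfSurjective f hf).toEquiv
  rw [← h1, ← hp]
  rfl

theorem Submodule.natCard_quotient_comap {S S' M M' : Type*} [Ring S] [Ring S'] [AddCommGroup M]
    [Module S M] [AddCommGroup M'] [Module S' M'] {σ : S →+* S'} (f : M →ₛₗ[σ] M')
    (L : Submodule S' M') (hf : ∀ y, ∃ x, y - f x ∈ L) :
    Nat.card (M ⧸ L.comap f) = Nat.card (M' ⧸ L) := by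
  refine Submodule.natCard_quotient_eq _ (L.mkQ.toAddMonoidHom.comp f.toAddMonoidHom) ?_ ?_
  · intro y
    obtain ⟨y, rfl⟩ := L.mkQ_surjective y
    obtain ⟨x, hx⟩ := hf y
    exact ⟨x, ((Submodule.Quotient.eq L).2 hx).symm⟩
  · intro x
    exact Submodule.Quotient.mk_eq_zero L

/-- Submodules of the target of a surjection correspond to submodules of the source containing the
kernel, with the same index. -/
theorem Submodule.card_natCard_quotient_eq_of_surjective {S S' M M' : Type*} [Ring S] [Ring S']
    [AddCommGroup M] [Module S M] [AddCommGroup M'] [Module S' M'] {σ : S →+* S'}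
    [RingHomSurjective σ] (f : M →ₛₗ[σ] M') (hf : Function.Surjective f) (P : ℕ → Prop) :
    ENat.card {L : Submodule S' M' // P (Nat.card (M' ⧸ L))} =
      ENat.card {L : Submodule S M // P (Nat.card (M ⧸ L)) ∧ LinearMap.ker f ≤ L} := by
  have hc : ∀ L : Submodule S' M', Nat.card (M ⧸ L.comap f) = Nat.card (M' ⧸ L) := fun L =>
    Submodule.natCard_quotient_comap f L fun y => by
      obtain ⟨x, rfl⟩ := hf y
      exact ⟨x, by simp⟩
  refine ENat.card_congr (Equiv.ofBijective
    (fun L => ⟨L.1.comap f, by rw [hc]; exact L.2, LinearMap.ker_le_comap f⟩) ⟨?_, ?_⟩)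
  · intro L L' h
    exact Subtype.ext (Submodule.comap_injective_of_surjective hf (congrArg Subtype.val h))
  · rintro ⟨L, hL, hker⟩
    have h1 : (L.map f).comap f = L := by
      rw [Submodule.comap_map_eq, sup_eq_left]
      exact hker
    refine ⟨⟨L.map f, ?_⟩, Subtype.ext h1⟩
    rw [← hc, h1]
    exact hL

section Nakayama

variable {R M : Type*} [CommRing R] [AddCommGroup M] [Module R M] [Finite M] (m : Ideal R)

theorem Submodule.eq_bot_of_le_smul_of_injective (K : Submodule R M)
    (hs : ∀ s : R, s - 1 ∈ m → ∀ x : M, s • x = 0 → x = 0) (h : K ≤ m • K) : K = ⊥ := by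
  obtain ⟨r, hr, hrK⟩ := Submodule.exists_sub_one_mem_and_smul_eq_zero_of_fg_of_le_smul m K
    (IsNoetherian.noetherian K) h
  exact (Submodule.eq_bot_iff K).2 fun x hx => hs r hr x (hrK x hx)

/-- A module of cardinality at most `e` on which the elements of `1 + m` act injectively is killed
by `m ^ e`, since the chain of the `m ^ i M` is strictly decreasing until it reaches `0`. -/
theorem Ideal.pow_smul_top_eq_bot_of_card_le
    (hs : ∀ s : R, s - 1 ∈ m → ∀ x : M, s • x = 0 → x = 0) {e : ℕ} (he : Nat.card M ≤ e) :
    m ^ e • (⊤ : Submodule R M) = ⊥ := by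
  have key : ∀ i : ℕ, m ^ i • (⊤ : Submodule R M) = ⊥ ∨
      Nat.card (m ^ i • (⊤ : Submodule R M) : Submodule R M) + i ≤ Nat.card M := by
    intro i
    induction i with
    | zero =>
      right
      simp
    | succ i ih =>
      rcases ih with h | h
      · left
        rw [pow_succ', Submodule.mul_smul, h, Submodule.smul_bot]
      · rcases eq_or_ne (m ^ (i + 1) • (⊤ : Submodule R M)) ⊥ with h0 | h0
        · exact Or.inl h0
        · right
          have hlt : m ^ (i + 1) • (⊤ : Submodule R M) < m ^ i • (⊤ : Submodule R M) := by
            refine lt_of_le_not_ge (Submodule.smul_mono_left (Ideal.pow_le_pow_right i.le_succ)) ?_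
            intro hle
            rw [pow_succ', Submodule.mul_smul] at hle h0
            rw [Submodule.eq_bot_of_le_smul_of_injective m _ hs hle, Submodule.smul_bot] at h0
            exact h0 rfl
          have h2 := Set.ncard_lt_ncard (show
            ((m ^ (i + 1) • (⊤ : Submodule R M) : Submodule R M) : Set M) <
              (m ^ i • (⊤ : Submodule R M) : Submodule R M) from hlt) (Set.toFinite _)
          have h3 : ∀ K : Submodule R M, Nat.card K = (K : Set M).ncard := fun K => rfl
          rw [h3] at h ⊢
          omega
  rcases key e with h | h
  · exact h
  · have := Nat.card_pos (α := (m ^ e • (⊤ : Submodule R M) : Submodule R M))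
    omega

/-- A nonzero finite module on which the elements of `1 + m` act injectively has at least as many
elements as `R / m`. -/
theorem Ideal.natCard_quotient_le_of_nontrivial [m.IsMaximal] [Nontrivial M]
    (hs : ∀ s : R, s - 1 ∈ m → ∀ x : M, s • x = 0 → x = 0) : Nat.card (R ⧸ m) ≤ Nat.card M := by
  have h1 : ¬ ⊤ ≤ m • (⊤ : Submodule R M) := fun h =>
    top_ne_bot (Submodule.eq_bot_of_le_smul_of_injective m ⊤ hs h)
  obtain ⟨x, -, hx⟩ := SetLike.not_le_iff_exists.1 h1
  refine Nat.card_le_card_of_injective (fun r : R ⧸ m => r.out • x) fun r r' h => ?_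
  by_contra hne
  have h2 : r.out - r'.out ∉ m := by
    rw [← Ideal.Quotient.eq, Ideal.Quotient.mk_out, Ideal.Quotient.mk_out]
    exact hne
  obtain ⟨s, hsm⟩ := Ideal.IsMaximal.exists_inv ‹m.IsMaximal› h2
  obtain ⟨i, hi, hsi⟩ := hsm
  have h3 : (r.out - r'.out) • x = 0 := by rw [sub_smul, sub_eq_zero]; exact h
  have h4 : x = i • x := by
    conv_lhs => rw [← one_smul R x, ← hsi, add_smul, mul_smul, h3, smul_zero, zero_add]
  exact hx (h4 ▸ Submodule.smul_mem_smul hi trivial)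

end Nakayama

/-- Left ideals of a matrix ring correspond to submodules of the module of rows. -/
theorem Matrix.card_ideal_natCard_quotient_eq {O : Type*} [CommRing O] {d : ℕ} (hd : 1 ≤ d)
    (P : ℕ → Prop) :
    ENat.card {J : Ideal (Matrix (Fin d) (Fin d) O) //
      P (Nat.card (Matrix (Fin d) (Fin d) O ⧸ J))} =
    ENat.card {L : Submodule O (Fin d → O) // P (Nat.card ((Fin d → O) ⧸ L) ^ d)} := by
  classical
  let J : Submodule O (Fin d → O) → Ideal (Matrix (Fin d) (Fin d) O) := fun L =>
    { carrier := {A | ∀ i, A i ∈ L}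
      add_mem' := fun ha hb i => add_mem (ha i) (hb i)
      zero_mem' := fun i => zero_mem L
      smul_mem' := fun A B hB i => by
        have : (A * B) i = ∑ k, A i k • B k := by
          ext j
          simp [Matrix.mul_apply, Finset.sum_apply]
        change (A * B) i ∈ L
        rw [this]
        exact Submodule.sum_mem _ fun k _ => Submodule.smul_mem _ _ (hB k) }
  have hc : ∀ L, Nat.card (Matrix (Fin d) (Fin d) O ⧸ J L) = Nat.card ((Fin d → O) ⧸ L) ^ d := by
    intro L
    have h1 : Nat.card (Matrix (Fin d) (Fin d) O ⧸ J L) = Nat.card (Fin d → (Fin d → O) ⧸ L) := by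
      refine Submodule.natCard_quotient_eq _
        { toFun := fun A i => L.mkQ (A i), map_zero' := rfl, map_add' := fun _ _ => rfl } ?_ ?_
      · intro y
        choose x hx using fun i => L.mkQ_surjective (y i)
        exact ⟨x, funext hx⟩
      · intro A
        rw [funext_iff]
        exact forall_congr' fun i => Submodule.Quotient.mk_eq_zero L
    rw [h1, Nat.card_fun, Nat.card_fin]
  refine (ENat.card_congr (Equiv.ofBijective
    (fun L => ⟨J L.1, by rw [hc]; exact L.2⟩) ⟨?_, ?_⟩)).symm
  · intro L L' h
    ext v
    have h1 := SetLike.ext_iff.1 (congrArg Subtype.val h) (Matrix.of fun _ => v)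
    exact ⟨fun hv => h1.1 (fun _ => hv) ⟨0, hd⟩, fun hv => h1.2 (fun _ => hv) ⟨0, hd⟩⟩
  · rintro ⟨K, hK⟩
    -- the matrix with row `i` equal to `v` and all other rows zero
    let r : Fin d → (Fin d → O) → Matrix (Fin d) (Fin d) O :=
      fun i v => (0 : Matrix _ _ O).updateRow i v
    have hr : ∀ i j v, Matrix.single j i 1 * r i v = r j v := by
      intro i j v
      ext a b
      by_cases ha : a = j
      · subst ha
        simp [r, Matrix.mul_apply, Matrix.single_apply, Matrix.updateRow_apply]
      · simp [r, Matrix.mul_apply, Matrix.updateRow_apply, ha, Ne.symm ha]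
    let L : Submodule O (Fin d → O) :=
      { carrier := {v | r ⟨0, hd⟩ v ∈ K}
        add_mem' := fun {v w} hv hw => by
          have : r ⟨0, hd⟩ (v + w) = r ⟨0, hd⟩ v + r ⟨0, hd⟩ w := by
            ext a b
            simp only [r, Matrix.updateRow_apply, Matrix.add_apply]
            split_ifs <;> simp
          change r _ _ ∈ K
          rw [this]
          exact add_mem hv hw
        zero_mem' := by
          have : r ⟨0, hd⟩ 0 = 0 := by
            ext a b
            simp [r, Matrix.updateRow_apply]
          change r _ _ ∈ K
          rw [this]
          exact zero_mem K
        smul_mem' := fun c v hv => by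
          have : r ⟨0, hd⟩ (c • v) = Matrix.scalar (Fin d) c * r ⟨0, hd⟩ v := by
            ext a b
            simp only [r, Matrix.updateRow_apply, Matrix.scalar_apply, Matrix.diagonal_mul]
            split_ifs <;> simp
          change r _ _ ∈ K
          rw [this]
          exact K.mul_mem_left _ hv }
    have hJL : J L = K := by
      ext A
      constructor
      · intro hA
        have : A = ∑ i, r i (A i) := by
          ext a b
          rw [Matrix.sum_apply]
          simp [r, Matrix.updateRow_apply]
        rw [this]
        refine Submodule.sum_mem _ fun i _ => ?_
        rw [← hr ⟨0, hd⟩ i]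
        exact K.mul_mem_left _ (hA i)
      · intro hA i
        change r ⟨0, hd⟩ (A i) ∈ K
        have : r ⟨0, hd⟩ (A i) = Matrix.single ⟨0, hd⟩ i 1 * A := by
          ext a b
          by_cases ha : a = ⟨0, hd⟩
          · subst ha
            simp [r, Matrix.mul_apply, Matrix.single_apply, Matrix.updateRow_apply]
          · simp [r, Matrix.mul_apply, Matrix.updateRow_apply, ha, Ne.symm ha]
        rw [this]
        exact K.mul_mem_left _ hA
    exact ⟨⟨L, by rw [← hc, hJL]; exact hK⟩, Subtype.ext hJL⟩

end FiniteIndex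

/-! ### Left ideals of localizations of algebras -/

section LocalizedIdeals

open scoped TensorProduct

theorem Ideal.finite_quotient_comap_of_finite {R B A : Type*} [CommRing R] [Ring B]
    [Algebra R B] [Ring A] [Algebra R A] (g : B →ₐ[R] A) (J : Ideal A) [Finite (A ⧸ J)] :
    Finite (B ⧸ J.comap (g : B →+* A)) := by
  let f : B ⧸ (J.comap (g : B →+* A) : Submodule B B) → A ⧸ J :=
    Submodule.mapQ _ _ (g : B →+* A).toSemilinearMap le_rfl
  refine Finite.of_injective f ?_
  intro x y h
  obtain ⟨x, rfl⟩ := Submodule.Quotient.mk_surjective _ x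
  obtain ⟨y, rfl⟩ := Submodule.Quotient.mk_surjective _ y
  have h : (Submodule.Quotient.mk (g x) : A ⧸ J) = Submodule.Quotient.mk (g y) := h
  rw [Submodule.Quotient.eq] at h ⊢
  change g (x - y) ∈ J
  rw [map_sub]
  exact h

variable {R B A : Type*} [CommRing R] [Ring B] [Algebra R B] [Ring A] [Algebra R A]
  (m : Ideal R) [m.IsPrime] (g : B →ₐ[R] A) [hg : IsLocalizedModule m.primeCompl g.toLinearMap]

include m g hg

theorem IsLocalizedModule.mem_ideal_of_smul_mem {s : R} (hs : s ∉ m) {J : Ideal A} {a : A}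
    (h : s • a ∈ J) : a ∈ J := by
  have h1 := hg.map_units ⟨s, hs⟩
  obtain ⟨u, hu⟩ := ((Module.End.isUnit_iff _).1 h1).2 1
  have h2 : s • u = 1 := hu
  have h3 : a = u * (s • a) := by rw [mul_smul_comm, ← smul_mul_assoc, h2, one_mul]
  rw [h3]
  exact J.mul_mem_left _ h

theorem IsLocalizedModule.smul_mk_eq_zero {J : Ideal A} {s : R} (hs : s ∉ m) {x : A ⧸ J}
    (h : s • x = 0) : x = 0 := by
  obtain ⟨a, rfl⟩ := Submodule.Quotient.mk_surjective _ x
  rw [← Submodule.Quotient.mk_smul, Submodule.Quotient.mk_eq_zero] at h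
  rw [Submodule.Quotient.mk_eq_zero]
  exact IsLocalizedModule.mem_ideal_of_smul_mem m g hs h

/-- A finite quotient of a localization is a quotient of the original module, since the elements
inverted act injectively, hence bijectively, on the image of the latter. -/
theorem IsLocalizedModule.exists_sub_mem_of_finite (J : Ideal A)
    [Finite (B ⧸ J.comap (g : B →+* A))] (a : A) : ∃ b, a - g b ∈ J := by
  obtain ⟨⟨b, s⟩, h⟩ := IsLocalizedModule.surj m.primeCompl g.toLinearMap a
  have h : s.1 • a = g b := h
  let K : Submodule B B := J.comap (g : B →+* A)
  let φ : (B ⧸ K) →ₗ[R] (B ⧸ K) := LinearMap.lsmul R (B ⧸ K) s.1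
  have hφ : Function.Injective φ := by
    rw [← LinearMap.ker_eq_bot, LinearMap.ker_eq_bot']
    intro x hx
    obtain ⟨y, rfl⟩ := Submodule.Quotient.mk_surjective _ x
    have hx : s.1 • (Submodule.Quotient.mk y : B ⧸ K) = 0 := hx
    rw [← Submodule.Quotient.mk_smul, Submodule.Quotient.mk_eq_zero] at hx
    rw [Submodule.Quotient.mk_eq_zero]
    have hx' : g (s.1 • y) ∈ J := hx
    rw [map_smul] at hx'
    exact IsLocalizedModule.mem_ideal_of_smul_mem m g s.2 hx'
  have : Finite (B ⧸ K) := ‹_›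
  obtain ⟨x, hx⟩ := Finite.surjective_of_injective hφ (Submodule.Quotient.mk b)
  obtain ⟨b', rfl⟩ := Submodule.Quotient.mk_surjective _ x
  have hx : s.1 • (Submodule.Quotient.mk b' : B ⧸ K) = Submodule.Quotient.mk b := hx
  rw [← Submodule.Quotient.mk_smul, eq_comm, Submodule.Quotient.eq] at hx
  have hx' : g (b - s.1 • b') ∈ J := hx
  refine ⟨b', IsLocalizedModule.mem_ideal_of_smul_mem m g s.2 ?_⟩
  rw [smul_sub, h, ← map_smul, ← map_sub]
  exact hx'

theorem IsLocalizedModule.natCard_quotient_comap (J : Ideal A)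
    [Finite (B ⧸ J.comap (g : B →+* A))] :
    Nat.card (B ⧸ J.comap (g : B →+* A)) = Nat.card (A ⧸ J) :=
  Submodule.natCard_quotient_comap (g : B →+* A).toSemilinearMap J
    fun a => IsLocalizedModule.exists_sub_mem_of_finite m g J a

/-- A left ideal of finite index of a localization contains a power of the maximal ideal. -/
theorem IsLocalizedModule.pow_smul_mem_of_card_le (J : Ideal A) [Finite (A ⧸ J)] {e : ℕ}
    (he : Nat.card (A ⧸ J) ≤ e) {r : R} (hr : r ∈ m ^ e) (a : A) : r • a ∈ J := by
  have h := Ideal.pow_smul_top_eq_bot_of_card_le (M := A ⧸ J) m (fun s hs x hx => by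
    refine IsLocalizedModule.smul_mk_eq_zero m g (s := s) (fun hsm => ?_) hx
    exact ‹m.IsPrime›.ne_top ((Ideal.eq_top_iff_one m).2 (by simpa using m.sub_mem hsm hs))) he
  have h1 := Submodule.smul_mem_smul hr (show (Submodule.Quotient.mk a : A ⧸ J) ∈ ⊤ from trivial)
  rw [h, Submodule.mem_bot, ← Submodule.Quotient.mk_smul, Submodule.Quotient.mk_eq_zero] at h1
  exact h1

/-- The residue field is the smallest possible nonzero quotient of a localization. -/
theorem IsLocalizedModule.natCard_le_of_ne_top [m.IsMaximal] (J : Ideal A) [Finite (A ⧸ J)]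
    (hJ : J ≠ ⊤) : Nat.card (R ⧸ m) ≤ Nat.card (A ⧸ J) := by
  have : Nontrivial (A ⧸ J) := Submodule.Quotient.nontrivial_iff.2 hJ
  exact Ideal.natCard_quotient_le_of_nontrivial (M := A ⧸ J) m (fun s hs x hx => by
    refine IsLocalizedModule.smul_mk_eq_zero m g (s := s) (fun hsm => ?_) hx
    exact ‹m.IsPrime›.ne_top ((Ideal.eq_top_iff_one m).2 (by simpa using m.sub_mem hsm hs)))

/-- Left ideals of finite index of the localization of an algebra at a maximal ideal `m` correspond
to the left ideals of the algebra which contain a power of `m`. -/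
theorem IsLocalizedModule.card_ideal_natCard_quotient_eq [m.IsMaximal] {N e : ℕ} (hN : N ≠ 0)
    (he : N ≤ e) :
    ENat.card {J : Ideal A // Nat.card (A ⧸ J) = N} =
      ENat.card {J : Ideal B // Nat.card (B ⧸ J) = N ∧ ∀ r ∈ m ^ e, ∀ b : B, r • b ∈ J} := by
  have hfin : ∀ J : Ideal A, Nat.card (A ⧸ J) = N → Finite (A ⧸ J) := fun J hJ =>
    Nat.finite_of_card_ne_zero (hJ ▸ hN)
  refine ENat.card_congr (Equiv.ofBijective (fun J => ⟨J.1.comap (g : B →+* A), ?_, ?_⟩) ⟨?_, ?_⟩)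
  · have := hfin J.1 J.2
    have := Ideal.finite_quotient_comap_of_finite g J.1
    rw [IsLocalizedModule.natCard_quotient_comap m g, J.2]
  · intro r hr b
    have := hfin J.1 J.2
    change g (r • b) ∈ J.1
    rw [map_smul]
    exact IsLocalizedModule.pow_smul_mem_of_card_le m g J.1 (J.2.trans_le he) hr _
  · intro J J' h
    have h1 : ∀ b, g b ∈ J.1 ↔ g b ∈ J'.1 := fun b =>
      SetLike.ext_iff.1 (congrArg Subtype.val h) b
    ext a
    obtain ⟨⟨b, s⟩, h2⟩ := IsLocalizedModule.surj m.primeCompl g.toLinearMap a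
    have h2 : s.1 • a = g b := h2
    have h3 : ∀ K : Ideal A, a ∈ K ↔ g b ∈ K := fun K =>
      ⟨fun h => h2 ▸ Submodule.smul_of_tower_mem K s.1 h,
        fun h => IsLocalizedModule.mem_ideal_of_smul_mem m g s.2 (h2 ▸ h)⟩
    rw [h3, h3, h1]
  · rintro ⟨K, hK, hmK⟩
    let J : Ideal A :=
      { carrier := {a | ∃ s ∉ m, ∃ b ∈ K, s • a = g b}
        add_mem' := by
          rintro a a' ⟨s, hs, b, hb, h⟩ ⟨s', hs', b', hb', h'⟩
          refine ⟨s * s', ‹m.IsPrime›.mul_notMem hs hs', s' • b + s • b',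
            add_mem (Submodule.smul_of_tower_mem K s' hb) (Submodule.smul_of_tower_mem K s hb'), ?_⟩
          rw [smul_add, map_add, map_smul, map_smul, ← h, ← h', smul_smul, smul_smul, mul_comm s']
        zero_mem' := ⟨1, ‹m.IsPrime›.one_notMem, 0, zero_mem _, by simp⟩
        smul_mem' := by
          rintro c a ⟨s, hs, b, hb, h⟩
          obtain ⟨⟨b', t⟩, h'⟩ := IsLocalizedModule.surj m.primeCompl g.toLinearMap c
          have h' : t.1 • c = g b' := h'
          refine ⟨t.1 * s, ‹m.IsPrime›.mul_notMem t.2 hs, b' * b, K.mul_mem_left _ hb, ?_⟩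
          rw [smul_eq_mul, map_mul, ← h', ← h, smul_mul_smul_comm] }
    have hJ : J.comap (g : B →+* A) = K := by
      ext b
      constructor
      · rintro ⟨s, hs, b', hb', h⟩
        have h : g (s • b) = g b' := by rw [map_smul]; exact h
        obtain ⟨t, ht⟩ := hg.exists_of_eq (x₁ := s • b) (x₂ := b') h
        have ht : t.1 • s • b = t.1 • b' := ht
        have h1 : (t.1 * s) • b ∈ K := by
          rw [mul_smul, ht]
          exact Submodule.smul_of_tower_mem K t.1 hb'
        obtain ⟨r, hr⟩ := (Ideal.Quotient.isUnit_mk_pow_of_notMem m (n := e)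
          (‹m.IsPrime›.mul_notMem t.2 hs)).exists_left_inv
        obtain ⟨r, rfl⟩ := Ideal.Quotient.mk_surjective r
        rw [← map_mul, ← map_one (Ideal.Quotient.mk (m ^ e)), Ideal.Quotient.eq] at hr
        have h2 := hmK _ hr b
        have h3 : b = r • (t.1 * s) • b - (r * (t.1 * s) - 1) • b := by
          rw [sub_smul, one_smul, mul_smul r]
          abel
        rw [h3]
        exact sub_mem (Submodule.smul_of_tower_mem K r h1) h2
      · intro hb
        exact ⟨1, ‹m.IsPrime›.one_notMem, b, hb, one_smul _ _⟩
    have : Finite (B ⧸ J.comap (g : B →+* A)) := by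
      rw [hJ]
      exact Nat.finite_of_card_ne_zero (hK ▸ hN)
    refine ⟨⟨J, ?_⟩, Subtype.ext hJ⟩
    rw [← IsLocalizedModule.natCard_quotient_comap m g, hJ, hK]

end LocalizedIdeals

section AzumayaCount

open scoped TensorProduct

theorem IsLocalRing.quotient_pow {R : Type*} [CommRing R] (m : Ideal R) [m.IsMaximal] {e : ℕ}
    (he : e ≠ 0) : IsLocalRing (R ⧸ m ^ e) := by
  let f : R ⧸ m ^ e →+* R ⧸ m := Ideal.Quotient.factor (Ideal.pow_le_self he)
  have : IsLocalHom f := ⟨fun x hx => by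
    obtain ⟨x, rfl⟩ := Ideal.Quotient.mk_surjective x
    exact (Ideal.Quotient.isUnit_mk_pow_iff_isUnit_mk m he).2 hx⟩
  let := Ideal.Quotient.field m
  exact RingHom.domain_isLocalRing f

/-- An Azumaya algebra of degree `d` over a ring becomes a matrix algebra modulo every power of a
maximal ideal with finite residue field. -/
theorem IsAzumaya.nonempty_ringEquiv_matrix {R : Type*} (B : Type*) [CommRing R] [Ring B]
    [Algebra R B] [IsAzumaya R B] {d : ℕ} (hd : 1 ≤ d)
    (hrank : ∀ p, Module.rankAtStalk (R := R) B p = d ^ 2)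
    (m : Ideal R) [m.IsMaximal] [Finite (R ⧸ m)] (hm : m.FG) {e : ℕ} (he : e ≠ 0) :
    Nonempty ((R ⧸ m ^ e) ⊗[R] B ≃+* Matrix (Fin d) (Fin d) (R ⧸ m ^ e)) := by
  have := IsLocalRing.quotient_pow m he
  have : Finite (R ⧸ m ^ e) := Ideal.finite_quotient_pow hm e
  have : Module.Free (R ⧸ m ^ e) ((R ⧸ m ^ e) ⊗[R] B) := Module.free_of_flat_of_isLocalRing
  have hfr : ∀ (S : Type _) [CommRing S] [Algebra R S] [Nontrivial S] [Module.Free S (S ⊗[R] B)],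
      Module.finrank S (S ⊗[R] B) = d ^ 2 := by
    intro S _ _ _ _
    obtain ⟨p⟩ : Nonempty (PrimeSpectrum S) := inferInstance
    have h1 := Module.rankAtStalk_baseChange (R := R) (M := B) p
    rw [hrank, Module.rankAtStalk_eq_finrank_of_free] at h1
    exact h1
  let := Ideal.Quotient.field m
  have hrk := hfr (R ⧸ m)
  have : Nontrivial ((R ⧸ m) ⊗[R] B) := Module.nontrivial_of_finrank_pos (R := R ⧸ m)
    (by rw [hrk]; positivity)
  obtain ⟨E⟩ := IsAzumaya.nonempty_algEquiv_matrix (R := R) (B := B) (R ⧸ m)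
    (Algebra.TensorProduct.includeRight : B →ₐ[R] (R ⧸ m) ⊗[R] B)
    (Ideal.surjective_includeRight_quotient B m) hrk
  let res : R ⧸ m ^ e →ₐ[R] R ⧸ m := Ideal.Quotient.factorₐ R (Ideal.pow_le_self he)
  let τ : (R ⧸ m ^ e) ⊗[R] B →ₐ[R] (R ⧸ m) ⊗[R] B :=
    Algebra.TensorProduct.map res (AlgHom.id R B)
  have hτ : ∀ b : B, τ (Algebra.TensorProduct.includeRight b) =
      (Algebra.TensorProduct.includeRight : B →ₐ[R] (R ⧸ m) ⊗[R] B) b := fun b => by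
    simp [τ]
  refine IsLocalRing.nonempty_ringEquiv_matrix (hfr _) res.toRingHom
    (Ideal.Quotient.factor_surjective (Ideal.pow_le_self he)) ?_ ((E : _ →+* _).comp τ.toRingHom)
    ?_ ?_ ?_ hd
  · intro x hx
    rw [IsLocalRing.mem_maximalIdeal, mem_nonunits_iff]
    intro hu
    have := hu.map res.toRingHom
    rw [(RingHom.mem_ker).1 hx] at this
    exact not_isUnit_zero this
  · intro M
    obtain ⟨x, rfl⟩ := E.surjective M
    obtain ⟨b, rfl⟩ := Ideal.surjective_includeRight_quotient B m x
    exact ⟨_, congrArg E (hτ b)⟩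
  · intro c a
    have h1 : τ (c • a) = res c • τ a := by
      induction a using TensorProduct.induction_on with
      | zero => simp
      | tmul x y => simp [τ, TensorProduct.smul_tmul']
      | add x y hx hy => rw [smul_add, map_add, hx, hy, map_add, smul_add]
    change E (τ (c • a)) = res c • E (τ a)
    rw [h1, map_smul]
  · intro a ha
    obtain ⟨b, rfl⟩ := Ideal.surjective_includeRight_quotient B (m ^ e) a
    replace ha : E (τ _) = 0 := ha
    rw [hτ, map_eq_zero_iff E E.injective, Ideal.includeRight_quotient_eq_zero_iff] at ha
    induction ha using Submodule.smul_induction_on' with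
    | smul r hr b _ =>
      have h1 : (Algebra.TensorProduct.includeRight (r • b) : (R ⧸ m ^ e) ⊗[R] B) =
          Ideal.Quotient.mk (m ^ e) r • Algebra.TensorProduct.includeRight b := by
        rw [map_smul]
        exact (algebraMap_smul (R ⧸ m ^ e) r _).symm
      rw [h1]
      refine Submodule.smul_mem_smul ?_ trivial
      rw [IsLocalRing.mem_maximalIdeal, mem_nonunits_iff,
        Ideal.Quotient.isUnit_mk_pow_iff_notMem m he, not_not]
      exact hr
    | add x _ y _ hx hy =>
      rw [map_add]
      exact add_mem hx hy

theorem IsAzumaya.one_le_of_rankAtStalk_eq {R : Type*} (B : Type*) [CommRing R] [Nontrivial R]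
    [Ring B] [Algebra R B] [IsAzumaya R B] {d : ℕ}
    (hrank : ∀ p, Module.rankAtStalk (R := R) B p = d ^ 2) : 1 ≤ d := by
  by_contra! h
  obtain rfl : d = 0 := by omega
  have h1 : Subsingleton B := (Module.rankAtStalk_eq_zero_iff_subsingleton (R := R)).1
    (funext fun p => by rw [hrank]; rfl)
  have h2 : (0 : R) = 1 := FaithfulSMul.eq_of_smul_eq_smul (α := B) fun b =>
    Subsingleton.elim _ _
  exact zero_ne_one h2

/-- The left ideals of given finite index in a localization of an Azumaya algebra of degree `d` are
as many as the submodules of corresponding index of a free module of rank `d`. -/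
theorem IsAzumaya.card_ideal_natCard_quotient_eq {R B A O : Type*} [CommRing R] [Ring B]
    [Algebra R B] [IsAzumaya R B] {d : ℕ}
    (hrank : ∀ p, Module.rankAtStalk (R := R) B p = d ^ 2)
    (m : Ideal R) [m.IsMaximal] [Finite (R ⧸ m)] (hm : m.FG) [Ring A] [Algebra R A]
    (g : B →ₐ[R] A) [IsLocalizedModule m.primeCompl g.toLinearMap] [CommRing O] [Algebra R O]
    [IsLocalization.AtPrime O m] {N : ℕ} (hN : N ≠ 0) :
    ENat.card {J : Ideal A // Nat.card (A ⧸ J) = N} =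
      ENat.card {L : Submodule O (Fin d → O) // Nat.card ((Fin d → O) ⧸ L) ^ d = N} := by
  have : Nontrivial (R ⧸ m) := Ideal.Quotient.nontrivial_iff.2 (‹m.IsMaximal›.ne_top)
  have : Nontrivial R := (Ideal.Quotient.mk m).domain_nontrivial
  have hd := IsAzumaya.one_le_of_rankAtStalk_eq B hrank
  obtain ⟨E⟩ := IsAzumaya.nonempty_ringEquiv_matrix B hd hrank m hm hN
  rw [IsLocalizedModule.card_ideal_natCard_quotient_eq m g hN le_rfl]
  -- left ideals of `B` containing `m ^ N`, of its reduction, and of a matrix ring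
  let f : B →+* Matrix (Fin d) (Fin d) (R ⧸ m ^ N) := (E : _ →+* _).comp
    (Algebra.TensorProduct.includeRight : B →ₐ[R] (R ⧸ m ^ N) ⊗[R] B).toRingHom
  have hf : Function.Surjective f :=
    E.surjective.comp (Ideal.surjective_includeRight_quotient B (m ^ N))
  have : RingHomSurjective f := ⟨hf⟩
  have h1 := Submodule.card_natCard_quotient_eq_of_surjective f.toSemilinearMap hf (· = N)
  have h2 : ∀ J : Ideal B, LinearMap.ker f.toSemilinearMap ≤ J ↔
      ∀ r ∈ m ^ N, ∀ b : B, r • b ∈ J := by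
    have hk : ∀ b, b ∈ LinearMap.ker f.toSemilinearMap ↔ b ∈ m ^ N • (⊤ : Submodule R B) := by
      intro b
      rw [← Ideal.includeRight_quotient_eq_zero_iff, ← map_eq_zero_iff E E.injective]
      rfl
    intro J
    constructor
    · intro h r hr b
      exact h ((hk _).2 (Submodule.smul_mem_smul hr trivial))
    · intro h b hb
      rw [hk] at hb
      have : m ^ N • (⊤ : Submodule R B) ≤ J.restrictScalars R :=
        Submodule.smul_le.2 fun r hr b _ => h r hr b
      exact this hb
  simp only [h2] at h1
  rw [← h1, Matrix.card_ideal_natCard_quotient_eq hd (· = N)]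
  -- submodules of a free module over `R ⧸ m ^ N` and over the localization
  let ψ : O →+* R ⧸ m ^ N := IsLocalization.lift (M := m.primeCompl)
    (g := Ideal.Quotient.mk (m ^ N)) fun s => Ideal.Quotient.isUnit_mk_pow_of_notMem m s.2
  have hψ : Function.Surjective ψ := fun x => by
    obtain ⟨r, rfl⟩ := Ideal.Quotient.mk_surjective x
    exact ⟨algebraMap R O r, IsLocalization.lift_eq _ r⟩
  have : RingHomSurjective ψ := ⟨hψ⟩
  let F : (Fin d → O) →ₛₗ[ψ] (Fin d → R ⧸ m ^ N) :=
    { toFun := fun v i => ψ (v i)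
      map_add' := fun v w => funext fun i => map_add ψ _ _
      map_smul' := fun c v => funext fun i => map_mul ψ _ _ }
  have hF : Function.Surjective F := fun y => by
    choose x hx using fun i => hψ (y i)
    exact ⟨x, funext hx⟩
  rw [Submodule.card_natCard_quotient_eq_of_surjective F hF fun c => c ^ d = N]
  refine ENat.card_congr (Equiv.subtypeEquivRight fun L => and_iff_left_of_imp fun hL => ?_)
  have hne : Nat.card ((Fin d → O) ⧸ L) ≠ 0 := fun h0 => by
    rw [h0, zero_pow (by omega)] at hL
    exact hN hL.symm
  have : Finite ((Fin d → O) ⧸ L) := Nat.finite_of_card_ne_zero hne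
  have : IsLocalRing O := IsLocalization.AtPrime.isLocalRing O m
  have hle : Nat.card ((Fin d → O) ⧸ L) ≤ N := hL ▸ Nat.le_self_pow (by omega) _
  have h3 := Ideal.pow_smul_top_eq_bot_of_card_le (M := (Fin d → O) ⧸ L)
    (IsLocalRing.maximalIdeal O) (fun s hs x hx => by
      have hu : IsUnit s := by
        by_contra hns
        have h4 : s ∈ IsLocalRing.maximalIdeal O := hns
        exact (IsLocalRing.maximalIdeal.isMaximal O).ne_top
          ((Ideal.eq_top_iff_one _).2 (by simpa using sub_mem h4 hs))
      exact (hu.smul_eq_zero).1 hx) hle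
  intro v hv
  have hv' : ∀ i, ψ (v i) = 0 := fun i => congrFun (LinearMap.mem_ker.1 hv) i
  have h5 : ∀ x, ψ x = 0 → x ∈ IsLocalRing.maximalIdeal O ^ N := by
    intro x hx
    obtain ⟨⟨r, s⟩, hrs⟩ := IsLocalization.surj m.primeCompl x
    have hr : Ideal.Quotient.mk (m ^ N) r = 0 := by
      have := congrArg ψ hrs
      rw [map_mul, hx, zero_mul] at this
      rw [← IsLocalization.lift_eq (M := m.primeCompl) (S := O)
        (fun s => Ideal.Quotient.isUnit_mk_pow_of_notMem m s.2) r]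
      exact this.symm
    rw [Ideal.Quotient.eq_zero_iff_mem] at hr
    have h6 : algebraMap R O r ∈ IsLocalRing.maximalIdeal O ^ N := by
      rw [← IsLocalization.AtPrime.map_eq_maximalIdeal m O, ← Ideal.map_pow]
      exact Ideal.mem_map_of_mem _ hr
    rw [← hrs] at h6
    exact (Ideal.mul_unit_mem_iff_mem _ (IsLocalization.map_units O s)).1 h6
  rw [← Submodule.Quotient.mk_eq_zero, ← Submodule.mkQ_apply, pi_eq_sum_univ v, map_sum]
  refine Finset.sum_eq_zero fun i _ => ?_
  rw [map_smul]
  have h6 := Submodule.smul_mem_smul (h5 _ (hv' i))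
    (show (Submodule.Quotient.mk (fun j => if i = j then 1 else 0) : (Fin d → O) ⧸ L) ∈ ⊤ from
      trivial)
  rw [h3] at h6
  exact h6

end AzumayaCount

/-! ### Closed points of schemes of finite type over the integers -/

section ClosedPoints

namespace AlgebraicGeometry

instance ULift.isJacobsonRing_int : IsJacobsonRing (ULift.{u} ℤ) :=
  (isJacobsonRing_iso (R := ℤ) (S := ULift.{u} ℤ) ULift.ringEquiv.symm).1 inferInstance

variable {X : Scheme.{u}} [LocallyOfFiniteType (specULiftZIsTerminal.{u}.from X)]

/-- The sections over an affine open form a finitely generated ring. -/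
theorem Scheme.exists_surjective_mvPolynomial {U : X.Opens} (hU : IsAffineOpen U) :
    ∃ (n : ℕ) (φ : MvPolynomial (Fin n) ℤ →+* Γ(X, U)), Function.Surjective φ := by
  have h1 := LocallyOfFiniteType.finiteType_appLE (f := specULiftZIsTerminal.{u}.from X)
    (isAffineOpen_top _) hU le_top
  let e : ℤ →+* Γ(Spec (CommRingCat.of (ULift.{u} ℤ)), ⊤) :=
    (Scheme.ΓSpecIso (CommRingCat.of (ULift.{u} ℤ))).inv.hom.comp
      (ULift.ringEquiv.symm : ℤ ≃+* ULift.{u} ℤ).toRingHom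
  have he : Function.Surjective e :=
    (Scheme.ΓSpecIso (CommRingCat.of (ULift.{u} ℤ))).symm.commRingCatIsoToRingEquiv.surjective.comp
      (ULift.ringEquiv.symm : ℤ ≃+* ULift.{u} ℤ).surjective
  have h2 := h1.comp (RingHom.FiniteType.of_surjective e he)
  have h3 : Algebra.FiniteType ℤ Γ(X, U) := by
    rw [← RingHom.finiteType_algebraMap]
    exact (RingHom.ext_int _ _ : algebraMap ℤ Γ(X, U) = _) ▸ h2
  obtain ⟨n, f, hf⟩ := Algebra.FiniteType.iff_quotient_mvPolynomial''.1 h3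
  exact ⟨n, f.toRingHom, hf⟩

theorem Scheme.isNoetherianRing_of_isAffineOpen {U : X.Opens} (hU : IsAffineOpen U) :
    IsNoetherianRing Γ(X, U) := by
  obtain ⟨n, φ, hφ⟩ := Scheme.exists_surjective_mvPolynomial hU
  exact isNoetherianRing_of_surjective _ _ φ hφ

theorem Scheme.jacobsonSpace_of_locallyOfFiniteType : JacobsonSpace X :=
  LocallyOfFiniteType.jacobsonSpace (specULiftZIsTerminal.{u}.from X)

/-- A field which is finitely generated as a ring is finite: it is finite over `ℤ` by the
Nullstellensatz, and killed by some nonzero integer as `ℤ` is not a field. -/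
theorem Scheme.finite_quotient_of_isMaximal {U : X.Opens} (hU : IsAffineOpen U)
    (m : Ideal Γ(X, U)) [m.IsMaximal] : Finite (Γ(X, U) ⧸ m) := by
  obtain ⟨n, φ, hφ⟩ := Scheme.exists_surjective_mvPolynomial hU
  let := Ideal.Quotient.field m
  let ψ : MvPolynomial (Fin n) ℤ →+* Γ(X, U) ⧸ m := (Ideal.Quotient.mk m).comp φ
  have hψ : Function.Surjective ψ := Ideal.Quotient.mk_surjective.comp hφ
  have hft : (ψ.comp MvPolynomial.C).FiniteType :=
    (RingHom.FiniteType.of_surjective ψ hψ).comp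
      (RingHom.finiteType_algebraMap.2 inferInstance :
        (algebraMap ℤ (MvPolynomial (Fin n) ℤ)).FiniteType)
  have h3 : Algebra.FiniteType ℤ (Γ(X, U) ⧸ m) := by
    have : algebraMap ℤ (Γ(X, U) ⧸ m) = ψ.comp MvPolynomial.C := RingHom.ext_int _ _
    rw [← RingHom.finiteType_algebraMap, this]
    exact hft
  have h4 := finite_of_finite_type_of_isJacobsonRing ℤ (Γ(X, U) ⧸ m)
  have h5 : ¬ Function.Injective (algebraMap ℤ (Γ(X, U) ⧸ m)) := fun h =>
    Int.not_isField (isField_of_isIntegral_of_isField h (Field.toIsField _))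
  rw [injective_iff_map_eq_zero] at h5
  push Not at h5
  obtain ⟨c, hc, hc0⟩ := h5
  refine Module.finite_of_fg_torsion _ fun x => ⟨⟨c, mem_nonZeroDivisors_of_ne_zero hc0⟩, ?_⟩
  change c • x = 0
  rw [Algebra.smul_def, hc, zero_mul]

theorem IsAffineOpen.primeIdealOf_injective {X : Scheme.{u}} {U : X.Opens} (hU : IsAffineOpen U) :
    Function.Injective hU.primeIdealOf := fun x y h => Subtype.ext <| by
  rw [← hU.fromSpec_primeIdealOf, h, hU.fromSpec_primeIdealOf]

theorem IsAffineOpen.mem_basicOpen_iff_notMem_primeIdealOf {X : Scheme.{u}} {U : X.Opens}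
    (hU : IsAffineOpen U) (x : U) (s : Γ(X, U)) :
    x.1 ∈ X.basicOpen s ↔ s ∉ (hU.primeIdealOf x).asIdeal := by
  have := hU.isLocalization_stalk x
  rw [Scheme.mem_basicOpen _ _ _ x.2]
  exact IsLocalization.AtPrime.isUnit_to_map_iff (X.presheaf.stalk x.1)
    (hU.primeIdealOf x).asIdeal s

theorem IsAffineOpen.natCard_quotient_primeIdealOf {X : Scheme.{u}} {U : X.Opens}
    (hU : IsAffineOpen U) (x : U) [(hU.primeIdealOf x).asIdeal.IsMaximal] :
    Nat.card (Γ(X, U) ⧸ (hU.primeIdealOf x).asIdeal) = Nat.card (X.residueField x.1) := by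
  have := hU.isLocalization_stalk x
  exact Nat.card_congr (IsLocalization.AtPrime.equivQuotMaximalIdeal (hU.primeIdealOf x).asIdeal
    (X.presheaf.stalk x.1)).toEquiv

/-- Every point has an affine open neighbourhood contained in a given open neighbourhood. -/
theorem Scheme.exists_isAffineOpen_mem_le (X : Scheme.{u}) {V : X.Opens} {x : X} (hx : x ∈ V) :
    ∃ U : X.Opens, IsAffineOpen U ∧ x ∈ U ∧ U ≤ V := by
  obtain ⟨U, hU, hxU, hUV⟩ := Opens.isBasis_iff_nbhd.1 X.isBasis_affineOpens hx
  exact ⟨U, hU, hxU, hUV⟩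

theorem Scheme.finite_residueField_of_isClosed {x : X} (hx : IsClosed {x}) :
    Finite (X.residueField x) := by
  obtain ⟨U, hU, hxU, -⟩ := X.exists_isAffineOpen_mem_le (V := ⊤) (x := x) trivial
  have := hU.primeIdealOf_isMaximal_of_isClosed ⟨x, hxU⟩ hx
  have := Scheme.finite_quotient_of_isMaximal hU (hU.primeIdealOf ⟨x, hxU⟩).asIdeal
  refine Nat.finite_of_card_ne_zero ?_
  rw [← hU.natCard_quotient_primeIdealOf ⟨x, hxU⟩]
  exact Nat.card_pos.ne'

theorem Scheme.one_lt_natCard_residueField {x : X} (hx : IsClosed {x}) :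
    1 < Nat.card (X.residueField x) := by
  have := Scheme.finite_residueField_of_isClosed hx
  exact Finite.one_lt_card

/-- A finitely generated ring has finitely many maximal ideals with residue field of given
cardinality, since it has finitely many homomorphisms to a finite field. -/
theorem _root_.Ideal.finite_setOf_isMaximal_natCard_eq {R : Type*} [CommRing R] {n : ℕ}
    (φ : MvPolynomial (Fin n) ℤ →+* R) (hφ : Function.Surjective φ) {c : ℕ} (hc : c ≠ 0) :
    {m : Ideal R | m.IsMaximal ∧ Nat.card (R ⧸ m) = c}.Finite := by
  rcases Set.eq_empty_or_nonempty {m : Ideal R | m.IsMaximal ∧ Nat.card (R ⧸ m) = c} with h | h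
  · rw [h]
    exact Set.finite_empty
  obtain ⟨m₀, hm₀, hc₀⟩ := h
  let := Ideal.Quotient.field m₀
  have hf₀ : Finite (R ⧸ m₀) := Nat.finite_of_card_ne_zero (hc₀ ▸ hc)
  have hhom : Finite (R →+* R ⧸ m₀) := by
    refine Finite.of_injective (β := Fin n → R ⧸ m₀) (fun f i => f (φ (MvPolynomial.X i))) ?_
    intro f g h
    have h1 : f.comp φ = g.comp φ :=
      MvPolynomial.ringHom_ext (fun a => by simp) fun i => congrFun h i
    exact RingHom.ext fun r => by
      obtain ⟨p, rfl⟩ := hφ r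
      exact RingHom.congr_fun h1 p
  refine (Set.finite_range fun f : R →+* R ⧸ m₀ => RingHom.ker f).subset ?_
  rintro m ⟨hm, hmc⟩
  let := Ideal.Quotient.field m
  have hf : Finite (R ⧸ m) := Nat.finite_of_card_ne_zero (hmc ▸ hc)
  have := Fintype.ofFinite (R ⧸ m)
  have := Fintype.ofFinite (R ⧸ m₀)
  let e : R ⧸ m ≃+* R ⧸ m₀ := FiniteField.ringEquivOfCardEq (by
    rw [Fintype.card_eq_nat_card, Fintype.card_eq_nat_card, hmc, hc₀])
  refine ⟨(e : R ⧸ m →+* R ⧸ m₀).comp (Ideal.Quotient.mk m), ?_⟩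
  ext r
  change e (Ideal.Quotient.mk m r) = 0 ↔ _
  rw [map_eq_zero_iff e e.injective, Ideal.Quotient.eq_zero_iff_mem]

theorem Scheme.finite_setOf_natCard_residueField_le [CompactSpace X] (N : ℕ) :
    {x : OrderZeta.ClosedPt X | Nat.card (X.residueField x.1) ≤ N}.Finite := by
  have hU : ∀ U : X.affineOpens, {x : OrderZeta.ClosedPt X | x.1 ∈ U.1 ∧
      Nat.card (X.residueField x.1) ≤ N}.Finite := by
    intro U
    obtain ⟨n, φ, hφ⟩ := Scheme.exists_surjective_mvPolynomial U.2
    have h1 : (⋃ c ∈ Finset.Icc 1 N,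
        {m : Ideal Γ(X, U.1) | m.IsMaximal ∧ Nat.card (Γ(X, U.1) ⧸ m) = c}).Finite :=
      Set.Finite.biUnion (Finset.finite_toSet _) fun c hc =>
        Ideal.finite_setOf_isMaximal_natCard_eq φ hφ (by
          have := (Finset.mem_Icc.1 hc).1
          omega)
    classical
    refine Set.Finite.of_finite_image (f := fun x => if h : x.1 ∈ U.1 then
      (U.2.primeIdealOf ⟨x.1, h⟩).asIdeal else ⊥) (h1.subset ?_) ?_
    · rintro _ ⟨x, ⟨hx, hxN⟩, rfl⟩
      have := U.2.primeIdealOf_isMaximal_of_isClosed ⟨x.1, hx⟩ x.2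
      simp only [hx, dite_true]
      refine Set.mem_biUnion (x := Nat.card (X.residueField x.1)) ?_
        ⟨this, U.2.natCard_quotient_primeIdealOf ⟨x.1, hx⟩⟩
      exact Finset.mem_coe.2 (Finset.mem_Icc.2
        ⟨(Scheme.one_lt_natCard_residueField x.2).le, hxN⟩)
    · rintro x ⟨hx, -⟩ y ⟨hy, -⟩ h
      simp only [hx, hy, dite_true] at h
      have h1 := U.2.primeIdealOf_injective (PrimeSpectrum.ext h)
      have h2 := congrArg Subtype.val h1
      exact Subtype.ext h2
  obtain ⟨s, hs⟩ := CompactSpace.elim_nhds_subcover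
    (fun x : X => ((X.exists_isAffineOpen_mem_le (V := ⊤) (x := x) trivial).choose : Set X))
    (fun x => (Opens.isOpen _).mem_nhds
      (X.exists_isAffineOpen_mem_le (V := ⊤) (x := x) trivial).choose_spec.2.1)
  refine (Set.Finite.biUnion (Finset.finite_toSet s) fun x _ => hU
    ⟨_, (X.exists_isAffineOpen_mem_le (V := ⊤) (x := x) trivial).choose_spec.1⟩).subset ?_
  intro x hx
  obtain ⟨i, hi, hxi⟩ := Set.mem_iUnion₂.1 (hs ▸ Set.mem_univ x.1 :
    x.1 ∈ ⋃ i ∈ s, ((X.exists_isAffineOpen_mem_le (V := ⊤) (x := i) trivial).choose : Set X))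
  exact Set.mem_biUnion hi ⟨hxi, hx⟩

section Dimension

variable [IsIntegral X] (hreg : ∀ x : X, IsRegularLocalRing (X.presheaf.stalk x))

include hreg

theorem Scheme.ringKrullDim_stalk_eq_of_mem_isAffineOpen {U : X.Opens} (hU : IsAffineOpen U)
    {x y : X} (hx : IsClosed {x}) (hy : IsClosed {y}) (hxU : x ∈ U) (hyU : y ∈ U) :
    ringKrullDim (X.presheaf.stalk x) = ringKrullDim (X.presheaf.stalk y) := by
  obtain ⟨n, φ, hφ⟩ := Scheme.exists_surjective_mvPolynomial hU
  have : Nonempty U := ⟨⟨x, hxU⟩⟩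
  have key : ∀ z (hz : IsClosed {z}) (hzU : z ∈ U),
      ((RingHom.ker φ).height : WithBot ℕ∞) + ringKrullDim (X.presheaf.stalk z) = n + 1 := by
    intro z hz hzU
    have := hU.primeIdealOf_isMaximal_of_isClosed ⟨z, hzU⟩ hz
    have := hU.isLocalization_stalk ⟨z, hzU⟩
    have := hreg z
    let := TopCat.Presheaf.algebra_section_stalk X.presheaf (⟨z, hzU⟩ : U)
    exact ringKrullDim_add_height_ker_eq φ hφ (hU.primeIdealOf ⟨z, hzU⟩).asIdeal
      (X.presheaf.stalk z)
  have h1 := (key x hx hxU).trans (key y hy hyU).symm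
  have hfin : (RingHom.ker φ).height ≠ ⊤ := by
    have := RingHom.ker_isPrime φ
    exact Ideal.height_ne_top_of_isPrime
  have := hreg x
  have := hreg y
  obtain ⟨h, hh⟩ := ENat.ne_top_iff_exists.1 hfin
  have hd : ∀ z, ∃ a : ℕ, ringKrullDim (X.presheaf.stalk z) = a := fun z => by
    have := hreg z
    exact ⟨_, (IsRegularLocalRing.spanFinrank_maximalIdeal (R := X.presheaf.stalk z)).symm⟩
  obtain ⟨a, ha⟩ := hd x
  obtain ⟨b, hb⟩ := hd y
  rw [← hh, ha, hb] at h1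
  rw [ha, hb]
  norm_cast at h1 ⊢
  omega

/-- Nonempty affine opens of an irreducible Jacobson space have a closed point in common, which
links any two closed points. -/
theorem Scheme.ringKrullDim_stalk_eq_of_isClosed {x y : X} (hx : IsClosed {x})
    (hy : IsClosed {y}) :
    ringKrullDim (X.presheaf.stalk x) = ringKrullDim (X.presheaf.stalk y) := by
  have := Scheme.jacobsonSpace_of_locallyOfFiniteType (X := X)
  obtain ⟨U, hU, hxU, -⟩ := X.exists_isAffineOpen_mem_le (V := ⊤) (x := x) trivial
  obtain ⟨V, hV, hyV, -⟩ := X.exists_isAffineOpen_mem_le (V := ⊤) (x := y) trivial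
  obtain ⟨z, ⟨hzU, hzV⟩, hz⟩ := nonempty_inter_closedPoints
    (nonempty_preirreducible_inter U.isOpen V.isOpen ⟨x, hxU⟩ ⟨y, hyV⟩)
    (U.isOpen.inter V.isOpen).isLocallyClosed
  rw [Scheme.ringKrullDim_stalk_eq_of_mem_isAffineOpen hreg hU hx hz hxU hzU,
    Scheme.ringKrullDim_stalk_eq_of_mem_isAffineOpen hreg hV hz hy hzV hyV]

/-- On a regular integral scheme of finite type over `ℤ`, the local rings at closed points have the
dimension of the scheme. -/
theorem Scheme.ringKrullDim_stalk_eq_topologicalKrullDim {x : X} (hx : IsClosed {x}) :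
    ringKrullDim (X.presheaf.stalk x) = topologicalKrullDim X := by
  have := Scheme.jacobsonSpace_of_locallyOfFiniteType (X := X)
  have h1 : topologicalKrullDim X = Order.krullDim X :=
    Order.krullDim_eq_of_orderIso (irreducibleSetEquivPoints (α := X))
  rw [h1, Order.krullDim_eq_iSup_coheight]
  refine le_antisymm ?_ (iSup_le fun y => ?_)
  · rw [ringKrullDim_stalk_eq_coheight]
    exact le_iSup (fun a : X => ((Order.coheight a : ℕ∞) : WithBot ℕ∞)) x
  · obtain ⟨z, hzy, hz⟩ := nonempty_inter_closedPoints (Z := closure {y})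
      ⟨y, subset_closure rfl⟩ isClosed_closure.isLocallyClosed
    rw [Scheme.ringKrullDim_stalk_eq_of_isClosed hreg hx hz, ringKrullDim_stalk_eq_coheight]
    have h2 : z ≤ y := Scheme.le_iff_specializes.2 (specializes_iff_mem_closure.2 hzy)
    exact WithBot.coe_le_coe.2 (Order.coheight_anti h2)

end Dimension

end AlgebraicGeometry

end ClosedPoints

/-! ### Stalks of sheaves of algebras and of sheaves of left ideals -/

namespace OrderZeta

namespace AlgebraSheaf

variable {X : Scheme.{u}} (𝒜 : AlgebraSheaf X)

theorem germ_res {U V : X.Opens} (h : V ≤ U) (x : X) (hx : x ∈ V) (s : 𝒜.sections U) :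
    𝒜.germ V x hx (𝒜.res h s) = 𝒜.germ U x (h hx) s :=
  TopCat.Presheaf.germ_res_apply 𝒜.sheaf.presheaf (homOfLE h) x hx s

theorem res_res {U V W : X.Opens} (h : V ≤ U) (h' : W ≤ V) (s : 𝒜.sections U) :
    𝒜.res h' (𝒜.res h s) = 𝒜.res (h'.trans h) s := by
  have := 𝒜.sheaf.presheaf.map_comp (homOfLE h).op (homOfLE h').op
  exact (ConcreteCategory.congr_hom this s).symm

theorem exists_germ_eq {x : X} (a : 𝒜.stalk x) :
    ∃ (U : X.Opens) (hx : x ∈ U) (s : 𝒜.sections U), 𝒜.germ U x hx s = a :=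
  TopCat.Presheaf.exists_germ_eq 𝒜.sheaf.presheaf a

theorem exists_res_eq_of_germ_eq {U V : X.Opens} {x : X} (hU : x ∈ U) (hV : x ∈ V)
    (s : 𝒜.sections U) (t : 𝒜.sections V) (h : 𝒜.germ U x hU s = 𝒜.germ V x hV t) :
    ∃ (W : X.Opens) (_ : x ∈ W) (h₁ : W ≤ U) (h₂ : W ≤ V), 𝒜.res h₁ s = 𝒜.res h₂ t := by
  obtain ⟨W, hW, iU, iV, hi⟩ := TopCat.Presheaf.germ_eq 𝒜.sheaf.presheaf x hU hV s t h
  exact ⟨W, hW, leOfHom iU, leOfHom iV, hi⟩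

theorem germ_unit_mul_comm (U : X.Opens) (x : X) (hx : x ∈ U) (r : Γ(X, U)) (a : 𝒜.stalk x) :
    𝒜.germ U x hx (𝒜.unit U r) * a = a * 𝒜.germ U x hx (𝒜.unit U r) := by
  obtain ⟨V, hV, t, rfl⟩ := 𝒜.exists_germ_eq a
  have hW : x ∈ U ⊓ V := ⟨hx, hV⟩
  rw [← 𝒜.germ_res (V := U ⊓ V) inf_le_left x hW, ← 𝒜.germ_res (V := U ⊓ V) inf_le_right x hW,
    ← map_mul, ← map_mul]
  have h1 : 𝒜.res (V := U ⊓ V) inf_le_left (𝒜.unit U r) = _ := 𝒜.unit_res U (U ⊓ V) inf_le_left r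
  rw [h1, 𝒜.unit_central]

/-- The stalk `𝒜_x` as an algebra over the sections of `𝒪_X` on a neighbourhood of `x`. -/
@[reducible]
noncomputable def stalkAlgebra (U : X.Opens) (x : X) (hx : x ∈ U) :
    Algebra Γ(X, U) (𝒜.stalk x) :=
  ((𝒜.germ U x hx).comp (𝒜.unit U)).toAlgebra' (𝒜.germ_unit_mul_comm U x hx)

/-- The germ homomorphism as a homomorphism of `𝒪_X(U)`-algebras. -/
noncomputable def germAlgHom (U : X.Opens) (x : X) (hx : x ∈ U) :
    letI := 𝒜.stalkAlgebra U x hx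
    𝒜.sections U →ₐ[Γ(X, U)] 𝒜.stalk x :=
  letI := 𝒜.stalkAlgebra U x hx
  { 𝒜.germ U x hx with commutes' := fun _ => rfl }

theorem isUnit_germ_unit (U : X.Opens) (x : X) (hx : x ∈ U) (f : Γ(X, U))
    (hf : x ∈ X.basicOpen f) : IsUnit (𝒜.germ U x hx (𝒜.unit U f)) := by
  rw [← 𝒜.germ_res (X.basicOpen_le f) x hf]
  refine IsUnit.map _ ?_
  have h1 : 𝒜.res (X.basicOpen_le f) (𝒜.unit U f) = _ :=
    𝒜.unit_res U (X.basicOpen f) (X.basicOpen_le f) f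
  rw [h1]
  exact (RingedSpace.isUnit_res_basicOpen X.toRingedSpace f).map _

variable {𝒜}

/-- The stalk of a quasi-coherent sheaf of algebras is a localization of the sections on an affine
neighbourhood. -/
theorem IsQuasicoherent.isLocalizedModule_germ (h : 𝒜.IsQuasicoherent) {U : X.Opens}
    (hU : IsAffineOpen U) (x : X) (hx : x ∈ U) :
    letI := 𝒜.stalkAlgebra U x hx
    IsLocalizedModule (hU.primeIdealOf ⟨x, hx⟩).asIdeal.primeCompl
      (𝒜.germAlgHom U x hx).toLinearMap := by
  let := 𝒜.stalkAlgebra U x hx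
  have hsmul : ∀ (f : Γ(X, U)) (a : 𝒜.stalk x), f • a = 𝒜.germ U x hx (𝒜.unit U f) * a :=
    fun f a => Algebra.smul_def f a
  refine ⟨?_, ?_, ?_⟩
  · rintro ⟨f, hf⟩
    have hf' := (hU.mem_basicOpen_iff_notMem_primeIdealOf ⟨x, hx⟩ f).2 hf
    obtain ⟨w, hw⟩ := 𝒜.isUnit_germ_unit U x hx f hf'
    rw [Module.End.isUnit_iff]
    constructor
    · intro a b hab
      have hab : f • a = f • b := hab
      rw [hsmul, hsmul, ← hw] at hab
      exact w.mul_right_inj.1 hab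
    · intro a
      refine ⟨(↑w⁻¹ : 𝒜.stalk x) * a, ?_⟩
      change f • ((↑w⁻¹ : 𝒜.stalk x) * a) = a
      rw [hsmul, ← hw, Units.mul_inv_cancel_left]
  · intro a
    obtain ⟨V, hV, t, rfl⟩ := 𝒜.exists_germ_eq a
    obtain ⟨f, hfV, hxf⟩ := hU.exists_basicOpen_le ⟨x, hV⟩ hx
    obtain ⟨n, s, hs⟩ := h.exists_res_eq U hU f (𝒜.res hfV t)
    have hf := (hU.mem_basicOpen_iff_notMem_primeIdealOf ⟨x, hx⟩ f).1 hxf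
    refine ⟨⟨s, ⟨f ^ n, Submonoid.pow_mem _ hf n⟩⟩, ?_⟩
    change f ^ n • 𝒜.germ V x hV t = 𝒜.germ U x hx s
    rw [hsmul, ← 𝒜.germ_res (X.basicOpen_le f) x hxf s, hs, map_mul, map_pow, map_pow,
      map_pow, 𝒜.germ_res, 𝒜.germ_res]
  · intro s t hst
    have hst : 𝒜.germ U x hx s = 𝒜.germ U x hx t := hst
    obtain ⟨W, hW, h₁, h₂, hres⟩ := 𝒜.exists_res_eq_of_germ_eq hx hx s t hst
    obtain ⟨f, hfW, hxf⟩ := hU.exists_basicOpen_le ⟨x, hW⟩ hx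
    have hf := (hU.mem_basicOpen_iff_notMem_primeIdealOf ⟨x, hx⟩ f).1 hxf
    obtain ⟨n, hn⟩ := h.exists_smul_eq_zero U hU f (s - t) (by
      rw [map_sub, sub_eq_zero, ← 𝒜.res_res h₁ hfW, hres, 𝒜.res_res])
    refine ⟨⟨f ^ n, Submonoid.pow_mem _ hf n⟩, ?_⟩
    change f ^ n • s = f ^ n • t
    rw [← sub_eq_zero, ← smul_sub, hn]

namespace LeftIdeal

variable (I : 𝒜.LeftIdeal)

theorem mem_stalk_iff {x : X} {a : 𝒜.stalk x} : a ∈ I.stalk x ↔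
    ∃ (U : X.Opens) (hx : x ∈ U) (s : 𝒜.sections U), s ∈ I.ideal U ∧ 𝒜.germ U x hx s = a := by
  refine ⟨fun h => ?_, fun h => Ideal.subset_span h⟩
  induction h using Submodule.span_induction with
  | mem a ha => exact ha
  | zero => exact ⟨⊤, trivial, 0, zero_mem _, map_zero _⟩
  | add a b _ _ ha hb =>
    obtain ⟨U, hU, s, hs, rfl⟩ := ha
    obtain ⟨V, hV, t, ht, rfl⟩ := hb
    have hUV : x ∈ U ⊓ V := ⟨hU, hV⟩
    refine ⟨U ⊓ V, hUV, 𝒜.res inf_le_left s + 𝒜.res inf_le_right t,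
      add_mem (I.res_mem _ _ _ _ hs) (I.res_mem _ _ _ _ ht), ?_⟩
    rw [map_add, 𝒜.germ_res, 𝒜.germ_res]
  | smul c a _ ha =>
    obtain ⟨U, hU, s, hs, rfl⟩ := ha
    obtain ⟨V, hV, t, rfl⟩ := 𝒜.exists_germ_eq c
    have hUV : x ∈ U ⊓ V := ⟨hU, hV⟩
    refine ⟨U ⊓ V, hUV, 𝒜.res inf_le_right t * 𝒜.res inf_le_left s,
      Ideal.mul_mem_left _ _ (I.res_mem _ _ _ _ hs), ?_⟩
    rw [map_mul, 𝒜.germ_res, 𝒜.germ_res, smul_eq_mul]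

theorem mem_ideal_iff_germ_mem {U : X.Opens} {s : 𝒜.sections U} :
    s ∈ I.ideal U ↔ ∀ (x : X) (hx : x ∈ U), 𝒜.germ U x hx s ∈ I.stalk x := by
  refine ⟨fun h x hx => I.mem_stalk_iff.2 ⟨U, hx, s, h, rfl⟩, fun h =>
    I.mem_of_locally U s fun x hx => ?_⟩
  obtain ⟨V, hV, t, ht, hst⟩ := I.mem_stalk_iff.1 (h x hx)
  obtain ⟨W, hW, h₁, h₂, hres⟩ := 𝒜.exists_res_eq_of_germ_eq hV hx t s hst
  exact ⟨W, h₂, hW, hres ▸ I.res_mem _ _ _ _ ht⟩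

theorem stalk_injective : Function.Injective (fun (I : 𝒜.LeftIdeal) (x : X) => I.stalk x) := by
  intro I J h
  ext U s
  rw [mem_ideal_iff_germ_mem, mem_ideal_iff_germ_mem]
  simp only [fun x => congrFun h x]

/-- The sheaf of left ideals of the sections whose germs lie in given left ideals. -/
def ofStalks (J : ∀ x : X, Ideal (𝒜.stalk x)) : 𝒜.LeftIdeal where
  ideal U :=
    { carrier := {s | ∀ (x : X) (hx : x ∈ U), 𝒜.germ U x hx s ∈ J x}
      add_mem' := fun hs ht x hx => by
        rw [map_add]
        exact add_mem (hs x hx) (ht x hx)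
      zero_mem' := fun x hx => by
        rw [map_zero]
        exact zero_mem _
      smul_mem' := fun c s hs x hx => by
        rw [smul_eq_mul, map_mul]
        exact Ideal.mul_mem_left _ _ (hs x hx) }
  res_mem U V h s hs x hx := by
    rw [𝒜.germ_res]
    exact hs x (h hx)
  mem_of_locally U s hs x hx := by
    obtain ⟨V, h, hxV, hV⟩ := hs x hx
    have := hV x hxV
    rwa [𝒜.germ_res] at this

theorem mem_ofStalks {J : ∀ x : X, Ideal (𝒜.stalk x)} {U : X.Opens} {s : 𝒜.sections U} :
    s ∈ (ofStalks J).ideal U ↔ ∀ (x : X) (hx : x ∈ U), 𝒜.germ U x hx s ∈ J x := Iff.rfl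

/-- An element of the maximal ideal of a point acts nilpotently on a finite quotient of the
stalk. -/
theorem exists_pow_germ_mem (h𝒜 : 𝒜.IsQuasicoherent) {U : X.Opens} (hU : IsAffineOpen U)
    (x : X) (hx : x ∈ U) (J : Ideal (𝒜.stalk x)) [Finite (𝒜.stalk x ⧸ J)] :
    ∃ e : ℕ, ∀ f ∈ (hU.primeIdealOf ⟨x, hx⟩).asIdeal ^ e, ∀ s : 𝒜.sections U,
      𝒜.germ U x hx (f • s) ∈ J := by
  let := 𝒜.stalkAlgebra U x hx
  have := h𝒜.isLocalizedModule_germ hU x hx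
  refine ⟨Nat.card (𝒜.stalk x ⧸ J), fun f hf s => ?_⟩
  have h := IsLocalizedModule.pow_smul_mem_of_card_le (hU.primeIdealOf ⟨x, hx⟩).asIdeal
    (𝒜.germAlgHom U x hx) J le_rfl hf (𝒜.germ U x hx s)
  rw [Algebra.smul_def] at h
  rw [Algebra.smul_def, map_mul]
  exact h

/-- The stalks of `ofStalks J` are the given left ideals, if these are proper at finitely many
closed points only. An element of `J x` is the germ of a section up to a unit; multiplying that
section by a function which is invertible at `x` and vanishes to high order at the other points
gives a section of `ofStalks J`. -/
theorem stalk_ofStalks (h𝒜 : 𝒜.IsQuasicoherent) (J : ∀ x : X, Ideal (𝒜.stalk x))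
    (hJ : {x | J x ≠ ⊤}.Finite) (hcl : ∀ x, J x ≠ ⊤ → IsClosed ({x} : Set X))
    (hfin : ∀ x, Finite (𝒜.stalk x ⧸ J x)) (x : X) : (ofStalks J).stalk x = J x := by
  classical
  apply le_antisymm
  · intro a ha
    obtain ⟨U, hx, s, hs, rfl⟩ := (mem_stalk_iff _).1 ha
    exact hs x hx
  · intro a ha
    obtain ⟨U, hU, hx, -⟩ := X.exists_isAffineOpen_mem_le (V := ⊤) (x := x) trivial
    let := 𝒜.stalkAlgebra U x hx
    have hloc := h𝒜.isLocalizedModule_germ hU x hx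
    obtain ⟨⟨b, s⟩, hbs⟩ := IsLocalizedModule.surj (hU.primeIdealOf ⟨x, hx⟩).asIdeal.primeCompl
      (𝒜.germAlgHom U x hx).toLinearMap a
    have hbs : s.1 • a = 𝒜.germ U x hx b := hbs
    -- a function outside the prime ideal of `x` which kills the quotients at all other points
    choose e he using fun y : U => have := hfin y.1; exists_pow_germ_mem h𝒜 hU y.1 y.2 (J y.1)
    let T : Finset U := Set.Finite.toFinset (s := {y : U | J y.1 ≠ ⊤ ∧ y.1 ≠ x})
      ((hJ.preimage Subtype.val_injective.injOn).subset fun y hy => hy.1)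
    have hTmem : ∀ y : U, y ∈ T ↔ J y.1 ≠ ⊤ ∧ y.1 ≠ x := fun y =>
      Set.Finite.mem_toFinset (s := {y : U | J y.1 ≠ ⊤ ∧ y.1 ≠ x}) _
    obtain ⟨f, hf, hfx⟩ : ∃ f ∈ ∏ y ∈ T, (hU.primeIdealOf y).asIdeal ^ e y,
        f ∉ (hU.primeIdealOf ⟨x, hx⟩).asIdeal := by
      refine SetLike.not_le_iff_exists.1 fun hle => ?_
      obtain ⟨y, hyT, hy⟩ := ((hU.primeIdealOf ⟨x, hx⟩).isPrime.prod_le).1 hle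
      have hyT' : J y.1 ≠ ⊤ ∧ y.1 ≠ x := (hTmem y).1 hyT
      have hy' := (hU.primeIdealOf ⟨x, hx⟩).isPrime.le_of_pow_le hy
      have hmax := hU.primeIdealOf_isMaximal_of_isClosed y (hcl y.1 hyT'.1)
      have h1 := hmax.eq_of_le (hU.primeIdealOf ⟨x, hx⟩).isPrime.ne_top hy'
      exact hyT'.2 (congrArg Subtype.val (hU.primeIdealOf_injective (PrimeSpectrum.ext h1)))
    have hmem : f • b ∈ (ofStalks J).ideal U := by
      rw [mem_ofStalks]
      intro y hy
      by_cases hyJ : J y = ⊤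
      · rw [hyJ]
        trivial
      by_cases hyx : y = x
      · subst hyx
        have h1 : s.1 • a ∈ J y := Submodule.smul_of_tower_mem _ _ ha
        rw [hbs] at h1
        rw [Algebra.smul_def, map_mul]
        exact Ideal.mul_mem_left _ _ h1
      · refine he ⟨y, hy⟩ f ?_ b
        exact Ideal.prod_le_inf.trans (Finset.inf_le (b := (⟨y, hy⟩ : U))
          ((hTmem ⟨y, hy⟩).2 ⟨hyJ, hyx⟩)) hf
    have hst : f • s.1 • a ∈ (ofStalks J).stalk x := by
      rw [mem_stalk_iff]
      refine ⟨U, hx, f • b, hmem, ?_⟩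
      rw [hbs, Algebra.smul_def, Algebra.smul_def, map_mul]
      rfl
    exact IsLocalizedModule.mem_ideal_of_smul_mem _ (𝒜.germAlgHom U x hx) s.2
      (IsLocalizedModule.mem_ideal_of_smul_mem _ (𝒜.germAlgHom U x hx) hfx hst)

theorem isCofinite_ofStalks (h𝒜 : 𝒜.IsQuasicoherent) (J : ∀ x : X, Ideal (𝒜.stalk x))
    (hJ : {x | J x ≠ ⊤}.Finite) (hcl : ∀ x, J x ≠ ⊤ → IsClosed ({x} : Set X))
    (hres : ∀ x, J x ≠ ⊤ → Finite (X.residueField x))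
    (hfin : ∀ x, Finite (𝒜.stalk x ⧸ J x)) : (ofStalks J).IsCofinite := by
  have hst := stalk_ofStalks h𝒜 J hJ hcl hfin
  have hsupp : (ofStalks J).support = {x | J x ≠ ⊤} := by
    ext x
    simp [support, hst]
  refine ⟨?_, by rw [hsupp]; exact hJ, by rw [hsupp]; exact hcl, by rw [hsupp]; exact hres⟩
  intro U hU f s hs
  choose e he using fun y : U => have := hfin y.1; exists_pow_germ_mem h𝒜 hU y.1 y.2 (J y.1)
  have hT := hJ.preimage (f := (Subtype.val : U → X)) Subtype.val_injective.injOn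
  refine ⟨∑ y ∈ hT.toFinset, e y, mem_ofStalks.2 fun y hy => ?_⟩
  by_cases hyJ : J y = ⊤
  · rw [hyJ]
    trivial
  by_cases hyf : y ∈ X.basicOpen f
  · have h1 := mem_ofStalks.1 hs y hyf
    rw [𝒜.germ_res] at h1
    rw [Algebra.smul_def, map_mul]
    exact Ideal.mul_mem_left _ _ h1
  · refine he ⟨y, hy⟩ _ ?_ s
    rw [hU.mem_basicOpen_iff_notMem_primeIdealOf ⟨y, hy⟩, not_not] at hyf
    refine Ideal.pow_le_pow_right ?_ (Ideal.pow_mem_pow hyf _)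
    exact Finset.single_le_sum (f := e) (fun _ _ => Nat.zero_le _)
      (by simpa using hyJ : (⟨y, hy⟩ : U) ∈ hT.toFinset)

end LeftIdeal

end AlgebraSheaf

end OrderZeta

/-! ### Cofinite sheaves of left ideals as finite families of local left ideals -/

theorem Module.finite_of_pow_smul_eq_zero {R Q : Type*} [CommRing R] [IsNoetherianRing R]
    [AddCommGroup Q] [Module R Q] [Module.Finite R Q] (m : Ideal R) [Finite (R ⧸ m)] (n : ℕ)
    (h : ∀ f ∈ m ^ n, ∀ q : Q, f • q = 0) : Finite Q := by
  have : Finite (R ⧸ m ^ n) := Ideal.finite_quotient_pow (IsNoetherian.noetherian m) n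
  have htor : Module.IsTorsionBySet R Q (m ^ n : Ideal R) := fun q f => h f.1 f.2 q
  let := htor.module
  have : IsScalarTower R (R ⧸ m ^ n) Q := htor.isScalarTower
  have : Module.Finite (R ⧸ m ^ n) Q := Module.Finite.of_restrictScalars_finite R _ _
  exact Module.finite_of_finite (R ⧸ m ^ n)

theorem Ideal.finite_quotient_of_pow_smul_mem {R B : Type*} [CommRing R] [IsNoetherianRing R]
    [Ring B] [Algebra R B] [Module.Finite R B] (m : Ideal R) [Finite (R ⧸ m)] (n : ℕ) (J : Ideal B)
    (h : ∀ f ∈ m ^ n, ∀ b : B, f • b ∈ J) : Finite (B ⧸ J) := by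
  have h1 : Finite (B ⧸ J.restrictScalars R) := by
    refine Module.finite_of_pow_smul_eq_zero m n fun f hf q => ?_
    obtain ⟨b, rfl⟩ := Submodule.Quotient.mk_surjective _ q
    rw [← Submodule.Quotient.mk_smul, Submodule.Quotient.mk_eq_zero]
    exact h f hf b
  exact h1

theorem Nat.card_pi_eq_prod_of_subsingleton {ι : Type*} {M : ι → Type*} [∀ i, Nonempty (M i)]
    (S : Finset ι) (h : ∀ i ∉ S, Subsingleton (M i)) :
    Nat.card (∀ i, M i) = ∏ i : S, Nat.card (M i) := by
  classical
  rw [Nat.card_congr (Equiv.piEquivPiSubtypeProd (· ∈ S) M), Nat.card_prod]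
  have h1 : ∀ i : {i // i ∉ S}, Subsingleton (M i) := fun i => h i i.2
  have h2 : Nonempty (∀ i : {i // i ∉ S}, M i) := Pi.instNonempty
  have h3 : Nat.card (∀ i : {i // i ∉ S}, M i) = 1 :=
    Nat.card_eq_one_iff_unique.2 ⟨inferInstance, h2⟩
  rw [h3, mul_one]
  exact Nat.card_pi

namespace OrderZeta

namespace AlgebraSheaf

variable {X : Scheme.{u}} {𝒜 : AlgebraSheaf X}

namespace LeftIdeal

/-- The stalks of a cofinite sheaf of left ideals have finite index. In an affine neighbourhood `U`
of a point `x` of the support which meets the support in `x` only, quasi-coherence shows that a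
power of the maximal ideal `m` of `x` multiplies `𝒜(U)` into `𝓘(U)`. -/
theorem IsCofinite.finite_stalk_quotient [LocallyOfFiniteType (specULiftZIsTerminal.{u}.from X)]
    {I : 𝒜.LeftIdeal} (hI : I.IsCofinite) {d : ℕ}
    (h𝒜 : 𝒜.IsAzumayaOfDegree d) (x : X) : Finite (𝒜.stalk x ⧸ I.stalk x) := by
  by_cases hx : x ∈ I.support
  swap
  · have hx : I.stalk x = ⊤ := by simpa [support] using hx
    have : Subsingleton (𝒜.stalk x ⧸ I.stalk x) := by
      rw [hx]
      exact Submodule.Quotient.subsingleton_iff.2 rfl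
    infer_instance
  let V : X.Opens := ⟨(I.support \ {x})ᶜ, by
    rw [isOpen_compl_iff, ← Set.biUnion_of_singleton (I.support \ {x})]
    exact (hI.finite_support.subset Set.sdiff_subset).isClosed_biUnion
      fun y hy => hI.isClosed y hy.1⟩
  have hxV : x ∈ V := fun h => h.2 rfl
  obtain ⟨U, hU, hxU, hUV⟩ := X.exists_isAffineOpen_mem_le hxV
  have hmax := hU.primeIdealOf_isMaximal_of_isClosed ⟨x, hxU⟩ (hI.isClosed x hx)
  have := Scheme.isNoetherianRing_of_isAffineOpen hU
  have := Scheme.finite_quotient_of_isMaximal hU (hU.primeIdealOf ⟨x, hxU⟩).asIdeal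
  have haz := h𝒜.azumaya U hU
  set m := (hU.primeIdealOf ⟨x, hxU⟩).asIdeal with hm
  -- the ideal of functions which multiply `𝒜(U)` into `𝓘(U)`
  let a : Ideal Γ(X, U) :=
    ((I.ideal U).restrictScalars Γ(X, U)).comap (Algebra.linearMap Γ(X, U) (𝒜.sections U))
  have ha : ∀ f ∈ a, ∀ b : 𝒜.sections U, f • b ∈ I.ideal U := by
    intro f hf b
    have h1 : algebraMap Γ(X, U) (𝒜.sections U) f ∈ I.ideal U := hf
    rw [Algebra.smul_def, Algebra.commutes]
    exact Ideal.mul_mem_left _ _ h1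
  have hrad : m ≤ a.radical := by
    intro f hf
    obtain ⟨n, hn⟩ := hI.quasicoherent U hU f 1 (by
      rw [mem_ideal_iff_germ_mem]
      intro y hy
      have hyx : y ≠ x := by
        rintro rfl
        exact (hU.mem_basicOpen_iff_notMem_primeIdealOf ⟨y, hxU⟩ f).1 hy hf
      have hyI : I.stalk y = ⊤ := by
        by_contra h
        exact hUV (X.basicOpen_le f hy) ⟨h, hyx⟩
      rw [hyI]
      trivial)
    refine ⟨n, ?_⟩
    change algebraMap Γ(X, U) (𝒜.sections U) (f ^ n) ∈ I.ideal U
    rw [Algebra.algebraMap_eq_smul_one]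
    exact hn
  obtain ⟨n, hn⟩ := Ideal.exists_pow_le_of_le_radical_of_fg hrad (IsNoetherian.noetherian m)
  have hfinB : Finite (𝒜.sections U ⧸ I.ideal U) :=
    Ideal.finite_quotient_of_pow_smul_mem m n (I.ideal U) fun f hf b => ha f (hn hf) b
  let := 𝒜.stalkAlgebra U x hxU
  have hloc := h𝒜.quasicoherent.isLocalizedModule_germ hU x hxU
  let g := 𝒜.germAlgHom U x hxU
  have hle : (I.ideal U : Submodule (𝒜.sections U) (𝒜.sections U)) ≤
      (I.stalk x).comap (g : 𝒜.sections U →+* 𝒜.stalk x) :=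
    fun s hs => (I.mem_stalk_iff).2 ⟨U, hxU, s, hs, rfl⟩
  have hfinC : Finite (𝒜.sections U ⧸ (I.stalk x).comap (g : 𝒜.sections U →+* 𝒜.stalk x)) :=
    Finite.of_surjective _ (Submodule.factor_surjective hle)
  have hcard := IsLocalizedModule.natCard_quotient_comap m g (I.stalk x)
  exact Nat.finite_of_card_ne_zero (hcard ▸ Nat.card_pos.ne')

theorem natCard_residueField_le {d : ℕ} (h𝒜 : 𝒜.IsAzumayaOfDegree d) {x : X}
    (hx : IsClosed ({x} : Set X)) (J : Ideal (𝒜.stalk x)) [Finite (𝒜.stalk x ⧸ J)] (hJ : J ≠ ⊤) :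
    Nat.card (X.residueField x) ≤ Nat.card (𝒜.stalk x ⧸ J) := by
  obtain ⟨U, hU, hxU, -⟩ := X.exists_isAffineOpen_mem_le (V := ⊤) (x := x) trivial
  have := hU.primeIdealOf_isMaximal_of_isClosed ⟨x, hxU⟩ hx
  let := 𝒜.stalkAlgebra U x hxU
  have hloc := h𝒜.quasicoherent.isLocalizedModule_germ hU x hxU
  rw [← hU.natCard_quotient_primeIdealOf ⟨x, hxU⟩]
  exact IsLocalizedModule.natCard_le_of_ne_top _ (𝒜.germAlgHom U x hxU) J hJ

theorem card_eq_prod (I : 𝒜.LeftIdeal) (S : Finset X) (hS : I.support ⊆ S) :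
    I.card = ∏ x : S, Nat.card (𝒜.stalk x.1 ⧸ I.stalk x.1) :=
  Nat.card_pi_eq_prod_of_subsingleton S fun x hx => by
    have hx : I.stalk x = ⊤ := by
      by_contra h
      exact hx (hS h)
    rw [hx]
    exact Submodule.Quotient.subsingleton_iff.2 rfl

theorem IsCofinite.finite_quot [LocallyOfFiniteType (specULiftZIsTerminal.{u}.from X)]
    {I : 𝒜.LeftIdeal} (hI : I.IsCofinite) {d : ℕ}
    (h𝒜 : 𝒜.IsAzumayaOfDegree d) : Finite I.Quot := by
  have hfin := hI.finite_stalk_quotient h𝒜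
  refine Nat.finite_of_card_ne_zero ?_
  have h1 : I.card ≠ 0 := by
    rw [I.card_eq_prod hI.finite_support.toFinset (by simp)]
    exact Finset.prod_ne_zero_iff.2 fun x _ => Nat.card_pos.ne'
  exact h1

/-- Points with residue field of more than `n` elements do not lie in the support of a cofinite
sheaf of left ideals of index `n`. -/
theorem IsCofinite.natCard_residueField_le_card
    [LocallyOfFiniteType (specULiftZIsTerminal.{u}.from X)]
    {I : 𝒜.LeftIdeal} (hI : I.IsCofinite) {d : ℕ}
    (h𝒜 : 𝒜.IsAzumayaOfDegree d) {x : X} (hx : x ∈ I.support) :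
    Nat.card (X.residueField x) ≤ I.card := by
  have hfin := hI.finite_stalk_quotient h𝒜
  refine (natCard_residueField_le h𝒜 (hI.isClosed x hx) (I.stalk x) hx).trans ?_
  have := hI.finite_quot h𝒜
  exact Nat.card_le_card_of_surjective (fun f : I.Quot => f x) (Function.surjective_eval x)

end LeftIdeal

open LeftIdeal in
/-- Cofinite sheaves of left ideals of index `n` correspond to families of left ideals in the stalks
at the closed points with residue field of at most `n` elements, with product of indices `n`. -/
theorem card_idealsOfCard [LocallyOfFiniteType (specULiftZIsTerminal.{u}.from X)] {d : ℕ}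
    (h𝒜 : 𝒜.IsAzumayaOfDegree d) {n : ℕ} (hn : n ≠ 0) (S : Finset X)
    (hcl : ∀ x ∈ S, IsClosed ({x} : Set X))
    (hS : ∀ x, IsClosed ({x} : Set X) → Nat.card (X.residueField x) ≤ n → x ∈ S) :
    ENat.card (𝒜.idealsOfCard n) =
      ENat.card {J : ∀ x : S, Ideal (𝒜.stalk x.1) //
        ∏ x, Nat.card (𝒜.stalk x.1 ⧸ J x) = n} := by
  classical
  have hsupp : ∀ I : 𝒜.idealsOfCard n, I.1.support ⊆ S := fun I x hx =>
    hS x (I.2.1.isClosed x hx) ((I.2.1.natCard_residueField_le_card h𝒜 hx).trans I.2.2.le)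
  refine ENat.card_congr (Equiv.ofBijective
    (fun I => ⟨fun x => I.1.stalk x.1, by rw [← I.1.card_eq_prod S (hsupp I), I.2.2]⟩) ⟨?_, ?_⟩)
  · intro I I' h
    refine Subtype.ext (stalk_injective (funext fun x => ?_))
    by_cases hx : x ∈ S
    · exact congrFun (congrArg Subtype.val h) ⟨x, hx⟩
    · have h1 : ∀ I : 𝒜.idealsOfCard n, I.1.stalk x = ⊤ := fun I => by
        by_contra h
        exact hx (hsupp I h)
      exact (h1 I).trans (h1 I').symm
  · rintro ⟨J, hJ⟩
    let J' : ∀ x : X, Ideal (𝒜.stalk x) := fun x => if h : x ∈ S then J ⟨x, h⟩ else ⊤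
    have hJ' : ∀ x : S, J' x.1 = J x := fun x => dif_pos x.2
    have hJS : ∀ x, J' x ≠ ⊤ → x ∈ S := fun x hx => by
      by_contra h
      exact hx (dif_neg h)
    have hfin : ∀ x, Finite (𝒜.stalk x ⧸ J' x) := by
      intro x
      by_cases hx : x ∈ S
      · rw [hJ' ⟨x, hx⟩]
        refine Nat.finite_of_card_ne_zero ?_
        exact Finset.prod_ne_zero_iff.1 (hJ ▸ hn) ⟨x, hx⟩ (Finset.mem_univ _)
      · have h1 : J' x = ⊤ := dif_neg hx
        have : Subsingleton (𝒜.stalk x ⧸ J' x) := by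
          rw [h1]
          exact Submodule.Quotient.subsingleton_iff.2 rfl
        infer_instance
    have hfinS : {x | J' x ≠ ⊤}.Finite := S.finite_toSet.subset hJS
    have hst := stalk_ofStalks h𝒜.quasicoherent J' hfinS (fun x hx => hcl x (hJS x hx)) hfin
    have hco := isCofinite_ofStalks h𝒜.quasicoherent J' hfinS (fun x hx => hcl x (hJS x hx))
      (fun x hx => Scheme.finite_residueField_of_isClosed (hcl x (hJS x hx))) hfin
    have hcard : (ofStalks J').card = n := by
      rw [card_eq_prod _ S fun x hx => hJS x (by rwa [support, Set.mem_ofPred_eq, hst] at hx), ← hJ]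
      refine Finset.prod_congr rfl fun x _ => ?_
      rw [hst, hJ']
    exact ⟨⟨ofStalks J', hco, hcard⟩, Subtype.ext (funext fun x => (hst x.1).trans (hJ' x))⟩

end AlgebraSheaf

end OrderZeta

/-! ### Products of formal Dirichlet series up to a given order -/

section Truncation

open scoped ENNReal ArithmeticFunction

/-- The coefficients of a product up to order `N` depend on those of the factors up to order `N`
only. -/
theorem ArithmeticFunction.mul_apply_congr {R : Type*} [CommSemiring R] {N : ℕ}
    {f f' g g' : ArithmeticFunction R} (hf : ∀ n ≤ N, f n = f' n) (hg : ∀ n ≤ N, g n = g' n)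
    {n : ℕ} (hn : n ≤ N) : (f * g) n = (f' * g') n := by
  rw [ArithmeticFunction.mul_apply, ArithmeticFunction.mul_apply]
  refine Finset.sum_congr rfl fun x hx => ?_
  have h := Nat.mem_divisorsAntidiagonal.1 hx
  have h0 : x.1 ≠ 0 ∧ x.2 ≠ 0 := by
    rw [← mul_ne_zero_iff, h.1]
    exact h.2
  rw [hf _ (((Nat.le_mul_of_pos_right _ (Nat.pos_of_ne_zero h0.2)).trans h.1.le).trans hn),
    hg _ (((Nat.le_mul_of_pos_left _ (Nat.pos_of_ne_zero h0.1)).trans h.1.le).trans hn)]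

theorem ArithmeticFunction.prod_apply_congr {R ι : Type*} [CommSemiring R] {N : ℕ} (S : Finset ι)
    {f g : ι → ArithmeticFunction R} (h : ∀ i ∈ S, ∀ n ≤ N, f i n = g i n) {n : ℕ} (hn : n ≤ N) :
    (∏ i ∈ S, f i) n = (∏ i ∈ S, g i) n := by
  classical
  induction S using Finset.induction_on generalizing n with
  | empty => rfl
  | insert i S hi ih =>
    rw [Finset.prod_insert hi, Finset.prod_insert hi]
    exact ArithmeticFunction.mul_apply_congr (h i (Finset.mem_insert_self i S))
      (fun n hn => ih (fun j hj => h j (Finset.mem_insert_of_mem hj)) hn) hn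

theorem dirichletSum_pi {ι : Type u} [Fintype ι] (T : ι → Type v)
    (F : ∀ i, T i → ArithmeticFunction ℝ≥0∞) :
    dirichletSum (fun t : ∀ i, T i => ∏ i, F i (t i)) = ∏ i, dirichletSum (F i) := by
  refine Fintype.induction_empty_option (P := fun ι _ => ∀ (T : ι → Type v)
    (F : ∀ i, T i → ArithmeticFunction ℝ≥0∞),
      dirichletSum (fun t : ∀ i, T i => ∏ i, F i (t i)) = ∏ i, dirichletSum (F i)) ?_ ?_ ?_ ι T F
  · intro α β _ e ih T F
    let := Fintype.ofEquiv β e.symm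
    rw [← Equiv.prod_comp e, ← ih (fun i => T (e i)) fun i => F (e i),
      ← dirichletSum_equiv (Equiv.piCongrLeft T e)]
    congr 1
    funext t
    rw [← Equiv.prod_comp e]
    simp only [Equiv.piCongrLeft_apply_apply]
  · intro T F
    ext n
    simp [dirichletSum_apply]
  · intro α _ ih T F
    rw [Fintype.prod_option, ← ih, ← dirichletSum_mul_dirichletSum,
      ← dirichletSum_equiv (Equiv.piOptionEquivProd (β := T))]
    congr 1
    funext t
    rw [Fintype.prod_option]
    rfl

theorem dirichletMono_prod {ι : Type*} (S : Finset ι) (m : ι → ℕ) :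
    ∏ i ∈ S, dirichletMono (m i) 1 = dirichletMono (∏ i ∈ S, m i) 1 := by
  classical
  induction S using Finset.induction_on with
  | empty => exact dirichletMono_one_one.symm
  | insert i S hi ih =>
    rw [Finset.prod_insert hi, Finset.prod_insert hi, ih, dirichletMono_mul, one_mul]

theorem dirichletSum_dirichletMono_one {T : Type*} (w : T → ℕ) {n : ℕ} (hn : n ≠ 0) :
    dirichletSum (fun t => dirichletMono (w t) 1) n = (ENat.card {t // w t = n} : ℝ≥0∞) := by
  rw [dirichletSum_apply, ← tsum_subtype_eq_of_support_subset (s := {t | w t = n})]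
  · have : ∀ t : {t | w t = n}, dirichletMono (w t) 1 n = 1 := fun t => if_pos ⟨t.2.symm, hn⟩
    simp only [this, ENNReal.tsum_const, mul_one]
    rfl
  · intro t ht
    by_contra h
    exact ht (if_neg fun h' => h h'.1.symm)

/-- The formal Dirichlet series `(1 - q ^ b (q ^ a) ^ (-s))⁻¹ = ∑ₖ q ^ (k b) (q ^ (k a)) ^ (-s)`,
with coefficients in the natural numbers. -/
def eulerSeries (q a b : ℕ) : ArithmeticFunction ℕ :=
  ⟨fun n => ∑ k ∈ Finset.range n, if n = q ^ (k * a) then q ^ (k * b) else 0, rfl⟩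

theorem eulerSeries_apply_pow {q a : ℕ} (hq : 1 < q) (ha : a ≠ 0) (b k : ℕ) :
    eulerSeries q a b (q ^ (k * a)) = q ^ (k * b) := by
  change ∑ l ∈ Finset.range (q ^ (k * a)), _ = _
  rw [Finset.sum_eq_single k]
  · exact if_pos rfl
  · intro l _ hl
    refine if_neg fun h => hl ?_
    exact (Nat.eq_of_mul_eq_mul_right (Nat.pos_of_ne_zero ha)
      (Nat.pow_right_injective hq h)).symm
  · intro h
    refine absurd (Finset.mem_range.2 ?_) h
    exact (Nat.le_mul_of_pos_right k (Nat.pos_of_ne_zero ha)).trans_lt (Nat.lt_pow_self hq)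

theorem eulerSeries_apply_of_ne {q a : ℕ} (b : ℕ) {n : ℕ} (h : ∀ k, n ≠ q ^ (k * a)) :
    eulerSeries q a b n = 0 := by
  change ∑ k ∈ Finset.range n, _ = _
  exact Finset.sum_eq_zero fun k _ => if_neg (h k)

theorem dirichletSum_dirichletMono_pow {q a : ℕ} (hq : 1 < q) (ha : a ≠ 0) (b : ℕ) :
    dirichletSum (fun k : ℕ => dirichletMono (q ^ (k * a)) ((q : ℝ≥0∞) ^ (k * b))) =
      (eulerSeries q a b : ArithmeticFunction ℝ≥0∞) := by
  ext n
  rw [dirichletSum_apply, ArithmeticFunction.natCoe_apply]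
  by_cases h : ∃ k, n = q ^ (k * a)
  · obtain ⟨k, rfl⟩ := h
    rw [eulerSeries_apply_pow hq ha, tsum_eq_single k]
    · rw [dirichletMono_apply, if_pos ⟨rfl, (pow_pos (by omega) _).ne'⟩]
      push_cast
      rfl
    · intro l hl
      refine if_neg fun h => hl ?_
      exact (Nat.eq_of_mul_eq_mul_right (Nat.pos_of_ne_zero ha)
        (Nat.pow_right_injective hq h.1)).symm
  · push Not at h
    rw [eulerSeries_apply_of_ne b h, Nat.cast_zero]
    exact ENNReal.tsum_eq_zero.2 fun k => if_neg fun h' => h k h'.1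

theorem ArithmeticFunction.natCoe_prod {R ι : Type*} [CommSemiring R] (S : Finset ι)
    (f : ι → ArithmeticFunction ℕ) :
    ((∏ i ∈ S, f i : ArithmeticFunction ℕ) : ArithmeticFunction R) =
      ∏ i ∈ S, (f i : ArithmeticFunction R) := by
  classical
  induction S using Finset.induction_on with
  | empty => exact ArithmeticFunction.natCoe_one
  | insert i S hi ih =>
    rw [Finset.prod_insert hi, Finset.prod_insert hi, ArithmeticFunction.natCoe_mul, ih]

end Truncation

/-! ### The number of cofinite sheaves of left ideals -/

namespace OrderZeta

open scoped ENNReal ArithmeticFunction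

/-- The first `N` factors of the local factor of the zeta function of an Azumaya algebra of degree
`d`, at a point with residue field of order `q`. -/
def localZeta (d N q : ℕ) : ArithmeticFunction ℕ :=
  ∏ i ∈ Finset.range N, ∏ j ∈ Finset.range d, eulerSeries q (d * (i + 1)) (d * i + j)

namespace AlgebraSheaf

variable {X : Scheme.{u}} {𝒜 : AlgebraSheaf X} [IsIntegral X]
  [LocallyOfFiniteType (specULiftZIsTerminal.{u}.from X)]

/-- Left ideals of given finite index in the stalk at a closed point. -/
theorem dirichletSum_stalk_apply (hreg : ∀ x : X, IsRegularLocalRing (X.presheaf.stalk x))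
    (hdim : topologicalKrullDim X = 2) {d : ℕ} (h𝒜 : 𝒜.IsAzumayaOfDegree d) {x : X}
    (hx : IsClosed ({x} : Set X)) {m N : ℕ} (hm : m ≤ N) :
    dirichletSum (fun J : Ideal (𝒜.stalk x) => dirichletMono (Nat.card (𝒜.stalk x ⧸ J)) 1) m =
      (localZeta d N (Nat.card (X.residueField x)) : ArithmeticFunction ℝ≥0∞) m := by
  rcases eq_or_ne m 0 with rfl | hm0
  · rw [ArithmeticFunction.map_zero, ArithmeticFunction.map_zero]
  obtain ⟨U, hU, hxU, -⟩ := X.exists_isAffineOpen_mem_le (V := ⊤) (x := x) trivial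
  have := hU.primeIdealOf_isMaximal_of_isClosed ⟨x, hxU⟩ hx
  have := Scheme.isNoetherianRing_of_isAffineOpen hU
  have := Scheme.finite_quotient_of_isMaximal hU (hU.primeIdealOf ⟨x, hxU⟩).asIdeal
  have := h𝒜.azumaya U hU
  have := hreg x
  have : Nonempty U := ⟨⟨x, hxU⟩⟩
  have hd : 1 ≤ d := IsAzumaya.one_le_of_rankAtStalk_eq (𝒜.sections U) (h𝒜.rank U hU)
  have hq := Scheme.one_lt_natCard_residueField hx
  let := 𝒜.stalkAlgebra U x hxU
  have hloc := h𝒜.quasicoherent.isLocalizedModule_germ hU x hxU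
  let := TopCat.Presheaf.algebra_section_stalk X.presheaf (⟨x, hxU⟩ : U)
  have : IsLocalization.AtPrime (X.presheaf.stalk x) (hU.primeIdealOf ⟨x, hxU⟩).asIdeal :=
    hU.isLocalization_stalk ⟨x, hxU⟩
  have h1 := IsAzumaya.card_ideal_natCard_quotient_eq (h𝒜.rank U hU)
    (hU.primeIdealOf ⟨x, hxU⟩).asIdeal (IsNoetherian.noetherian _) (𝒜.germAlgHom U x hxU)
    (O := X.presheaf.stalk x) hm0
  have h2 := IsRegularLocalRing.submoduleSeries_apply (O := X.presheaf.stalk x)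
    ((Scheme.ringKrullDim_stalk_eq_topologicalKrullDim hreg hx).trans hdim)
    (q := Nat.card (X.residueField x)) rfl hq d (D := d) (by omega) hm
  rw [dirichletSum_dirichletMono_one _ hm0, h1, ← dirichletSum_dirichletMono_one _ hm0, h2,
    localZeta]
  simp only [ArithmeticFunction.natCoe_prod]
  congr 1
  refine Finset.prod_congr rfl fun i _ => Finset.prod_congr rfl fun j _ => ?_
  exact dirichletSum_dirichletMono_pow hq (mul_ne_zero (by omega) (by omega)) _

/-- The number of cofinite sheaves of left ideals of index `n` is a coefficient of a finite product
of geometric series. -/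
theorem encard_idealsOfCard (hreg : ∀ x : X, IsRegularLocalRing (X.presheaf.stalk x))
    (hdim : topologicalKrullDim X = 2) {d : ℕ} (h𝒜 : 𝒜.IsAzumayaOfDegree d) {n N : ℕ} (hn : n ≠ 0)
    (hnN : n ≤ N) (S : Finset (ClosedPt X))
    (hS : ∀ x : ClosedPt X, Nat.card (X.residueField x.1) ≤ n → x ∈ S) :
    ENat.card (𝒜.idealsOfCard n) =
      ((∏ x ∈ S, localZeta d N (Nat.card (X.residueField x.1))) n : ℕ) := by
  classical
  let S' : Finset X := S.map (Function.Embedding.subtype _)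
  have hS' : ∀ x ∈ S', IsClosed ({x} : Set X) := fun x hx => by
    obtain ⟨y, -, rfl⟩ := Finset.mem_map.1 hx
    exact y.2
  have h1 := card_idealsOfCard h𝒜 hn S' hS' fun x hx hxn =>
    Finset.mem_map.2 ⟨⟨x, hx⟩, hS ⟨x, hx⟩ hxn, rfl⟩
  have h2 : (ENat.card (𝒜.idealsOfCard n) : ℝ≥0∞) =
      ((∏ x ∈ S, localZeta d N (Nat.card (X.residueField x.1))) n : ℕ) := by
    rw [h1, ← dirichletSum_dirichletMono_one _ hn]
    simp only [← dirichletMono_prod]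
    rw [dirichletSum_pi (fun x : S' => Ideal (𝒜.stalk x.1))
        fun x J => dirichletMono (Nat.card (𝒜.stalk x.1 ⧸ J)) 1,
      ArithmeticFunction.prod_apply_congr (N := N) (g := fun x : S' =>
        (localZeta d N (Nat.card (X.residueField x.1)) : ArithmeticFunction ℝ≥0∞)) _
        (fun x _ m hm => dirichletSum_stalk_apply hreg hdim h𝒜 (hS' x.1 x.2) hm) hnN,
      ← ArithmeticFunction.natCoe_apply, ArithmeticFunction.natCoe_prod,
      Finset.prod_coe_sort S' fun x =>
        (localZeta d N (Nat.card (X.residueField x)) : ArithmeticFunction ℝ≥0∞), Finset.prod_map]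
    rfl
  exact_mod_cast h2

theorem finite_idealsOfCard [CompactSpace X]
    (hreg : ∀ x : X, IsRegularLocalRing (X.presheaf.stalk x))
    (hdim : topologicalKrullDim X = 2) {d : ℕ} (h𝒜 : 𝒜.IsAzumayaOfDegree d) (n : ℕ) :
    (𝒜.idealsOfCard n).Finite := by
  rcases eq_or_ne n 0 with rfl | hn
  · refine Set.Finite.subset Set.finite_empty fun I hI => ?_
    have := hI.1.finite_quot h𝒜
    exact (Nat.card_pos (α := I.Quot)).ne' hI.2
  · have h := encard_idealsOfCard hreg hdim h𝒜 hn le_rfl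
      (Scheme.finite_setOf_natCard_residueField_le (X := X) n).toFinset (by simp)
    have h2 : ENat.card (𝒜.idealsOfCard n) ≠ ⊤ := by
      rw [h]
      exact ENat.natCast_ne_top _
    have h3 : Finite (𝒜.idealsOfCard n) := by
      by_contra h4
      rw [not_finite_iff_infinite] at h4
      exact h2 ENat.card_eq_top_of_infinite
    exact h3

theorem zeta_apply (hreg : ∀ x : X, IsRegularLocalRing (X.presheaf.stalk x))
    (hdim : topologicalKrullDim X = 2) {d : ℕ} (h𝒜 : 𝒜.IsAzumayaOfDegree d) {n N : ℕ}
    (hnN : n ≤ N) (S : Finset (ClosedPt X))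
    (hS : ∀ x : ClosedPt X, Nat.card (X.residueField x.1) ≤ n → x ∈ S) :
    𝒜.zeta n =
      (∏ x ∈ S, localZeta d N (Nat.card (X.residueField x.1)) : ArithmeticFunction ℕ) n := by
  rcases eq_or_ne n 0 with rfl | hn
  · rw [ArithmeticFunction.map_zero, ArithmeticFunction.map_zero, Nat.cast_zero]
  · have h := encard_idealsOfCard hreg hdim h𝒜 hn hnN S hS
    change (if n = 0 then 0 else ((𝒜.idealsOfCard n).ncard : ℚ)) = _
    rw [if_neg hn, Set.ncard, Set.encard, h, ENat.toNat_natCast]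

end AlgebraSheaf

end OrderZeta

/-! ### Infinite products of formal Dirichlet series -/

open scoped ArithmeticFunction

/-- Factors which agree with `1` up to order `N` can be left out. -/
theorem ArithmeticFunction.prod_apply_eq_of_subset {R ι : Type*} [CommSemiring R] {N : ℕ}
    {S T : Finset ι} (hST : S ⊆ T) (f : ι → ArithmeticFunction R)
    (h : ∀ i ∈ T, i ∉ S → ∀ n ≤ N, f i n = (1 : ArithmeticFunction R) n) {n : ℕ} (hn : n ≤ N) :
    (∏ i ∈ T, f i) n = (∏ i ∈ S, f i) n := by
  classical
  rw [← Finset.prod_sdiff hST, ArithmeticFunction.mul_apply_congr (N := N) (f' := 1)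
    (g' := ∏ i ∈ S, f i) (fun m hm => ?_) (fun _ _ => rfl) hn, one_mul]
  rw [ArithmeticFunction.prod_apply_congr (N := N) (g := fun _ => 1) _ (fun i hi n hn => ?_) hm,
    Finset.prod_const_one]
  exact h i (Finset.mem_sdiff.1 hi).1 (Finset.mem_sdiff.1 hi).2 n hn

theorem eulerSeries_apply_of_lt {q a : ℕ} (hq : 1 < q) (ha : a ≠ 0) (b : ℕ) {n : ℕ}
    (hn : n < q ^ a) : eulerSeries q a b n = (1 : ArithmeticFunction ℕ) n := by
  rcases eq_or_ne n 1 with rfl | h1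
  · simpa using eulerSeries_apply_pow hq ha b 0
  · rw [ArithmeticFunction.one_apply_ne h1]
    refine eulerSeries_apply_of_ne b fun k hk => ?_
    rcases Nat.eq_zero_or_pos k with rfl | hk0
    · exact h1 (by simpa using hk)
    · have : q ^ a ≤ q ^ (k * a) := Nat.pow_le_pow_right (by omega) (Nat.le_mul_of_pos_left a hk0)
      omega

namespace OrderZeta

section Prod

variable {ι : Type*} {f : ι → ArithmeticFunction ℚ} {F : ArithmeticFunction ℚ}

theorem HasDirichletProd.hasDirichletProd_dirichletProd (hF : HasDirichletProd f F) :
    HasDirichletProd f (dirichletProd f) := by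
  have h : ∃ F, HasDirichletProd f F := ⟨F, hF⟩
  rw [dirichletProd, dif_pos h]
  exact h.choose_spec

/-- A product converges if up to each order only finitely many factors differ from `1`. -/
theorem hasDirichletProd_dirichletProd_of_finite (S : ℕ → Finset ι)
    (hS : ∀ N, ∀ i ∉ S N, ∀ n ≤ N, f i n = (1 : ArithmeticFunction ℚ) n) :
    HasDirichletProd f (dirichletProd f) := by
  refine HasDirichletProd.hasDirichletProd_dirichletProd
    (F := ⟨fun n => (∏ i ∈ S n, f i) n, ArithmeticFunction.map_zero⟩) fun n => ?_
  filter_upwards [Filter.eventually_ge_atTop (S n)] with T hT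
  exact ArithmeticFunction.prod_apply_eq_of_subset hT f (fun i _ hi => hS n i hi) le_rfl

theorem HasDirichletProd.apply_eq (hF : HasDirichletProd f F) {N : ℕ} {S : Finset ι}
    (hS : ∀ i ∉ S, ∀ n ≤ N, f i n = (1 : ArithmeticFunction ℚ) n) {n : ℕ} (hn : n ≤ N) :
    F n = (∏ i ∈ S, f i) n := by
  obtain ⟨T, h1, h2⟩ := ((hF n).and (Filter.eventually_ge_atTop S)).exists
  rw [← h1]
  exact ArithmeticFunction.prod_apply_eq_of_subset h2 f (fun i _ hi => hS i hi) hn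

end Prod

section Subst

theorem dirichletSubst_apply (D : ArithmeticFunction ℚ) (a : ℕ) (b : ℤ) (n : ℕ) :
    dirichletSubst D a b n =
      ∑ m ∈ n.divisors, if m ^ a = n then D m * (m : ℚ) ^ (-b) else 0 := rfl

theorem dirichletSubst_apply_pow (D : ArithmeticFunction ℚ) {a : ℕ} (ha : a ≠ 0) (b : ℤ) (m : ℕ) :
    dirichletSubst D a b (m ^ a) = D m * (m : ℚ) ^ (-b) := by
  rcases eq_or_ne m 0 with rfl | hm
  · simp [ha]
  rw [dirichletSubst_apply, Finset.sum_eq_single m]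
  · exact if_pos rfl
  · intro l _ hl
    exact if_neg fun h => hl (Nat.pow_left_injective ha h)
  · intro h
    exact absurd (Nat.mem_divisors.2 ⟨dvd_pow_self m ha, pow_ne_zero a hm⟩) h

theorem dirichletSubst_apply_of_ne (D : ArithmeticFunction ℚ) {a : ℕ} (b : ℤ) {n : ℕ}
    (h : ∀ m, m ^ a ≠ n) : dirichletSubst D a b n = 0 := by
  rw [dirichletSubst_apply]
  exact Finset.sum_eq_zero fun m _ => if_neg (h m)

theorem dirichletSubst_apply_congr {D D' : ArithmeticFunction ℚ} {N : ℕ}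
    (h : ∀ n ≤ N, D n = D' n) (a : ℕ) (b : ℤ) {n : ℕ} (hn : n ≤ N) :
    dirichletSubst D a b n = dirichletSubst D' a b n := by
  rw [dirichletSubst_apply, dirichletSubst_apply]
  refine Finset.sum_congr rfl fun m hm => ?_
  rw [h m ((Nat.divisor_le hm).trans hn)]

theorem dirichletSubst_one {a : ℕ} (ha : a ≠ 0) (b : ℤ) : dirichletSubst 1 a b = 1 := by
  ext n
  by_cases h : ∃ m, m ^ a = n
  · obtain ⟨m, rfl⟩ := h
    rw [dirichletSubst_apply_pow _ ha]
    rcases eq_or_ne m 1 with rfl | hm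
    · simp
    · rw [ArithmeticFunction.one_apply_ne hm, ArithmeticFunction.one_apply_ne, zero_mul]
      exact fun h => (Nat.pow_eq_one.1 h).elim hm ha
  · push Not at h
    rw [dirichletSubst_apply_of_ne _ b h, ArithmeticFunction.one_apply_ne]
    rintro rfl
    exact h 1 (one_pow a)

theorem dirichletSubst_mul (D D' : ArithmeticFunction ℚ) {a : ℕ} (ha : a ≠ 0) (b : ℤ) :
    dirichletSubst (D * D') a b = dirichletSubst D a b * dirichletSubst D' a b := by
  ext n
  rw [ArithmeticFunction.mul_apply]
  by_cases h : ∃ m, m ^ a = n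
  · obtain ⟨m, rfl⟩ := h
    rcases eq_or_ne m 0 with rfl | hm
    · simp [ha]
    rw [dirichletSubst_apply_pow _ ha, ArithmeticFunction.mul_apply, Finset.sum_mul]
    refine Finset.sum_of_injOn (fun x => (x.1 ^ a, x.2 ^ a)) ?_ ?_ ?_ ?_
    · intro x _ y _ hxy
      rw [Prod.ext_iff] at hxy
      exact Prod.ext (Nat.pow_left_injective ha hxy.1) (Nat.pow_left_injective ha hxy.2)
    · intro x hx
      have hx := Nat.mem_divisorsAntidiagonal.1 (Finset.mem_coe.1 hx)
      refine Finset.mem_coe.2 (Nat.mem_divisorsAntidiagonal.2 ⟨?_, pow_ne_zero a hm⟩)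
      rw [← mul_pow, hx.1]
    · rintro ⟨x, y⟩ hxy hne
      by_cases hx : ∃ s, s ^ a = x
      · by_cases hy : ∃ t, t ^ a = y
        · obtain ⟨s, rfl⟩ := hx
          obtain ⟨t, rfl⟩ := hy
          have h1 := (Nat.mem_divisorsAntidiagonal.1 hxy).1
          refine absurd
            ⟨(s, t), Finset.mem_coe.2 (Nat.mem_divisorsAntidiagonal.2 ⟨?_, hm⟩), rfl⟩ hne
          rw [← mul_pow] at h1
          exact Nat.pow_left_injective ha h1
        · push Not at hy
          rw [dirichletSubst_apply_of_ne D' b hy, mul_zero]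
      · push Not at hx
        rw [dirichletSubst_apply_of_ne D b hx, zero_mul]
    · intro x hx
      have hx := Nat.mem_divisorsAntidiagonal.1 hx
      simp only
      rw [dirichletSubst_apply_pow _ ha, dirichletSubst_apply_pow _ ha, ← hx.1, Nat.cast_mul,
        mul_zpow]
      ring
  · push Not at h
    rw [dirichletSubst_apply_of_ne _ b h]
    symm
    refine Finset.sum_eq_zero fun x hx => ?_
    by_cases h1 : ∃ s, s ^ a = x.1
    · by_cases h2 : ∃ t, t ^ a = x.2
      · obtain ⟨s, hs⟩ := h1
        obtain ⟨t, ht⟩ := h2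
        refine absurd ?_ (h (s * t))
        rw [mul_pow, hs, ht]
        exact (Nat.mem_divisorsAntidiagonal.1 hx).1
      · push Not at h2
        rw [dirichletSubst_apply_of_ne D' b h2, mul_zero]
    · push Not at h1
      rw [dirichletSubst_apply_of_ne D b h1, zero_mul]

theorem dirichletSubst_prod {ι : Type*} (S : Finset ι) (D : ι → ArithmeticFunction ℚ) {a : ℕ}
    (ha : a ≠ 0) (b : ℤ) :
    dirichletSubst (∏ i ∈ S, D i) a b = ∏ i ∈ S, dirichletSubst (D i) a b := by
  classical
  induction S using Finset.induction_on with
  | empty => exact dirichletSubst_one ha b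
  | insert i S hi ih =>
    rw [Finset.prod_insert hi, Finset.prod_insert hi, dirichletSubst_mul _ _ ha, ih]

theorem dirichletSubst_eulerSeries {q a : ℕ} (hq : 1 < q) (ha : a ≠ 0) (b : ℕ) {c : ℤ}
    (hc : -c = b) :
    dirichletSubst (eulerSeries q 1 0 : ArithmeticFunction ℚ) a c =
      (eulerSeries q a b : ArithmeticFunction ℚ) := by
  ext n
  rw [ArithmeticFunction.natCoe_apply]
  by_cases h : ∃ k, n = q ^ (k * a)
  · obtain ⟨k, rfl⟩ := h
    have h1 := eulerSeries_apply_pow hq one_ne_zero 0 k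
    rw [mul_one] at h1
    rw [eulerSeries_apply_pow hq ha, pow_mul, dirichletSubst_apply_pow _ ha,
      ArithmeticFunction.natCoe_apply, h1, hc, zpow_natCast]
    push_cast
    rw [mul_zero, pow_zero, one_mul, ← pow_mul]
  · push Not at h
    rw [eulerSeries_apply_of_ne b h, Nat.cast_zero]
    by_cases hm : ∃ m, m ^ a = n
    · obtain ⟨m, rfl⟩ := hm
      rw [dirichletSubst_apply_pow _ ha, ArithmeticFunction.natCoe_apply, eulerSeries_apply_of_ne,
        Nat.cast_zero, zero_mul]
      rintro k rfl
      exact h k (by rw [mul_one, pow_mul])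
    · push Not at hm
      exact dirichletSubst_apply_of_ne _ _ hm

end Subst

section Serre

theorem dirichletMonomial_apply (N m : ℕ) :
    dirichletMonomial N m = if m = N ∧ m ≠ 0 then 1 else 0 := rfl

theorem dirichletMonomial_mul_apply {q : ℕ} (hq : q ≠ 0) (D : ArithmeticFunction ℚ) (n : ℕ) :
    (dirichletMonomial q * D) n = if q ∣ n then D (n / q) else 0 := by
  rcases eq_or_ne n 0 with rfl | hn
  · simp
  rw [ArithmeticFunction.mul_apply]
  split_ifs with h
  · obtain ⟨m, rfl⟩ := h
    rw [Nat.mul_div_cancel_left m (Nat.pos_of_ne_zero hq), Finset.sum_eq_single (q, m)]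
    · rw [dirichletMonomial_apply, if_pos ⟨rfl, hq⟩, one_mul]
    · rintro ⟨x, y⟩ hxy hne
      rw [dirichletMonomial_apply, if_neg, zero_mul]
      rintro ⟨rfl, -⟩
      refine hne (Prod.ext rfl ?_)
      exact Nat.eq_of_mul_eq_mul_left (Nat.pos_of_ne_zero hq)
        (Nat.mem_divisorsAntidiagonal.1 hxy).1
    · intro h
      exact absurd (Nat.mem_divisorsAntidiagonal.2 ⟨rfl, hn⟩) h
  · refine Finset.sum_eq_zero fun x hx => ?_
    rw [dirichletMonomial_apply, if_neg, zero_mul]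
    rintro ⟨h1, -⟩
    exact h ⟨x.2, by rw [← h1]; exact (Nat.mem_divisorsAntidiagonal.1 hx).1.symm⟩

theorem one_sub_dirichletMonomial_mul_eulerSeries {q : ℕ} (hq : 1 < q) :
    (1 - dirichletMonomial q) * (eulerSeries q 1 0 : ArithmeticFunction ℚ) = 1 := by
  have hE : ∀ k, eulerSeries q 1 0 (q ^ k) = 1 := fun k => by
    simpa using eulerSeries_apply_pow hq one_ne_zero 0 k
  rw [sub_mul, one_mul, sub_eq_iff_eq_add]
  ext n
  rw [ArithmeticFunction.add_apply, dirichletMonomial_mul_apply (by omega),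
    ArithmeticFunction.natCoe_apply]
  by_cases h : ∃ k, n = q ^ k
  · obtain ⟨k, rfl⟩ := h
    rw [hE]
    cases k with
    | zero =>
      rw [pow_zero, if_neg fun h => hq.ne' (Nat.dvd_one.1 h)]
      simp
    | succ k =>
      rw [if_pos (dvd_pow_self q k.succ_ne_zero), pow_succ, Nat.mul_div_cancel _ (by omega),
        ArithmeticFunction.natCoe_apply, hE, ArithmeticFunction.one_apply_ne, zero_add]
      rw [← pow_succ]
      exact (Nat.one_lt_pow k.succ_ne_zero hq).ne'
  · push Not at h
    rw [eulerSeries_apply_of_ne 0 fun k => by rw [mul_one]; exact h k,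
      ArithmeticFunction.one_apply_ne fun h1 => h 0 (by rw [h1, pow_zero])]
    split_ifs with hd
    · obtain ⟨m, rfl⟩ := hd
      rw [Nat.mul_div_cancel_left m (by omega), ArithmeticFunction.natCoe_apply,
        eulerSeries_apply_of_ne]
      · simp
      · rintro k rfl
        exact h (k + 1) (by rw [mul_one, pow_succ, mul_comm])
    · simp

theorem Ring.inverse_eq_of_mul_eq_one {R : Type*} [CommRing R] {a b : R} (h : a * b = 1) :
    Ring.inverse a = b := by
  have ha : IsUnit a := IsUnit.of_mul_eq_one b h
  rw [← mul_one (Ring.inverse a), ← h, ← mul_assoc, Ring.inverse_mul_cancel _ ha, one_mul]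

variable {X : Scheme.{u}} [LocallyOfFiniteType (specULiftZIsTerminal.{u}.from X)]

theorem serreFactor_eq_eulerSeries (x : ClosedPt X) :
    serreFactor X x = (eulerSeries (Nat.card (X.residueField x.1)) 1 0 : ArithmeticFunction ℚ) :=
  Ring.inverse_eq_of_mul_eq_one (one_sub_dirichletMonomial_mul_eulerSeries
    (Scheme.one_lt_natCard_residueField x.2))

theorem serreFactor_apply_of_lt (x : ClosedPt X) {n : ℕ}
    (hn : n < Nat.card (X.residueField x.1)) :
    serreFactor X x n = (1 : ArithmeticFunction ℚ) n := by
  rw [serreFactor_eq_eulerSeries, ArithmeticFunction.natCoe_apply,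
    eulerSeries_apply_of_lt (Scheme.one_lt_natCard_residueField x.2) one_ne_zero 0
      (by rwa [pow_one]), ArithmeticFunction.one_apply, ArithmeticFunction.one_apply]
  split_ifs <;> simp

variable [CompactSpace X]

variable (X) in
/-- The closed points with residue field of at most `N` elements. -/
noncomputable def closedPointsUpTo (N : ℕ) : Finset (ClosedPt X) :=
  (Scheme.finite_setOf_natCard_residueField_le (X := X) N).toFinset

theorem mem_closedPointsUpTo {N : ℕ} {x : ClosedPt X} :
    x ∈ closedPointsUpTo X N ↔ Nat.card (X.residueField x.1) ≤ N := by
  simp [closedPointsUpTo]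

theorem serreFactor_apply_of_notMem {N : ℕ} {x : ClosedPt X} (hx : x ∉ closedPointsUpTo X N)
    {n : ℕ} (hn : n ≤ N) : serreFactor X x n = (1 : ArithmeticFunction ℚ) n := by
  rw [mem_closedPointsUpTo] at hx
  exact serreFactor_apply_of_lt x (by omega)

theorem hasDirichletProd_serreZeta : HasDirichletProd (serreFactor X) (serreZeta X) :=
  hasDirichletProd_dirichletProd_of_finite (closedPointsUpTo X) fun _ _ hx _ hn =>
    serreFactor_apply_of_notMem hx hn

theorem serreZeta_apply {n N : ℕ} (hn : n ≤ N) :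
    serreZeta X n = (∏ x ∈ closedPointsUpTo X N, serreFactor X x) n :=
  hasDirichletProd_serreZeta.apply_eq (fun _ hx _ hn => serreFactor_apply_of_notMem hx hn) hn

/-- Up to order `N`, only the closed points with residue field of at most `N` elements contribute to
the factors on the right hand side of the product formula. -/
theorem dirichletSubst_serreZeta_apply {d n j N : ℕ} (hd : d ≠ 0) (hn : n ≠ 0) (hj : j ≤ d) {m : ℕ}
    (hm : m ≤ N) :
    dirichletSubst (serreZeta X) (n * d) ((j : ℤ) - (n : ℤ) * d) m =
      (∏ x ∈ closedPointsUpTo X N, (eulerSeries (Nat.card (X.residueField x.1)) (n * d)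
        (n * d - j) : ArithmeticFunction ℚ)) m := by
  rw [dirichletSubst_apply_congr (fun m hm => serreZeta_apply hm) _ _ hm,
    dirichletSubst_prod _ _ (mul_ne_zero hn hd)]
  congr 1
  refine Finset.prod_congr rfl fun x _ => ?_
  rw [serreFactor_eq_eulerSeries]
  refine dirichletSubst_eulerSeries (Scheme.one_lt_natCard_residueField x.2)
    (mul_ne_zero hn hd) _ ?_
  rw [Nat.cast_sub (hj.trans (Nat.le_mul_of_pos_left d (Nat.pos_of_ne_zero hn)))]
  push_cast
  ring

theorem prod_Icc_one_eq_prod_range {M : Type*} [CommMonoid M] (d : ℕ) (f : ℕ → M) :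
    ∏ j ∈ Finset.Icc 1 d, f j = ∏ j ∈ Finset.range d, f (d - j) := by
  refine Finset.prod_nbij' (fun j => d - j) (fun j => d - j) ?_ ?_ ?_ ?_ ?_
  · intro j hj
    rw [Finset.mem_Icc] at hj
    rw [Finset.mem_range]
    omega
  · intro j hj
    rw [Finset.mem_range] at hj
    rw [Finset.mem_Icc]
    omega
  · intro j hj
    rw [Finset.mem_Icc] at hj
    omega
  · intro j hj
    rw [Finset.mem_range] at hj
    omega
  · intro j hj
    rw [Finset.mem_Icc] at hj
    congr 1
    omega

/-- The product formula for the zeta function of an Azumaya algebra. -/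
theorem hasDirichletProd_zeta [IsIntegral X]
    (hreg : ∀ x : X, IsRegularLocalRing (X.presheaf.stalk x))
    (hdim : topologicalKrullDim X = 2) {𝒜 : AlgebraSheaf X} {d : ℕ} (hd : d ≠ 0)
    (h𝒜 : 𝒜.IsAzumayaOfDegree d) :
    HasDirichletProd
      (fun n : ℕ+ => ∏ j ∈ Finset.Icc 1 d,
        dirichletSubst (serreZeta X) (n * d) ((j : ℤ) - (n : ℤ) * d)) 𝒜.zeta := by
  classical
  intro N
  -- up to order `N`, the factors with `n > N` are equal to `1`
  let T₀ : Finset ℕ+ := (Finset.range N).map ⟨Nat.succPNat, Nat.succPNat_injective⟩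
  filter_upwards [Filter.eventually_ge_atTop T₀] with T hT
  let E : ClosedPt X → ℕ → ℕ → ArithmeticFunction ℚ := fun x n j =>
    (eulerSeries (Nat.card (X.residueField x.1)) (n * d) (n * d - j) : ArithmeticFunction ℚ)
  have h1 : ∀ n ∈ T, ∀ m ≤ N, (∏ j ∈ Finset.Icc 1 d,
      dirichletSubst (serreZeta X) (n * d) ((j : ℤ) - (n : ℤ) * d)) m =
      (∏ j ∈ Finset.Icc 1 d, ∏ x ∈ closedPointsUpTo X N, E x n j) m := fun n _ m hm =>
    ArithmeticFunction.prod_apply_congr _ (fun j hj m hm => dirichletSubst_serreZeta_apply hd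
      n.ne_zero (Finset.mem_Icc.1 hj).2 hm) hm
  have h2 : ∀ n ∈ T, n ∉ T₀ → ∀ m ≤ N,
      (∏ j ∈ Finset.Icc 1 d, ∏ x ∈ closedPointsUpTo X N, E x n j) m =
        (1 : ArithmeticFunction ℚ) m := by
    intro n _ hn m hm
    have hnN : N < n := by
      by_contra hle
      refine hn (Finset.mem_map.2 ⟨(n : ℕ).pred, Finset.mem_range.2 ?_, PNat.succPNat_natPred n⟩)
      have := n.pos
      simp only [Nat.pred_eq_sub_one]
      omega
    rw [ArithmeticFunction.prod_apply_congr (N := N) (g := fun _ => 1) _ (fun j _ m hm => ?_) hm,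
      Finset.prod_const_one]
    rw [ArithmeticFunction.prod_apply_congr (N := N) (g := fun _ => 1) _ (fun x _ m hm => ?_) hm,
      Finset.prod_const_one]
    have hq := Scheme.one_lt_natCard_residueField x.2
    rw [ArithmeticFunction.natCoe_apply, eulerSeries_apply_of_lt hq (mul_ne_zero n.ne_zero hd)]
    · rw [ArithmeticFunction.one_apply, ArithmeticFunction.one_apply]
      split_ifs <;> simp
    · calc m < n := by omega
        _ ≤ n * d := Nat.le_mul_of_pos_right _ (Nat.pos_of_ne_zero hd)
        _ < _ := Nat.lt_pow_self hq
  rw [ArithmeticFunction.prod_apply_congr T h1 le_rfl,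
    ArithmeticFunction.prod_apply_eq_of_subset hT _ h2 le_rfl,
    AlgebraSheaf.zeta_apply hreg hdim h𝒜 le_rfl (closedPointsUpTo X N)
      (fun x hx => mem_closedPointsUpTo.2 hx), ← ArithmeticFunction.natCoe_apply]
  congr 1
  rw [ArithmeticFunction.natCoe_prod, Finset.prod_map]
  simp only [Finset.prod_comm (s := Finset.Icc 1 d)]
  rw [Finset.prod_comm]
  refine Finset.prod_congr rfl fun x _ => ?_
  -- the local factor with indices `i`, `j` belongs to the Serre zeta function with indices `i + 1`,
  -- `d - j`
  rw [localZeta, ArithmeticFunction.natCoe_prod]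
  refine Finset.prod_congr rfl fun i _ => ?_
  rw [ArithmeticFunction.natCoe_prod, prod_Icc_one_eq_prod_range]
  refine Finset.prod_congr rfl fun j hj => ?_
  have hj := Finset.mem_range.1 hj
  have e1 : ((⟨Nat.succPNat, Nat.succPNat_injective⟩ : ℕ ↪ ℕ+) i : ℕ) = i + 1 := rfl
  have e2 : (i + 1) * d - (d - j) = d * i + j := by
    rw [add_mul, one_mul, mul_comm i d]
    omega
  simp only [E, e1, e2]
  rw [mul_comm (i + 1) d]

end Serre

end OrderZeta

/-! ### Power series as Dirichlet series supported at the powers of a prime power -/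

namespace OrderZeta

section PowerSeries

/-- The Dirichlet series `∑ₙ aₙ (q ^ n) ^ (-s)` obtained from the power series `∑ₙ aₙ t ^ n` by the
substitution `t = q ^ (-s)`. -/
noncomputable def toDirichlet (q : ℕ) (f : PowerSeries ℚ) : ArithmeticFunction ℚ :=
  ⟨fun n => ∑ k ∈ Finset.range n, if n = q ^ k then PowerSeries.coeff k f else 0, rfl⟩

variable {q : ℕ}

theorem toDirichlet_apply_pow (hq : 1 < q) (f : PowerSeries ℚ) (k : ℕ) :
    toDirichlet q f (q ^ k) = PowerSeries.coeff k f := by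
  change ∑ l ∈ Finset.range (q ^ k), _ = _
  rw [Finset.sum_eq_single k]
  · exact if_pos rfl
  · intro l _ hl
    exact if_neg fun h => hl (Nat.pow_right_injective hq h).symm
  · intro h
    exact absurd (Finset.mem_range.2 (Nat.lt_pow_self hq)) h

theorem toDirichlet_apply_of_ne (f : PowerSeries ℚ) {n : ℕ} (h : ∀ k, n ≠ q ^ k) :
    toDirichlet q f n = 0 := by
  change ∑ k ∈ Finset.range n, _ = _
  exact Finset.sum_eq_zero fun k _ => if_neg (h k)

theorem eq_toDirichlet (hq : 1 < q) {D : ArithmeticFunction ℚ} {f : PowerSeries ℚ}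
    (h : ∀ k, D (q ^ k) = PowerSeries.coeff k f) (h0 : ∀ n, (∀ k, n ≠ q ^ k) → D n = 0) :
    D = toDirichlet q f := by
  ext n
  by_cases hn : ∃ k, n = q ^ k
  · obtain ⟨k, rfl⟩ := hn
    rw [h, toDirichlet_apply_pow hq]
  · push Not at hn
    rw [h0 n hn, toDirichlet_apply_of_ne _ hn]

theorem toDirichlet_X_pow (hq : 1 < q) (e : ℕ) :
    toDirichlet q (PowerSeries.X ^ e) = dirichletMonomial (q ^ e) := by
  refine (eq_toDirichlet hq (fun k => ?_) fun n hn => ?_).symm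
  · rw [dirichletMonomial_apply, PowerSeries.coeff_X_pow]
    refine if_congr ⟨fun h => Nat.pow_right_injective hq h.1, ?_⟩ rfl rfl
    rintro rfl
    exact ⟨rfl, (pow_pos (by omega) _).ne'⟩
  · exact if_neg fun h => hn e h.1

theorem toDirichlet_one (hq : 1 < q) : toDirichlet q 1 = 1 := by
  refine (eq_toDirichlet hq (fun k => ?_) fun n hn => ?_).symm
  · rw [ArithmeticFunction.one_apply, PowerSeries.coeff_one]
    exact if_congr (Nat.pow_eq_one.trans (or_iff_right (by omega))) rfl rfl
  · exact ArithmeticFunction.one_apply_ne fun h => hn 0 (by rw [h, pow_zero])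

theorem toDirichlet_sub (hq : 1 < q) (f g : PowerSeries ℚ) :
    toDirichlet q (f - g) = toDirichlet q f - toDirichlet q g := by
  refine (eq_toDirichlet hq (fun k => ?_) fun n hn => ?_).symm
  · rw [sub_eq_add_neg, ArithmeticFunction.add_apply, ArithmeticFunction.neg_apply,
      toDirichlet_apply_pow hq, toDirichlet_apply_pow hq, map_sub, sub_eq_add_neg]
  · rw [sub_eq_add_neg, ArithmeticFunction.add_apply, ArithmeticFunction.neg_apply,
      toDirichlet_apply_of_ne _ hn, toDirichlet_apply_of_ne _ hn, neg_zero, add_zero]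

theorem toDirichlet_mul (hq : 1 < q) (f g : PowerSeries ℚ) :
    toDirichlet q (f * g) = toDirichlet q f * toDirichlet q g := by
  refine (eq_toDirichlet hq (fun k => ?_) fun n hn => ?_).symm
  · rw [ArithmeticFunction.mul_apply, PowerSeries.coeff_mul]
    symm
    refine Finset.sum_of_injOn (fun x => (q ^ x.1, q ^ x.2)) ?_ ?_ ?_ ?_
    · intro x _ y _ hxy
      rw [Prod.ext_iff] at hxy
      exact Prod.ext (Nat.pow_right_injective hq hxy.1) (Nat.pow_right_injective hq hxy.2)
    · intro x hx
      have hx := Finset.HasAntidiagonal.mem_antidiagonal.1 (Finset.mem_coe.1 hx)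
      refine Finset.mem_coe.2 (Nat.mem_divisorsAntidiagonal.2 ⟨?_, (pow_pos (by omega) _).ne'⟩)
      rw [← pow_add, hx]
    · rintro ⟨x, y⟩ hxy hne
      by_cases hx : ∃ s, x = q ^ s
      · by_cases hy : ∃ t, y = q ^ t
        · obtain ⟨s, rfl⟩ := hx
          obtain ⟨t, rfl⟩ := hy
          have h1 := (Nat.mem_divisorsAntidiagonal.1 hxy).1
          refine absurd ⟨(s, t),
            Finset.mem_coe.2 (Finset.HasAntidiagonal.mem_antidiagonal.2 ?_), rfl⟩ hne
          rw [← pow_add] at h1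
          exact Nat.pow_right_injective hq h1
        · push Not at hy
          rw [toDirichlet_apply_of_ne g hy, mul_zero]
      · push Not at hx
        rw [toDirichlet_apply_of_ne f hx, zero_mul]
    · intro x _
      simp only
      rw [toDirichlet_apply_pow hq, toDirichlet_apply_pow hq]
  · rw [ArithmeticFunction.mul_apply]
    refine Finset.sum_eq_zero fun x hx => ?_
    by_cases h1 : ∃ s, x.1 = q ^ s
    · by_cases h2 : ∃ t, x.2 = q ^ t
      · obtain ⟨s, hs⟩ := h1
        obtain ⟨t, ht⟩ := h2
        refine absurd ?_ (hn (s + t))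
        rw [pow_add, ← hs, ← ht]
        exact (Nat.mem_divisorsAntidiagonal.1 hx).1.symm
      · push Not at h2
        rw [toDirichlet_apply_of_ne g h2, mul_zero]
    · push Not at h1
      rw [toDirichlet_apply_of_ne f h1, zero_mul]

theorem toDirichlet_prod (hq : 1 < q) {ι : Type*} (S : Finset ι) (f : ι → PowerSeries ℚ) :
    toDirichlet q (∏ i ∈ S, f i) = ∏ i ∈ S, toDirichlet q (f i) := by
  classical
  induction S using Finset.induction_on with
  | empty => exact toDirichlet_one hq
  | insert i S hi ih => rw [Finset.prod_insert hi, Finset.prod_insert hi, toDirichlet_mul hq, ih]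

theorem hasPowerProd_of_hasDirichletProd (hq : 1 < q) {ι : Type*} {f : ι → PowerSeries ℚ}
    {F : PowerSeries ℚ}
    (h : HasDirichletProd (fun i => toDirichlet q (f i)) (toDirichlet q F)) : HasPowerProd f F := by
  intro n
  filter_upwards [h (q ^ n)] with S hS
  rw [← toDirichlet_prod hq, toDirichlet_apply_pow hq, toDirichlet_apply_pow hq] at hS
  exact hS

theorem HasPowerProd.unique {ι : Type*} {f : ι → PowerSeries ℚ} {F G : PowerSeries ℚ}
    (hF : HasPowerProd f F) (hG : HasPowerProd f G) : F = G := by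
  ext n
  obtain ⟨S, h1, h2⟩ := ((hF n).and (hG n)).exists
  exact h1.symm.trans h2

theorem HasPowerProd.powerProd_eq {ι : Type*} {f : ι → PowerSeries ℚ} {F : PowerSeries ℚ}
    (hF : HasPowerProd f F) : powerProd f = F := by
  have h : ∃ F, HasPowerProd f F := ⟨F, hF⟩
  rw [powerProd, dif_pos h]
  exact h.choose_spec.unique hF

/-- An infinite product of Dirichlet series coming from power series comes from a power series. -/
theorem HasDirichletProd.exists_eq_toDirichlet (hq : 1 < q) {ι : Type*} {f : ι → PowerSeries ℚ}
    {D : ArithmeticFunction ℚ} (h : HasDirichletProd (fun i => toDirichlet q (f i)) D) :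
    ∃ F, D = toDirichlet q F := by
  refine ⟨PowerSeries.mk fun k => D (q ^ k), eq_toDirichlet hq (fun k => ?_) fun n hn => ?_⟩
  · rw [PowerSeries.coeff_mk]
  · obtain ⟨S, hS⟩ := (h n).exists
    rw [← hS, ← toDirichlet_prod hq, toDirichlet_apply_of_ne _ hn]

theorem coeff_subst_C_mul_X_pow (f : PowerSeries ℚ) (c : ℚ) {a : ℕ} (ha : a ≠ 0) (n : ℕ) :
    PowerSeries.coeff n (f.subst (PowerSeries.C c * PowerSeries.X ^ a : PowerSeries ℚ)) =
      if a ∣ n then PowerSeries.coeff (n / a) f * c ^ (n / a) else 0 := by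
  have hs : PowerSeries.HasSubst (PowerSeries.C c * PowerSeries.X ^ a : PowerSeries ℚ) :=
    PowerSeries.HasSubst.of_constantCoeff_zero' (by simp [ha])
  rw [PowerSeries.coeff_subst' hs]
  have h1 : ∀ k, PowerSeries.coeff n ((PowerSeries.C c * PowerSeries.X ^ a : PowerSeries ℚ) ^ k) =
      if n = a * k then c ^ k else 0 := fun k => by
    rw [mul_pow, ← map_pow, ← pow_mul, PowerSeries.coeff_C_mul, PowerSeries.coeff_X_pow]
    simp
  simp only [h1]
  split_ifs with h
  · obtain ⟨k, rfl⟩ := h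
    rw [Nat.mul_div_cancel_left k (Nat.pos_of_ne_zero ha), finsum_eq_single _ k]
    · rw [if_pos rfl, smul_eq_mul]
    · intro l hl
      rw [if_neg, smul_zero]
      exact fun h => hl (Nat.eq_of_mul_eq_mul_left (Nat.pos_of_ne_zero ha) h).symm
  · refine finsum_eq_zero_of_forall_eq_zero fun k => ?_
    rw [if_neg, smul_zero]
    rintro rfl
    exact h (dvd_mul_right a k)

/-- Under `t = q ^ (-s)`, the substitution of `q ^ (-b) t ^ a` for `t` becomes that of `a s + b` for
`s`. -/
theorem toDirichlet_subst (hq : 1 < q) (f : PowerSeries ℚ) {a : ℕ} (ha : a ≠ 0) (b : ℤ) :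
    toDirichlet q (f.subst (PowerSeries.C ((q : ℚ) ^ (-b)) * PowerSeries.X ^ a : PowerSeries ℚ)) =
      dirichletSubst (toDirichlet q f) a b := by
  refine (eq_toDirichlet hq (fun k => ?_) fun n hn => ?_).symm
  · rw [coeff_subst_C_mul_X_pow _ _ ha]
    split_ifs with h
    · obtain ⟨l, rfl⟩ := h
      rw [mul_comm a l, pow_mul, dirichletSubst_apply_pow _ ha, toDirichlet_apply_pow hq,
        Nat.mul_div_cancel l (Nat.pos_of_ne_zero ha), Nat.cast_pow, ← zpow_natCast, ← zpow_natCast,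
        ← zpow_mul, ← zpow_mul, mul_comm (l : ℤ)]
    · by_cases hm : ∃ m, m ^ a = q ^ k
      · obtain ⟨m, hm⟩ := hm
        rw [← hm, dirichletSubst_apply_pow _ ha, toDirichlet_apply_of_ne, zero_mul]
        rintro l rfl
        rw [← pow_mul] at hm
        exact h ⟨l, by rw [mul_comm]; exact (Nat.pow_right_injective hq hm).symm⟩
      · push Not at hm
        exact dirichletSubst_apply_of_ne _ _ hm
  · by_cases hm : ∃ m, m ^ a = n
    · obtain ⟨m, rfl⟩ := hm
      rw [dirichletSubst_apply_pow _ ha, toDirichlet_apply_of_ne, zero_mul]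
      rintro l rfl
      exact hn (l * a) (pow_mul q l a).symm
    · push Not at hm
      exact dirichletSubst_apply_of_ne _ _ hm

end PowerSeries

/-! ### Schemes over a finite field -/

section FiniteField

variable {X : Scheme.{u}} {k : Type u} [Field k] (f : X ⟶ Spec (CommRingCat.of k))

theorem natCard_residueField_eq_pow (x : X) [Finite (X.residueField x)] :
    Nat.card (X.residueField x) = Nat.card k ^ pointDegree f x := by
  let : Algebra k (X.residueField x) := ((X.Γevaluation x).hom.comp (baseHom f)).toAlgebra
  exact Module.natCard_eq_pow_finrank

theorem AlgebraSheaf.LeftIdeal.card_eq_pow_dim {𝒜 : AlgebraSheaf X} (I : 𝒜.LeftIdeal)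
    [Finite I.Quot] : I.card = Nat.card k ^ I.dim f := by
  let : Module k I.Quot := Module.compHom I.Quot (𝒜.baseToStalks f)
  exact Module.natCard_eq_pow_finrank

variable [LocallyOfFiniteType (specULiftZIsTerminal.{u}.from X)] [Finite k]

theorem toDirichlet_serreZFactor (x : ClosedPt X) :
    toDirichlet (Nat.card k) (serreZFactor f x) = serreFactor X x := by
  have := Scheme.finite_residueField_of_isClosed x.2
  have hq : 1 < Nat.card k := Finite.one_lt_card
  have h1 := natCard_residueField_eq_pow f x.1
  have h2 := Scheme.one_lt_natCard_residueField x.2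
  have h3 : pointDegree f x.1 ≠ 0 := fun h => by
    rw [h1, h, pow_zero] at h2
    exact lt_irrefl _ h2
  rw [serreFactor]
  symm
  refine Ring.inverse_eq_of_mul_eq_one ?_
  rw [h1, ← toDirichlet_X_pow hq, ← toDirichlet_one hq, ← toDirichlet_sub hq, ← toDirichlet_mul hq,
    serreZFactor, PowerSeries.mul_inv_cancel _ (by simp [h3])]

/-- The Serre zeta function in the variable `t` exists, and becomes the one in the variable `s`
under `t = q ^ (-s)`. -/
theorem hasPowerProd_serreZ_and_eq [CompactSpace X] : HasPowerProd (serreZFactor f) (serreZ f) ∧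
    toDirichlet (Nat.card k) (serreZ f) = serreZeta X := by
  have hq : 1 < Nat.card k := Finite.one_lt_card
  have h1 : HasDirichletProd (fun x => toDirichlet (Nat.card k) (serreZFactor f x))
      (serreZeta X) := by
    simp only [toDirichlet_serreZFactor]
    exact hasDirichletProd_serreZeta
  obtain ⟨F, hF⟩ := h1.exists_eq_toDirichlet hq
  rw [hF] at h1
  have h2 := hasPowerProd_of_hasDirichletProd hq h1
  have h3 : serreZ f = F := h2.powerProd_eq
  rw [h3, hF]
  exact ⟨h2, rfl⟩

theorem idealsOfDim_eq {𝒜 : AlgebraSheaf X} {d : ℕ} (h𝒜 : 𝒜.IsAzumayaOfDegree d) (n : ℕ) :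
    𝒜.idealsOfDim f n = 𝒜.idealsOfCard (Nat.card k ^ n) := by
  have hq : 1 < Nat.card k := Finite.one_lt_card
  ext I
  refine and_congr_right fun hI => ?_
  have := hI.finite_quot h𝒜
  rw [I.card_eq_pow_dim f]
  exact (Nat.pow_right_injective hq).eq_iff.symm

theorem toDirichlet_zetaZ {𝒜 : AlgebraSheaf X} {d : ℕ} (h𝒜 : 𝒜.IsAzumayaOfDegree d) :
    toDirichlet (Nat.card k) (𝒜.zetaZ f) = 𝒜.zeta := by
  have hq : 1 < Nat.card k := Finite.one_lt_card
  refine (eq_toDirichlet hq (fun n => ?_) fun n hn => ?_).symm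
  · rw [AlgebraSheaf.zetaZ, PowerSeries.coeff_mk, idealsOfDim_eq f h𝒜]
    exact if_neg (pow_pos (by omega) n).ne'
  · change (if n = 0 then 0 else ((𝒜.idealsOfCard n).ncard : ℚ)) = 0
    have h1 : 𝒜.idealsOfCard n = ∅ := by
      refine Set.eq_empty_of_forall_notMem fun I hI => ?_
      have := hI.1.finite_quot h𝒜
      exact hn _ (hI.2.symm.trans (I.card_eq_pow_dim f))
    rw [h1]
    simp

end FiniteField

end OrderZeta

theorem mainTheorem5 (X : Scheme.{u}) [IsIntegral X] [CompactSpace X]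
    [LocallyOfFiniteType (specULiftZIsTerminal.{u}.from X)]
    (hreg : ∀ x : X, IsRegularLocalRing (X.presheaf.stalk x))
    (hdim : topologicalKrullDim X = 2)
    (𝒜 : OrderZeta.AlgebraSheaf X) (d : ℕ) (h𝒜 : 𝒜.IsAzumayaOfDegree d) :
    -- the two zeta functions are well defined
    (∀ n : ℕ, (𝒜.idealsOfCard n).Finite) ∧
    OrderZeta.HasDirichletProd (OrderZeta.serreFactor X) (OrderZeta.serreZeta X) ∧
    -- the product formula, with `n d (s - 1) + j = (n d) s + (j - n d)`
    OrderZeta.HasDirichletProd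
      (fun n : ℕ+ => ∏ j ∈ Finset.Icc 1 d,
        OrderZeta.dirichletSubst (OrderZeta.serreZeta X) (n * d) ((j : ℤ) - (n : ℤ) * d))
      𝒜.zeta ∧
    -- the case of a scheme over a finite field
    ∀ (k : Type u) [Field k] [Finite k] (f : X ⟶ Spec (CommRingCat.of k)),
      (∀ n : ℕ, (𝒜.idealsOfDim f n).Finite) ∧
      OrderZeta.HasPowerProd (OrderZeta.serreZFactor f) (OrderZeta.serreZ f) ∧
      OrderZeta.HasPowerProd
        (fun n : ℕ+ => ∏ j ∈ Finset.Icc 1 d,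
          (OrderZeta.serreZ f).subst
            (PowerSeries.C ((Nat.card k : ℚ) ^ (-(j : ℤ))) *
              (PowerSeries.C (Nat.card k : ℚ) * PowerSeries.X) ^ (d * (n : ℕ)) : PowerSeries ℚ))
        (𝒜.zetaZ f) := by
  have hd : d ≠ 0 := by
    obtain ⟨x⟩ : Nonempty X := inferInstance
    obtain ⟨U, hU, hxU, -⟩ := X.exists_isAffineOpen_mem_le (V := ⊤) (x := x) trivial
    have : Nonempty U := ⟨⟨x, hxU⟩⟩
    have := h𝒜.azumaya U hU
    exact Nat.one_le_iff_ne_zero.1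
      (IsAzumaya.one_le_of_rankAtStalk_eq (𝒜.sections U) (h𝒜.rank U hU))
  have hzeta := OrderZeta.hasDirichletProd_zeta hreg hdim hd h𝒜
  refine ⟨OrderZeta.AlgebraSheaf.finite_idealsOfCard hreg hdim h𝒜,
    OrderZeta.hasDirichletProd_serreZeta, hzeta, fun k _ _ f => ⟨fun n => ?_,
    (OrderZeta.hasPowerProd_serreZ_and_eq f).1, ?_⟩⟩
  · rw [OrderZeta.idealsOfDim_eq f h𝒜]
    exact OrderZeta.AlgebraSheaf.finite_idealsOfCard hreg hdim h𝒜 _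
  · have hq : 1 < Nat.card k := Finite.one_lt_card
    refine OrderZeta.hasPowerProd_of_hasDirichletProd hq ?_
    rw [OrderZeta.toDirichlet_zetaZ f h𝒜]
    convert hzeta using 2 with n
    rw [OrderZeta.toDirichlet_prod hq]
    refine Finset.prod_congr rfl fun j _ => ?_
    -- `q ^ (-j) (q t) ^ (d n) = q ^ (n d - j) t ^ (n d)`
    have h1 : (PowerSeries.C ((Nat.card k : ℚ) ^ (-(j : ℤ))) *
        (PowerSeries.C (Nat.card k : ℚ) * PowerSeries.X) ^ (d * (n : ℕ)) : PowerSeries ℚ) =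
        PowerSeries.C ((Nat.card k : ℚ) ^ (-((j : ℤ) - ((n : ℕ) : ℤ) * d))) *
          PowerSeries.X ^ ((n : ℕ) * d) := by
      rw [mul_pow, ← mul_assoc, ← map_pow, ← map_mul, ← zpow_natCast,
        ← zpow_add₀ (by exact_mod_cast (by omega : Nat.card k ≠ 0)), mul_comm d]
      congr 3
      push_cast
      ring
    rw [h1, OrderZeta.toDirichlet_subst hq _ (Nat.mul_ne_zero n.ne_zero hd),
      (OrderZeta.hasPowerProd_serreZ_and_eq f).2]
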